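/- Consider the phase space of quadruples of smooth real functions $(K_1,K_2,E^1,E^2)$ of $x\in\mathbb R$ with $E^1>0$ and $E^2$ nowhere zero, with Poisson brackets $\{K_1(x),E^1(y)\}=2G\,\delta(x,y)$, $\{K_2(x),E^2(y)\}=G\,\delta(x,y)$, $G>0$. Put $f[N]=\int f N\,dx$, $$H_x=\tfrac1{2G}\left(-K_1\partial_xE^1+2E^2\partial_xK_2\right),\quad S=\frac{E^1}{(E^2)^2},$$ $$s_1=E^1,\quad s_2=K_2,\quad s_3=\frac{K_1}{E^2},\quad s_4=\frac{\partial_xE^1}{E^2},\quad s_5=\frac{\partial_xs_4}{E^2}.$$ For $H_{\rm eff}=E^2F(s_1,\dots,s_5)$, with $F$ smooth and real on $\{s_1>0\}$, and a function $\mu$ on phase space that is a smooth function of finitely many derivatives of the fields, consider: (a) closure: for all smooth compactly supported smearing functions, $$\{H_x[N_1],H_x[N_2]\}=H_x[N_1\partial_xN_2-N_2\partial_xN_1],\qquad \{H_{\rm eff}[N],H_x[N^x]\}=-H_{\rm eff}[N^x\partial_xN],$$ $$\{H_{\rm eff}[N_1],H_{\rm eff}[N_2]\}=H_x[\mu S(N_1\partial_xN_2-N_2\partial_xN_1)];$$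 (b) covariance conditions: $H_{\rm eff}$ does not depend on $\partial_x^nK_1$, $n\ge1$, and $\alpha\{\mu S,H_{\rm eff}[N]\}=\{\mu S,H_{\rm eff}[\alpha N]\}$ for all smooth phase space independent $\alpha,N$; (c) nondegeneracy (the branch that contains the classical constraint, for which $\mu=1$): $\mu$ does not vanish identically on any nonempty open set of values of the fields and their derivatives. 1. If (a), (b), (c) hold, then $\mu=\mu(s_1,s_2,s_4)$ is a smooth function of $s_1,s_2,s_4$, and there is a smooth function $M_{\rm eff}(s_1,s_2,s_4)$ on $\{s_1>0\}$ such that $(\partial_{s_4}M_{\rm eff})/s_4$ extends smoothly through $s_4=0$, such that $$\frac{\mu s_1s_4}{4G^2}=(\partial_{s_2}M_{\rm eff})\,\partial_{s_2}\partial_{s_4}M_{\rm eff}-(\partial_{s_4}M_{\rm eff})\,\partial_{s_2}^2M_{\rm eff},\qquad (\partial_{s_2}\mu)\,\partial_{s_4}M_{\rm eff}-(\partial_{s_4}\mu)\,\partial_{s_2}M_{\rm eff}=0,$$ and such that $$H_{\rm eff}=-2E^2\left[\partial_{s_1}M_{\rm eff}+\frac{\partial_{s_2}M_{\rm eff}}{2}s_3+\frac{\partial_{s_4}M_{\rm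 eff}}{s_4}s_5+\mathcal R\right],$$ where $\mathcal R$ is a smooth function of $(s_1,s_2,s_4)$ on $\{s_1>0\}$ that has the form $\mathcal R=\mathcal R(s_1,M_{\rm eff})$, with a smooth function of two variables, on every open set $V$ of points $(s_1,s_2,s_4)$ with $s_1>0$ and $(\partial_{s_2}M_{\rm eff},\partial_{s_4}M_{\rm eff})\neq(0,0)$ in which, for each fixed $s_1$, the level sets of $M_{\rm eff}$ are connected. Every point with $s_1>0$ and $(\partial_{s_2}M_{\rm eff},\partial_{s_4}M_{\rm eff})\ne(0,0)$ has such a neighbourhood $V$. 2. Conversely, let $M_{\rm eff}$ and $\mu$ be any smooth functions of $(s_1,s_2,s_4)$ on $\{s_1>0\}$ that solve the two covariance equations above, with $(\partial_{s_4}M_{\rm eff})/s_4$ smooth through $s_4=0$. Then for every $\mathcal R$ of the form described in 1, in particular for $\mathcal R(s_1,M_{\rm eff})$ with an arbitrary smooth function $\mathcal R$ on $(0,\infty)\times\mathbb R$, the constraint $H_{\rm eff}$ given by the formula satisfies (a) and (b) with this $\mu$. 3. In the situation of 2 with $\mathcal R=0$, $M_{\rm eff}$ is a Dirac observable: $\{M_{\rm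 eff}(x),H_{\rm eff}[N]+H_x[N^x]\}=0$ on the constraint surface $H_{\rm eff}=H_x=0$, for all smooth $N,N^x$ and all $x$. -/

import Mathlib

open scoped ContDiff

noncomputable section

namespace EffGrav

/-! ### Phase space of the spherically symmetric model -/

/-- Names of the four canonical fields `K_1, K_2, E^1, E^2`. -/
inductive Var
  | K1 | K2 | E1 | E2
  deriving DecidableEq

instance : Fintype Var where
  elems := {.K1, .K2, .E1, .E2}
  complete := by intro i; cases i <;> simp

/-- A quadruple of real functions of the radial coordinate `x ∈ ℝ`. -/
abbrev Fields := Var → ℝ → ℝ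

/-- Points of phase space: smooth fields with `E^1 > 0` and `E^2` nowhere zero. -/
structure IsPhasePoint (φ : Fields) : Prop where
  smooth : ∀ i, ContDiff ℝ ∞ (φ i)
  E1_pos : ∀ x, 0 < φ .E1 x
  E2_ne : ∀ x, φ .E2 x ≠ 0

/-- Jets of order `k`: `j i n` stands for the `n`-th `x`-derivative of the field `i`. -/
abbrev Jet (k : ℕ) := Var → Fin (k + 1) → ℝ

/-- Jets of points of phase space. -/
def admissible (k : ℕ) : Set (Jet k) := {j | 0 < j .E1 0 ∧ j .E2 0 ≠ 0}

/-- The `k`-jet of the fields `φ` at `x`. A function `f : Jet k → ℝ` is used as the local phase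
space function `x ↦ f (jet k φ x)`. -/
def jet (k : ℕ) (φ : Fields) (x : ℝ) : Jet k := fun i n => iteratedDeriv n (φ i) x

/-! ### Poisson brackets of local functions -/

/-- The partial derivative of `f` with respect to `∂_x^n φ_i`. -/
def pd {k : ℕ} (f : Jet k → ℝ) (i : Var) (n : Fin (k + 1)) (j : Jet k) : ℝ :=
  fderiv ℝ f j (Pi.single i (Pi.single n 1))

/-- The smeared functional `f[N] = ∫ f(x) N(x) dx`. -/
def smear {k : ℕ} (f : Jet k → ℝ) (N : ℝ → ℝ) (φ : Fields) : ℝ :=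
  ∫ x, f (jet k φ x) * N x

/-- The variational derivative
`δ f[N] / δ φ_i (x) = ∑_n (-1)^n ∂_x^n (N ∂f/∂(∂_x^n φ_i))`. -/
def varDeriv {k : ℕ} (f : Jet k → ℝ) (N : ℝ → ℝ) (φ : Fields) (i : Var) (x : ℝ) : ℝ :=
  ∑ n : Fin (k + 1),
    (-1) ^ (n : ℕ) * iteratedDeriv n (fun y => N y * pd f i n (jet k φ y)) x

/-- The Hamiltonian vector field `{φ_i(x), f[N]}` for
`{K_1(x), E^1(y)} = 2 G δ(x,y)` and `{K_2(x), E^2(y)} = G δ(x,y)`. -/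
def hamVec (G : ℝ) {k : ℕ} (f : Jet k → ℝ) (N : ℝ → ℝ) (φ : Fields) : Fields
  | .K1 => fun x => 2 * G * varDeriv f N φ .E1 x
  | .E1 => fun x => -(2 * G * varDeriv f N φ .K1 x)
  | .K2 => fun x => G * varDeriv f N φ .E2 x
  | .E2 => fun x => -(G * varDeriv f N φ .K2 x)

/-- The bracket `{f(x), h[N]}`: the derivative of the local function `f` at `x` along the
Hamiltonian vector field of `h[N]`. -/
def bracketAt (G : ℝ) {k l : ℕ} (f : Jet k → ℝ) (h : Jet l → ℝ) (N : ℝ → ℝ) (φ : Fields)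
    (x : ℝ) : ℝ :=
  ∑ i : Var, ∑ n : Fin (k + 1), pd f i n (jet k φ x) * iteratedDeriv n (hamVec G h N φ i) x

/-- The bracket `{f[N], h[M]}` of two smeared functionals. -/
def bracket (G : ℝ) {k l : ℕ} (f : Jet k → ℝ) (N : ℝ → ℝ) (h : Jet l → ℝ) (M : ℝ → ℝ)
    (φ : Fields) : ℝ :=
  ∫ x, (2 * G * (varDeriv f N φ .K1 x * varDeriv h M φ .E1 x
          - varDeriv f N φ .E1 x * varDeriv h M φ .K1 x)
      + G * (varDeriv f N φ .K2 x * varDeriv h M φ .E2 x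
          - varDeriv f N φ .E2 x * varDeriv h M φ .K2 x))

/-! ### Constraints -/

/-- The diffeomorphism constraint `H_x = (-K_1 ∂_x E^1 + 2 E^2 ∂_x K_2) / (2G)`. -/
def diffeo (G : ℝ) (j : Jet 1) : ℝ :=
  1 / (2 * G) * (-(j .K1 0 * j .E1 1) + 2 * j .E2 0 * j .K2 1)

/-- The classical structure function `S = E^1 / (E^2)^2`. -/
def structS {k : ℕ} (j : Jet k) : ℝ := j .E1 0 / (j .E2 0) ^ 2

/-- The basic scalar `s_1 = E^1`. -/
def s1 (j : Jet 2) : ℝ := j .E1 0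
/-- The basic scalar `s_2 = K_2`. -/
def s2 (j : Jet 2) : ℝ := j .K2 0
/-- The basic scalar `s_3 = K_1 / E^2`. -/
def s3 (j : Jet 2) : ℝ := j .K1 0 / j .E2 0
/-- The basic scalar `s_4 = ∂_x E^1 / E^2`. -/
def s4 (j : Jet 2) : ℝ := j .E1 1 / j .E2 0
/-- The basic scalar `s_5 = ∂_x s_4 / E^2`, see `s5_jet`. -/
def s5 (j : Jet 2) : ℝ :=
  (j .E1 2 * j .E2 0 - j .E1 1 * j .E2 1) / (j .E2 0) ^ 2 / j .E2 0

theorem s5_jet (φ : Fields) (hφ : IsPhasePoint φ) (x : ℝ) :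
    s5 (jet 2 φ x) = deriv (fun y => s4 (jet 2 φ y)) x / φ .E2 x := by
  have h1 : Differentiable ℝ (deriv (φ .E1)) := by
    have := (hφ.smooth .E1).differentiable_iteratedDeriv 1 (by norm_cast)
    simpa [iteratedDeriv_one] using this
  have h2 : Differentiable ℝ (φ .E2) := (hφ.smooth .E2).differentiable (by simp)
  have e : (fun y => s4 (jet 2 φ y)) = fun y => deriv (φ .E1) y / φ .E2 y := by
    funext y; simp [s4, jet, iteratedDeriv_one]
  rw [e, deriv_fun_div (h1 x) (h2 x) (hφ.E2_ne x)]
  simp [s5, jet, iteratedDeriv_succ]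

/-- The effective Hamiltonian constraint `H_eff = E^2 F(s_1, …, s_5)`. -/
def heff (F : ℝ → ℝ → ℝ → ℝ → ℝ → ℝ) (j : Jet 2) : ℝ :=
  j .E2 0 * F (s1 j) (s2 j) (s3 j) (s4 j) (s5 j)

/-- Smearing functions. -/
def IsTest (N : ℝ → ℝ) : Prop := ContDiff ℝ ∞ N ∧ HasCompactSupport N

/-- The deformed constraint algebra with modification factor `μ`. -/
structure ClosedAlgebra (G : ℝ) {k : ℕ} (h : Jet 2 → ℝ) (μ : Jet k → ℝ) : Prop where
  diffeo_diffeo : ∀ φ, IsPhasePoint φ → ∀ N₁ N₂, IsTest N₁ → IsTest N₂ →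
    bracket G (diffeo G) N₁ (diffeo G) N₂ φ
      = smear (diffeo G) (fun x => N₁ x * deriv N₂ x - N₂ x * deriv N₁ x) φ
  ham_diffeo : ∀ φ, IsPhasePoint φ → ∀ N M, IsTest N → IsTest M →
    bracket G h N (diffeo G) M φ = -smear h (fun x => M x * deriv N x) φ
  ham_ham : ∀ φ, IsPhasePoint φ → ∀ N₁ N₂, IsTest N₁ → IsTest N₂ →
    bracket G h N₁ h N₂ φ
      = smear (diffeo G) (fun x => μ (jet k φ x) * structS (jet k φ x)
          * (N₁ x * deriv N₂ x - N₂ x * deriv N₁ x)) φ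

/-- The covariance conditions: (i) `H_eff` is independent of `∂_x^n K_1`, `n ≥ 1`;
(ii) `α {μ S, H_eff[N]} = {μ S, H_eff[α N]}` for all phase space independent `α`, `N`. -/
structure CovarianceConditions (G : ℝ) {k : ℕ} (h : Jet 2 → ℝ) (μ : Jet k → ℝ) : Prop where
  indep : ∀ j ∈ admissible 2, ∀ n : Fin 3, n ≠ 0 → pd h .K1 n j = 0
  bracket_eq : ∀ φ, IsPhasePoint φ → ∀ α N : ℝ → ℝ, ContDiff ℝ ∞ α → ContDiff ℝ ∞ N → ∀ x,
    α x * bracketAt G (fun j => μ j * structS j) h N φ x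
      = bracketAt G (fun j => μ j * structS j) h (fun y => α y * N y) φ x

/-- `O` is a Dirac observable: its brackets with all `H_eff[N] + H_x[N^x]` vanish on the
constraint surface. -/
def IsDiracObservable (G : ℝ) {k : ℕ} (h : Jet 2 → ℝ) (O : Jet k → ℝ) : Prop :=
  ∀ φ, IsPhasePoint φ → (∀ x, h (jet 2 φ x) = 0) → (∀ x, diffeo G (jet 1 φ x) = 0) →
    ∀ N Nx : ℝ → ℝ, ContDiff ℝ ∞ N → ContDiff ℝ ∞ Nx → ∀ x,
      bracketAt G O h N φ x + bracketAt G O (diffeo G) Nx φ x = 0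

/-! ### Functions of the basic scalars -/

/-- Smooth functions `F(s_1, …, s_5)` on `s_1 > 0`. -/
def Smooth5 (F : ℝ → ℝ → ℝ → ℝ → ℝ → ℝ) : Prop :=
  ContDiffOn ℝ ∞ (fun q : ℝ × ℝ × ℝ × ℝ × ℝ => F q.1 q.2.1 q.2.2.1 q.2.2.2.1 q.2.2.2.2)
    {q | 0 < q.1}

/-- Smooth functions of `(s_1, s_2, s_4)` on `s_1 > 0`. -/
def Smooth3 (M : ℝ → ℝ → ℝ → ℝ) : Prop :=
  ContDiffOn ℝ ∞ (fun q : ℝ × ℝ × ℝ => M q.1 q.2.1 q.2.2) {q | 0 < q.1}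

/-- `∂/∂s_1` of a function of `(s_1, s_2, s_4)`. -/
def d1 (M : ℝ → ℝ → ℝ → ℝ) : ℝ → ℝ → ℝ → ℝ := fun a b c => deriv (fun t => M t b c) a
/-- `∂/∂s_2` of a function of `(s_1, s_2, s_4)`. -/
def d2 (M : ℝ → ℝ → ℝ → ℝ) : ℝ → ℝ → ℝ → ℝ := fun a b c => deriv (fun t => M a t c) b
/-- `∂/∂s_4` of a function of `(s_1, s_2, s_4)`. -/
def d4 (M : ℝ → ℝ → ℝ → ℝ) : ℝ → ℝ → ℝ → ℝ := fun a b c => deriv (fun t => M a b t) c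

/-- The covariance equations for `M(s_1, s_2, s_4)` and `μ(s_1, s_2, s_4)`. -/
structure CovarianceEquations (G : ℝ) (M μ : ℝ → ℝ → ℝ → ℝ) : Prop where
  eq_mu : ∀ a b c, 0 < a →
    μ a b c * a * c / (4 * G ^ 2) = d2 M a b c * d2 (d4 M) a b c - d4 M a b c * d2 (d2 M) a b c
  eq_dmu : ∀ a b c, 0 < a → d2 μ a b c * d4 M a b c - d4 μ a b c * d2 M a b c = 0

/-- `P` is the function `(∂_{s_4} M) / s_4`, extended smoothly through `s_4 = 0`. -/
def IsQuotient (M P : ℝ → ℝ → ℝ → ℝ) : Prop :=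
  Smooth3 P ∧ ∀ a b c, 0 < a → d4 M a b c = c * P a b c

/-- `-2 [∂_{s_1} M + (∂_{s_2} M / 2) s_3 + P s_5 + B]`, with `P = ∂_{s_4} M / s_4`. -/
def massForm (M P B : ℝ → ℝ → ℝ → ℝ) (a b z c w : ℝ) : ℝ :=
  -2 * (d1 M a b c + d2 M a b c / 2 * z + P a b c * w + B a b c)

/-- The points `(s_1, s_2, s_4)` with `s_1 > 0` that are not critical for `M(s_1, ·, ·)`. -/
def regularSet (M : ℝ → ℝ → ℝ → ℝ) : Set (ℝ × ℝ × ℝ) :=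
  {q | 0 < q.1 ∧ (d2 M q.1 q.2.1 q.2.2 ≠ 0 ∨ d4 M q.1 q.2.1 q.2.2 ≠ 0)}

/-- Open sets of regular points in which the level curves of all `M(s_1, ·, ·)` are connected. -/
structure IsLevelDomain (M : ℝ → ℝ → ℝ → ℝ) (V : Set (ℝ × ℝ × ℝ)) : Prop where
  isOpen : IsOpen V
  regular : V ⊆ regularSet M
  connected : ∀ a m : ℝ, IsPreconnected {q ∈ V | q.1 = a ∧ M q.1 q.2.1 q.2.2 = m}

/-- On `V`, the function `B` is `R(s_1, M)` for a smooth function `R` of two variables. -/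
def IsFunctionOf (M B : ℝ → ℝ → ℝ → ℝ) (V : Set (ℝ × ℝ × ℝ)) : Prop :=
  ∃ R : ℝ → ℝ → ℝ,
    ContDiffOn ℝ ∞ (fun p : ℝ × ℝ => R p.1 p.2)
      ((fun q : ℝ × ℝ × ℝ => (q.1, M q.1 q.2.1 q.2.2)) '' V) ∧
    ∀ q ∈ V, B q.1 q.2.1 q.2.2 = R q.1 (M q.1 q.2.1 q.2.2)

/-- `B` is a smooth function of `(s_1, s_2, s_4)` of the form `R(s_1, M)`, with one function `R`
for each domain in which the level curves of `M(s_1, ·, ·)` are connected. In particular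
`B = R(s_1, M)` is allowed for every smooth function `R` on `(0, ∞) × ℝ`. -/
def IsRTerm (M B : ℝ → ℝ → ℝ → ℝ) : Prop :=
  Smooth3 B ∧ ∀ V, IsLevelDomain M V → IsFunctionOf M B V

theorem isRTerm_comp (M : ℝ → ℝ → ℝ → ℝ) (hM : Smooth3 M) (R : ℝ → ℝ → ℝ)
    (hR : ContDiffOn ℝ ∞ (fun p : ℝ × ℝ => R p.1 p.2) {p | 0 < p.1}) :
    IsRTerm M fun a b c => R a (M a b c) := by
  constructor
  · exact hR.comp (t := {p : ℝ × ℝ | 0 < p.1})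
      (f := fun q : ℝ × ℝ × ℝ => (q.1, M q.1 q.2.1 q.2.2))
      (contDiff_fst.contDiffOn.prodMk hM) (fun q hq => hq)
  · intro V hV
    refine ⟨R, hR.mono ?_, fun q _ => rfl⟩
    rintro _ ⟨q, hq, rfl⟩
    exact (hV.regular hq).1

end EffGrav

end

open scoped ContDiff

noncomputable section

namespace EffGrav

/-! ### Partial derivatives of functions of three and five variables -/

/-! Write F_i for the derivative of F in s_i and D = (1/E^2) ∂_x. Then D s_1 = s_4 and D s_4 = s_5,
while D s_2, D s_3, D s_5 are new jet coordinates u, v, y, independent of s_1, …, s_5. After one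
integration by parts, the bracket of H_eff[N_1] and H_eff[N_2] is the integral of G · C · (N_1 N_2'
− N_2 N_1') with C = −2 F_3 F_4 + s_4 F_2 F_5 + 2 (F_3 D F_5 − F_5 D F_3) (`bracket_heff_heff`).
Wronskians of test functions separate continuous functions, so closure is the pointwise identity 2
G^2 C = μ s_1 (2u − s_3 s_4) (`ham_ham_iff`), whose two sides are compared as polynomials in u, v,
y.

The u-coefficient expresses μ by 2 (F_3 ∂_2 F_5 − F_5 ∂_2 F_3) (`ClosedAlgebra.mu_eq`), so
nondegeneracy says that this determinant is nonzero on a dense set. The covariance condition, tested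
where the smearing function vanishes, gives a homogeneous linear system for ∂_3 μ and ∂_5 μ with the
same determinant; hence both vanish (`muOf_indep`). The v- and y-coefficients make the s_3- and
s_5-derivatives of the vector (F_3, F_5) parallel to that vector. Combined with ∂_3 μ = ∂_5 μ = 0
they are also parallel to ∂_2 (F_3, F_5), so they are zero where the determinant is not, and by
density everywhere (`eq_zero_of_minors`, `eq_lin_of_covariant`). Thus F = f0 + f3 s_3 + f5 s_5 with
coefficients depending on s_1, s_2, s_4.

The rest of closure at u = s_3 s_4 / 2 contains s_4 ∂_2 f5 = 2 ∂_4 f3. This is the integrability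
condition for the form −f3 ds_2 − (s_4 f5 / 2) ds_4, and its primitive at fixed s_1 is the mass
function M (`exists_mass`). Writing f0 = −2 (∂_1 M + B), the last closure equation says that B and M
have vanishing Jacobian in (s_2, s_4). In level coordinates (s_1, M, coordinate) this means that B
is constant along connected level curves (`isRTerm_of_commute`). The remaining covariance equation
says the same of μ and M.

The converse runs the same identities backwards (`clos_massForm`, `covarianceConditions_massForm`),
with `IsRTerm.commute` supplying the vanishing Jacobian. For B = 0, both D M on H_x = 0 and the
evolution of M are multiples of the constraint, so M is a Dirac observable. -/

theorem fderiv_apply_eq_of_hasDerivAt {E : Type*} [NormedAddCommGroup E] [NormedSpace ℝ E]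
    {f : E → ℝ} {x v : E} {L : ℝ} (hf : DifferentiableAt ℝ f x)
    (h : HasDerivAt (fun t : ℝ => f (x + t • v)) L 0) : fderiv ℝ f x v = L := by
  have h0 : HasDerivAt (fun t : ℝ => x + t • v) v 0 := by
    simpa using ((hasDerivAt_id (0 : ℝ)).smul_const v).const_add x
  have h1 : HasFDerivAt f (fderiv ℝ f x) (x + (0 : ℝ) • v) := by
    simpa using hf.hasFDerivAt
  exact (h1.comp_hasDerivAt (0 : ℝ) h0).unique h

theorem contDiffOn_fderiv_apply {E : Type*} [NormedAddCommGroup E] [NormedSpace ℝ E]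
    {f : E → ℝ} {S : Set E} (hS : IsOpen S) (hf : ContDiffOn ℝ ∞ f S) (v : E) :
    ContDiffOn ℝ ∞ (fun x => fderiv ℝ f x v) S :=
  (hf.fderiv_of_isOpen hS (by simp)).clm_apply contDiffOn_const

theorem fderiv_fderiv_comm {E : Type*} [NormedAddCommGroup E] [NormedSpace ℝ E]
    {f : E → ℝ} {S : Set E} (hS : IsOpen S) (hf : ContDiffOn ℝ ∞ f S) {x : E} (hx : x ∈ S)
    (v w : E) :
    fderiv ℝ (fun y => fderiv ℝ f y v) x w = fderiv ℝ (fun y => fderiv ℝ f y w) x v := by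
  have hc : ContDiffAt ℝ ∞ f x := hf.contDiffAt (hS.mem_nhds hx)
  have hd : DifferentiableAt ℝ (fderiv ℝ f) x :=
    ((hf.fderiv_of_isOpen (m := ∞) hS (by simp)).differentiableOn (by simp)).differentiableAt
      (hS.mem_nhds hx)
  have hs : IsSymmSndFDerivAt ℝ f x := hc.isSymmSndFDerivAt
    (by rw [minSmoothness_of_isRCLikeNormedField]; exact WithTop.coe_le_coe.2 (le_top : (2 : ℕ∞) ≤ ⊤))
  rw [fderiv_clm_apply hd (differentiableAt_const v), fderiv_clm_apply hd (differentiableAt_const w)]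
  simpa using hs.eq w v

/-- `F(s_1, …, s_5)` as a function on a product space. -/
def unc5 (F : ℝ → ℝ → ℝ → ℝ → ℝ → ℝ) : ℝ × ℝ × ℝ × ℝ × ℝ → ℝ :=
  fun q => F q.1 q.2.1 q.2.2.1 q.2.2.2.1 q.2.2.2.2

/-- `M(s_1, s_2, s_4)` as a function on a product space. -/
def unc3 (M : ℝ → ℝ → ℝ → ℝ) : ℝ × ℝ × ℝ → ℝ := fun q => M q.1 q.2.1 q.2.2

theorem isOpen_pos_fst {X : Type*} [TopologicalSpace X] : IsOpen {q : ℝ × X | 0 < q.1} :=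
  isOpen_lt continuous_const continuous_fst

/-- `∂/∂s_1` of a function of `(s_1, …, s_5)`. -/
def p1 (F : ℝ → ℝ → ℝ → ℝ → ℝ → ℝ) : ℝ → ℝ → ℝ → ℝ → ℝ → ℝ :=
  fun a b z c w => deriv (fun t => F t b z c w) a
/-- `∂/∂s_2` of a function of `(s_1, …, s_5)`. -/
def p2 (F : ℝ → ℝ → ℝ → ℝ → ℝ → ℝ) : ℝ → ℝ → ℝ → ℝ → ℝ → ℝ :=
  fun a b z c w => deriv (fun t => F a t z c w) b
/-- `∂/∂s_3` of a function of `(s_1, …, s_5)`. -/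
def p3 (F : ℝ → ℝ → ℝ → ℝ → ℝ → ℝ) : ℝ → ℝ → ℝ → ℝ → ℝ → ℝ :=
  fun a b z c w => deriv (fun t => F a b t c w) z
/-- `∂/∂s_4` of a function of `(s_1, …, s_5)`. -/
def p4 (F : ℝ → ℝ → ℝ → ℝ → ℝ → ℝ) : ℝ → ℝ → ℝ → ℝ → ℝ → ℝ :=
  fun a b z c w => deriv (fun t => F a b z t w) c
/-- `∂/∂s_5` of a function of `(s_1, …, s_5)`. -/
def p5 (F : ℝ → ℝ → ℝ → ℝ → ℝ → ℝ) : ℝ → ℝ → ℝ → ℝ → ℝ → ℝ :=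
  fun a b z c w => deriv (fun t => F a b z c t) w

section five

variable {F : ℝ → ℝ → ℝ → ℝ → ℝ → ℝ} {a b z c w : ℝ}

theorem Smooth5.differentiableAt (hF : Smooth5 F) (ha : 0 < a) :
    DifferentiableAt ℝ (unc5 F) (a, b, z, c, w) :=
  (ContDiffOn.differentiableOn hF (by simp)).differentiableAt (isOpen_pos_fst.mem_nhds ha)

theorem Smooth5.p1_eq (hF : Smooth5 F) (ha : 0 < a) :
    p1 F a b z c w = fderiv ℝ (unc5 F) (a, b, z, c, w) (1, 0, 0, 0, 0) := by
  have h : HasDerivAt (fun t : ℝ => (t, b, z, c, w)) ((1, 0, 0, 0, 0) : ℝ × ℝ × ℝ × ℝ × ℝ) a :=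
    (hasDerivAt_id a).prodMk (hasDerivAt_const _ _)
  exact ((hF.differentiableAt ha).hasFDerivAt.comp_hasDerivAt a h).deriv

theorem Smooth5.p2_eq (hF : Smooth5 F) (ha : 0 < a) :
    p2 F a b z c w = fderiv ℝ (unc5 F) (a, b, z, c, w) (0, 1, 0, 0, 0) := by
  have h : HasDerivAt (fun t : ℝ => (a, t, z, c, w)) ((0, 1, 0, 0, 0) : ℝ × ℝ × ℝ × ℝ × ℝ) b :=
    (hasDerivAt_const _ _).prodMk ((hasDerivAt_id b).prodMk (hasDerivAt_const _ _))
  exact ((hF.differentiableAt ha).hasFDerivAt.comp_hasDerivAt b h).deriv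

theorem Smooth5.p3_eq (hF : Smooth5 F) (ha : 0 < a) :
    p3 F a b z c w = fderiv ℝ (unc5 F) (a, b, z, c, w) (0, 0, 1, 0, 0) := by
  have h : HasDerivAt (fun t : ℝ => (a, b, t, c, w)) ((0, 0, 1, 0, 0) : ℝ × ℝ × ℝ × ℝ × ℝ) z :=
    (hasDerivAt_const _ _).prodMk ((hasDerivAt_const _ _).prodMk
      ((hasDerivAt_id z).prodMk (hasDerivAt_const _ _)))
  exact ((hF.differentiableAt ha).hasFDerivAt.comp_hasDerivAt z h).deriv

theorem Smooth5.p4_eq (hF : Smooth5 F) (ha : 0 < a) :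
    p4 F a b z c w = fderiv ℝ (unc5 F) (a, b, z, c, w) (0, 0, 0, 1, 0) := by
  have h : HasDerivAt (fun t : ℝ => (a, b, z, t, w)) ((0, 0, 0, 1, 0) : ℝ × ℝ × ℝ × ℝ × ℝ) c :=
    (hasDerivAt_const _ _).prodMk ((hasDerivAt_const _ _).prodMk
      ((hasDerivAt_const _ _).prodMk ((hasDerivAt_id c).prodMk (hasDerivAt_const _ _))))
  exact ((hF.differentiableAt ha).hasFDerivAt.comp_hasDerivAt c h).deriv

theorem Smooth5.p5_eq (hF : Smooth5 F) (ha : 0 < a) :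
    p5 F a b z c w = fderiv ℝ (unc5 F) (a, b, z, c, w) (0, 0, 0, 0, 1) := by
  have h : HasDerivAt (fun t : ℝ => (a, b, z, c, t)) ((0, 0, 0, 0, 1) : ℝ × ℝ × ℝ × ℝ × ℝ) w :=
    (hasDerivAt_const _ _).prodMk ((hasDerivAt_const _ _).prodMk
      ((hasDerivAt_const _ _).prodMk ((hasDerivAt_const _ _).prodMk (hasDerivAt_id w))))
  exact ((hF.differentiableAt ha).hasFDerivAt.comp_hasDerivAt w h).deriv

theorem Smooth5.p2 (hF : Smooth5 F) : Smooth5 (p2 F) :=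
  (contDiffOn_fderiv_apply isOpen_pos_fst hF (0, 1, 0, 0, 0)).congr fun _ hq => hF.p2_eq hq
theorem Smooth5.p3 (hF : Smooth5 F) : Smooth5 (p3 F) :=
  (contDiffOn_fderiv_apply isOpen_pos_fst hF (0, 0, 1, 0, 0)).congr fun _ hq => hF.p3_eq hq
theorem Smooth5.p4 (hF : Smooth5 F) : Smooth5 (p4 F) :=
  (contDiffOn_fderiv_apply isOpen_pos_fst hF (0, 0, 0, 1, 0)).congr fun _ hq => hF.p4_eq hq
theorem Smooth5.p5 (hF : Smooth5 F) : Smooth5 (p5 F) :=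
  (contDiffOn_fderiv_apply isOpen_pos_fst hF (0, 0, 0, 0, 1)).congr fun _ hq => hF.p5_eq hq

/-- The exchange is needed when the s_2-derivative of a closure equation is compared with the
s_3-derivative of the determinant `closU F`. -/
theorem Smooth5.p3_p2 (hF : Smooth5 F) (ha : 0 < a) :
    EffGrav.p3 (EffGrav.p2 F) a b z c w = EffGrav.p2 (EffGrav.p3 F) a b z c w := by
  rw [hF.p2.p3_eq ha, hF.p3.p2_eq ha]
  have h2 : unc5 (EffGrav.p2 F) =ᶠ[nhds (a, b, z, c, w)]
      fun q => fderiv ℝ (unc5 F) q (0, 1, 0, 0, 0) :=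
    Filter.eventuallyEq_of_mem (isOpen_pos_fst.mem_nhds ha) fun q hq => hF.p2_eq hq
  have h3 : unc5 (EffGrav.p3 F) =ᶠ[nhds (a, b, z, c, w)]
      fun q => fderiv ℝ (unc5 F) q (0, 0, 1, 0, 0) :=
    Filter.eventuallyEq_of_mem (isOpen_pos_fst.mem_nhds ha) fun q hq => hF.p3_eq hq
  rw [h2.fderiv_eq, h3.fderiv_eq]
  exact fderiv_fderiv_comm isOpen_pos_fst hF ha _ _

theorem Smooth5.p5_p2 (hF : Smooth5 F) (ha : 0 < a) :
    EffGrav.p5 (EffGrav.p2 F) a b z c w = EffGrav.p2 (EffGrav.p5 F) a b z c w := by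
  rw [hF.p2.p5_eq ha, hF.p5.p2_eq ha]
  have h2 : unc5 (EffGrav.p2 F) =ᶠ[nhds (a, b, z, c, w)]
      fun q => fderiv ℝ (unc5 F) q (0, 1, 0, 0, 0) :=
    Filter.eventuallyEq_of_mem (isOpen_pos_fst.mem_nhds ha) fun q hq => hF.p2_eq hq
  have h3 : unc5 (EffGrav.p5 F) =ᶠ[nhds (a, b, z, c, w)]
      fun q => fderiv ℝ (unc5 F) q (0, 0, 0, 0, 1) :=
    Filter.eventuallyEq_of_mem (isOpen_pos_fst.mem_nhds ha) fun q hq => hF.p5_eq hq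
  rw [h2.fderiv_eq, h3.fderiv_eq]
  exact fderiv_fderiv_comm isOpen_pos_fst hF ha _ _

theorem Smooth5.hasDerivAt_comp (hF : Smooth5 F) {x : ℝ} {α β γ δ ε : ℝ → ℝ}
    {α' β' γ' δ' ε' : ℝ} (hα : HasDerivAt α α' x) (hβ : HasDerivAt β β' x)
    (hγ : HasDerivAt γ γ' x) (hδ : HasDerivAt δ δ' x) (hε : HasDerivAt ε ε' x)
    (hx : 0 < α x) :
    HasDerivAt (fun t => F (α t) (β t) (γ t) (δ t) (ε t))
      (EffGrav.p1 F (α x) (β x) (γ x) (δ x) (ε x) * α'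
        + EffGrav.p2 F (α x) (β x) (γ x) (δ x) (ε x) * β'
        + EffGrav.p3 F (α x) (β x) (γ x) (δ x) (ε x) * γ'
        + EffGrav.p4 F (α x) (β x) (γ x) (δ x) (ε x) * δ'
        + EffGrav.p5 F (α x) (β x) (γ x) (δ x) (ε x) * ε') x := by
  have h := (hF.differentiableAt (b := β x) (z := γ x) (c := δ x) (w := ε x)
    hx).hasFDerivAt.comp_hasDerivAt x (hα.prodMk (hβ.prodMk (hγ.prodMk (hδ.prodMk hε))))
  have e : ((α', β', γ', δ', ε') : ℝ × ℝ × ℝ × ℝ × ℝ) = α' • (1, 0, 0, 0, 0)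
      + β' • (0, 1, 0, 0, 0) + γ' • (0, 0, 1, 0, 0) + δ' • (0, 0, 0, 1, 0)
      + ε' • (0, 0, 0, 0, 1) := by simp
  rw [hF.p1_eq hx, hF.p2_eq hx, hF.p3_eq hx, hF.p4_eq hx, hF.p5_eq hx]
  refine h.congr_deriv ?_
  rw [e]
  simp only [map_add, map_smul, smul_eq_mul]
  ring

end five

section three

variable {M : ℝ → ℝ → ℝ → ℝ} {a b c : ℝ}

theorem Smooth3.differentiableAt (hM : Smooth3 M) (ha : 0 < a) :
    DifferentiableAt ℝ (unc3 M) (a, b, c) :=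
  (ContDiffOn.differentiableOn hM (by simp)).differentiableAt (isOpen_pos_fst.mem_nhds ha)

theorem Smooth3.d1_eq (hM : Smooth3 M) (ha : 0 < a) :
    d1 M a b c = fderiv ℝ (unc3 M) (a, b, c) (1, 0, 0) := by
  have h : HasDerivAt (fun t : ℝ => (t, b, c)) ((1, 0, 0) : ℝ × ℝ × ℝ) a :=
    (hasDerivAt_id a).prodMk (hasDerivAt_const _ _)
  exact ((hM.differentiableAt ha).hasFDerivAt.comp_hasDerivAt a h).deriv

theorem Smooth3.d2_eq (hM : Smooth3 M) (ha : 0 < a) :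
    d2 M a b c = fderiv ℝ (unc3 M) (a, b, c) (0, 1, 0) := by
  have h : HasDerivAt (fun t : ℝ => (a, t, c)) ((0, 1, 0) : ℝ × ℝ × ℝ) b :=
    (hasDerivAt_const _ _).prodMk ((hasDerivAt_id b).prodMk (hasDerivAt_const _ _))
  exact ((hM.differentiableAt ha).hasFDerivAt.comp_hasDerivAt b h).deriv

theorem Smooth3.d4_eq (hM : Smooth3 M) (ha : 0 < a) :
    d4 M a b c = fderiv ℝ (unc3 M) (a, b, c) (0, 0, 1) := by
  have h : HasDerivAt (fun t : ℝ => (a, b, t)) ((0, 0, 1) : ℝ × ℝ × ℝ) c :=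
    (hasDerivAt_const _ _).prodMk ((hasDerivAt_const _ _).prodMk (hasDerivAt_id c))
  exact ((hM.differentiableAt ha).hasFDerivAt.comp_hasDerivAt c h).deriv

theorem Smooth3.d1 (hM : Smooth3 M) : Smooth3 (d1 M) :=
  (contDiffOn_fderiv_apply isOpen_pos_fst hM (1, 0, 0)).congr fun _ hq => hM.d1_eq hq
theorem Smooth3.d2 (hM : Smooth3 M) : Smooth3 (d2 M) :=
  (contDiffOn_fderiv_apply isOpen_pos_fst hM (0, 1, 0)).congr fun _ hq => hM.d2_eq hq
theorem Smooth3.d4 (hM : Smooth3 M) : Smooth3 (d4 M) :=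
  (contDiffOn_fderiv_apply isOpen_pos_fst hM (0, 0, 1)).congr fun _ hq => hM.d4_eq hq

theorem Smooth3.eventuallyEq_d1 (hM : Smooth3 M) (ha : 0 < a) :
    unc3 (EffGrav.d1 M) =ᶠ[nhds (a, b, c)] fun q => fderiv ℝ (unc3 M) q (1, 0, 0) :=
  Filter.eventuallyEq_of_mem (isOpen_pos_fst.mem_nhds ha) fun _ hq => hM.d1_eq hq
theorem Smooth3.eventuallyEq_d2 (hM : Smooth3 M) (ha : 0 < a) :
    unc3 (EffGrav.d2 M) =ᶠ[nhds (a, b, c)] fun q => fderiv ℝ (unc3 M) q (0, 1, 0) :=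
  Filter.eventuallyEq_of_mem (isOpen_pos_fst.mem_nhds ha) fun _ hq => hM.d2_eq hq
theorem Smooth3.eventuallyEq_d4 (hM : Smooth3 M) (ha : 0 < a) :
    unc3 (EffGrav.d4 M) =ᶠ[nhds (a, b, c)] fun q => fderiv ℝ (unc3 M) q (0, 0, 1) :=
  Filter.eventuallyEq_of_mem (isOpen_pos_fst.mem_nhds ha) fun _ hq => hM.d4_eq hq

theorem Smooth3.d2_d4 (hM : Smooth3 M) (ha : 0 < a) :
    EffGrav.d2 (EffGrav.d4 M) a b c = EffGrav.d4 (EffGrav.d2 M) a b c := by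
  rw [hM.d4.d2_eq ha, hM.d2.d4_eq ha, (hM.eventuallyEq_d2 ha).fderiv_eq,
    (hM.eventuallyEq_d4 ha).fderiv_eq]
  exact fderiv_fderiv_comm isOpen_pos_fst hM ha _ _

theorem Smooth3.d1_d2 (hM : Smooth3 M) (ha : 0 < a) :
    EffGrav.d1 (EffGrav.d2 M) a b c = EffGrav.d2 (EffGrav.d1 M) a b c := by
  rw [hM.d2.d1_eq ha, hM.d1.d2_eq ha, (hM.eventuallyEq_d2 ha).fderiv_eq,
    (hM.eventuallyEq_d1 ha).fderiv_eq]
  exact fderiv_fderiv_comm isOpen_pos_fst hM ha _ _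

theorem Smooth3.d1_d4 (hM : Smooth3 M) (ha : 0 < a) :
    EffGrav.d1 (EffGrav.d4 M) a b c = EffGrav.d4 (EffGrav.d1 M) a b c := by
  rw [hM.d4.d1_eq ha, hM.d1.d4_eq ha, (hM.eventuallyEq_d4 ha).fderiv_eq,
    (hM.eventuallyEq_d1 ha).fderiv_eq]
  exact fderiv_fderiv_comm isOpen_pos_fst hM ha _ _

theorem Smooth3.hasDerivAt_comp (hM : Smooth3 M) {x : ℝ} {α β γ : ℝ → ℝ}
    {α' β' γ' : ℝ} (hα : HasDerivAt α α' x) (hβ : HasDerivAt β β' x)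
    (hγ : HasDerivAt γ γ' x) (hx : 0 < α x) :
    HasDerivAt (fun t => M (α t) (β t) (γ t))
      (EffGrav.d1 M (α x) (β x) (γ x) * α' + EffGrav.d2 M (α x) (β x) (γ x) * β'
        + EffGrav.d4 M (α x) (β x) (γ x) * γ') x := by
  have h := (hM.differentiableAt (b := β x) (c := γ x)
    hx).hasFDerivAt.comp_hasDerivAt x (hα.prodMk (hβ.prodMk hγ))
  have e : ((α', β', γ') : ℝ × ℝ × ℝ) = α' • (1, 0, 0) + β' • (0, 1, 0) + γ' • (0, 0, 1) := by
    simp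
  rw [hM.d1_eq hx, hM.d2_eq hx, hM.d4_eq hx]
  refine h.congr_deriv ?_
  rw [e]
  simp only [map_add, map_smul, smul_eq_mul]
  ring

theorem Smooth3.hasDerivAt_d1 (hM : Smooth3 M) (ha : 0 < a) :
    HasDerivAt (fun t => M t b c) (EffGrav.d1 M a b c) a := by
  simpa using hM.hasDerivAt_comp (hasDerivAt_id a) (hasDerivAt_const a b) (hasDerivAt_const a c) ha
theorem Smooth3.hasDerivAt_d2 (hM : Smooth3 M) (ha : 0 < a) :
    HasDerivAt (fun t => M a t c) (EffGrav.d2 M a b c) b := by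
  simpa using hM.hasDerivAt_comp (hasDerivAt_const b a) (hasDerivAt_id b) (hasDerivAt_const b c) ha
theorem Smooth3.hasDerivAt_d4 (hM : Smooth3 M) (ha : 0 < a) :
    HasDerivAt (fun t => M a b t) (EffGrav.d4 M a b c) c := by
  simpa using hM.hasDerivAt_comp (hasDerivAt_const c a) (hasDerivAt_const c b) (hasDerivAt_id c) ha

theorem d1_congr {M' : ℝ → ℝ → ℝ → ℝ} (h : ∀ a b c, 0 < a → M a b c = M' a b c) (ha : 0 < a) :
    EffGrav.d1 M a b c = EffGrav.d1 M' a b c :=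
  Filter.EventuallyEq.deriv_eq (Filter.eventuallyEq_of_mem (Ioi_mem_nhds ha)
    fun t ht => h t b c ht)
theorem d2_congr {M' : ℝ → ℝ → ℝ → ℝ} (h : ∀ a b c, 0 < a → M a b c = M' a b c) (ha : 0 < a) :
    EffGrav.d2 M a b c = EffGrav.d2 M' a b c := by
  simp only [EffGrav.d2, h a _ c ha]
theorem d4_congr {M' : ℝ → ℝ → ℝ → ℝ} (h : ∀ a b c, 0 < a → M a b c = M' a b c) (ha : 0 < a) :
    EffGrav.d4 M a b c = EffGrav.d4 M' a b c := by
  simp only [EffGrav.d4, h a b _ ha]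

end three

/-- Functions of `(s_1, …, s_5)` that are affine in `s_3` and `s_5`. -/
def lin (f0 f3 f5 : ℝ → ℝ → ℝ → ℝ) (a b z c w : ℝ) : ℝ :=
  f0 a b c + f3 a b c * z + f5 a b c * w

section lin

variable {f0 f3 f5 : ℝ → ℝ → ℝ → ℝ} {a b z c w : ℝ}

theorem Smooth3.lift5 {M : ℝ → ℝ → ℝ → ℝ} (hM : Smooth3 M) : Smooth5 fun a b _ c _ => M a b c :=
  ContDiffOn.comp (t := {q : ℝ × ℝ × ℝ | 0 < q.1}) hM
    (f := fun q : ℝ × ℝ × ℝ × ℝ × ℝ => (q.1, q.2.1, q.2.2.2.1)) (by fun_prop) fun _ hq => hq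

theorem smooth5_lin (h0 : Smooth3 f0) (h3 : Smooth3 f3) (h5 : Smooth3 f5) :
    Smooth5 (lin f0 f3 f5) := by
  have e0 := h0.lift5
  have e3 := h3.lift5
  have e5 := h5.lift5
  unfold Smooth5 at *
  unfold lin
  exact (e0.add (e3.mul (by fun_prop))).add (e5.mul (by fun_prop))

theorem p2_lin (h0 : Smooth3 f0) (h3 : Smooth3 f3) (h5 : Smooth3 f5) (ha : 0 < a) :
    p2 (lin f0 f3 f5) a b z c w = lin (d2 f0) (d2 f3) (d2 f5) a b z c w :=
  (((h0.hasDerivAt_d2 ha).add ((h3.hasDerivAt_d2 ha).mul_const z)).add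
    ((h5.hasDerivAt_d2 ha).mul_const w)).deriv

theorem p4_lin (h0 : Smooth3 f0) (h3 : Smooth3 f3) (h5 : Smooth3 f5) (ha : 0 < a) :
    p4 (lin f0 f3 f5) a b z c w = lin (d4 f0) (d4 f3) (d4 f5) a b z c w :=
  (((h0.hasDerivAt_d4 ha).add ((h3.hasDerivAt_d4 ha).mul_const z)).add
    ((h5.hasDerivAt_d4 ha).mul_const w)).deriv

theorem p3_lin : p3 (lin f0 f3 f5) = fun a b _ c _ => f3 a b c := by
  funext a b z c w
  simp [p3, lin]

theorem p5_lin : p5 (lin f0 f3 f5) = fun a b _ c _ => f5 a b c := by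
  funext a b z c w
  simp [p5, lin]

end lin

end EffGrav

end

open scoped ContDiff

noncomputable section

namespace EffGrav

/-! ### Scalars on jets and along fields -/

theorem isOpen_admissible (k : ℕ) : IsOpen (admissible k) := by
  have h1 : Continuous fun j : Jet k => j .E1 0 := by fun_prop
  have h2 : Continuous fun j : Jet k => j .E2 0 := by fun_prop
  exact (isOpen_lt continuous_const h1).inter (isOpen_ne_fun h2 continuous_const)

theorem IsPhasePoint.jet_mem {φ : Fields} (hφ : IsPhasePoint φ) (k : ℕ) (x : ℝ) :
    jet k φ x ∈ admissible k := by
  constructor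
  · simpa [jet] using hφ.E1_pos x
  · simpa [jet] using hφ.E2_ne x

theorem contDiff_iteratedDeriv {g : ℝ → ℝ} (hg : ContDiff ℝ ∞ g) (n : ℕ) :
    ContDiff ℝ ∞ (iteratedDeriv n g) := by
  induction n with
  | zero => simpa using hg
  | succ n ih => rw [iteratedDeriv_succ]; exact ih.deriv' 

theorem contDiff_jet {φ : Fields} (hφ : ∀ i, ContDiff ℝ ∞ (φ i)) (k : ℕ) :
    ContDiff ℝ ∞ (jet k φ) :=
  contDiff_pi.2 fun i => contDiff_pi.2 fun n => contDiff_iteratedDeriv (hφ i) n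

theorem jet_zero {k : ℕ} (φ : Fields) (x : ℝ) (i : Var) : jet k φ x i 0 = φ i x := by
  simp [jet]
theorem jet_one {k : ℕ} (φ : Fields) (x : ℝ) (i : Var) :
    jet (k + 1) φ x i 1 = deriv (φ i) x := by
  simp [jet, iteratedDeriv_one]
theorem jet_two (φ : Fields) (x : ℝ) (i : Var) :
    jet 2 φ x i 2 = deriv (deriv (φ i)) x := by
  simp [jet, iteratedDeriv_succ]

/-- The five basic scalars of a jet. -/
def scal (j : Jet 2) : ℝ × ℝ × ℝ × ℝ × ℝ := (s1 j, s2 j, s3 j, s4 j, s5 j)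

theorem contDiffOn_s1 : ContDiffOn ℝ ∞ s1 (admissible 2) := by unfold s1; fun_prop
theorem contDiffOn_s2 : ContDiffOn ℝ ∞ s2 (admissible 2) := by unfold s2; fun_prop
theorem contDiffOn_s3 : ContDiffOn ℝ ∞ s3 (admissible 2) := by
  unfold s3; exact ContDiffOn.div (by fun_prop) (by fun_prop) fun j hj => hj.2
theorem contDiffOn_s4 : ContDiffOn ℝ ∞ s4 (admissible 2) := by
  unfold s4; exact ContDiffOn.div (by fun_prop) (by fun_prop) fun j hj => hj.2
theorem contDiffOn_s5 : ContDiffOn ℝ ∞ s5 (admissible 2) := by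
  unfold s5
  exact ContDiffOn.div (ContDiffOn.div (by fun_prop) (by fun_prop) fun j hj => pow_ne_zero 2 hj.2)
    (by fun_prop) fun j hj => hj.2

theorem contDiffOn_scal : ContDiffOn ℝ ∞ scal (admissible 2) :=
  contDiffOn_s1.prodMk (contDiffOn_s2.prodMk (contDiffOn_s3.prodMk
    (contDiffOn_s4.prodMk contDiffOn_s5)))

theorem Smooth5.comp_scal {F : ℝ → ℝ → ℝ → ℝ → ℝ → ℝ} (hF : Smooth5 F) :
    ContDiffOn ℝ ∞ (fun j => F (s1 j) (s2 j) (s3 j) (s4 j) (s5 j)) (admissible 2) :=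
  ContDiffOn.comp (t := {q : ℝ × ℝ × ℝ × ℝ × ℝ | 0 < q.1}) hF contDiffOn_scal fun _ hj => hj.1

theorem Smooth5.contDiffOn_heff {F : ℝ → ℝ → ℝ → ℝ → ℝ → ℝ} (hF : Smooth5 F) :
    ContDiffOn ℝ ∞ (heff F) (admissible 2) := by
  unfold heff
  exact ContDiffOn.mul (by fun_prop) hF.comp_scal

/-- Variation of `s_3`. -/
def ds3 (j v : Jet 2) : ℝ := v .K1 0 / j .E2 0 - j .K1 0 * v .E2 0 / (j .E2 0) ^ 2
/-- Variation of `s_4`. -/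
def ds4 (j v : Jet 2) : ℝ := v .E1 1 / j .E2 0 - j .E1 1 * v .E2 0 / (j .E2 0) ^ 2
/-- Variation of `s_5`. -/
def ds5 (j v : Jet 2) : ℝ :=
  (v .E1 2 * j .E2 0 + j .E1 2 * v .E2 0 - v .E1 1 * j .E2 1 - j .E1 1 * v .E2 1) / (j .E2 0) ^ 3
    - 3 * (j .E1 2 * j .E2 0 - j .E1 1 * j .E2 1) * v .E2 0 / (j .E2 0) ^ 4

/-! ### First variations of the scalars and of the constraint density -/

section line

variable {j : Jet 2} (v : Jet 2)

theorem hasDerivAt_line {k : ℕ} (j v : Jet k) (i : Var) (n : Fin (k + 1)) :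
    HasDerivAt (fun t : ℝ => (j + t • v) i n) (v i n) 0 := by
  simpa using ((hasDerivAt_id (0 : ℝ)).mul_const (v i n)).const_add (j i n)

theorem hasDerivAt_s3_line (hj : j ∈ admissible 2) :
    HasDerivAt (fun t : ℝ => s3 (j + t • v)) (ds3 j v) 0 := by
  have h2 : j .E2 0 ≠ 0 := hj.2
  refine ((hasDerivAt_line j v .K1 0).div (hasDerivAt_line j v .E2 0) (by simpa using h2)).congr_deriv ?_
  simp only [ds3, zero_smul, add_zero]
  field_simp

theorem hasDerivAt_s4_line (hj : j ∈ admissible 2) :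
    HasDerivAt (fun t : ℝ => s4 (j + t • v)) (ds4 j v) 0 := by
  have h2 : j .E2 0 ≠ 0 := hj.2
  refine ((hasDerivAt_line j v .E1 1).div (hasDerivAt_line j v .E2 0) (by simpa using h2)).congr_deriv ?_
  simp only [ds4, zero_smul, add_zero]
  field_simp

theorem hasDerivAt_s5_line (hj : j ∈ admissible 2) :
    HasDerivAt (fun t : ℝ => s5 (j + t • v)) (ds5 j v) 0 := by
  have h2 : j .E2 0 ≠ 0 := hj.2
  have hE := hasDerivAt_line j v .E2 0
  refine ((((hasDerivAt_line j v .E1 2).mul hE).sub ((hasDerivAt_line j v .E1 1).mul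
    (hasDerivAt_line j v .E2 1))).div (hE.pow 2) (by simpa using h2) |>.div hE
    (by simpa using h2)).congr_deriv ?_
  simp only [ds5, zero_smul, add_zero, Pi.mul_apply, Pi.sub_apply, Pi.div_apply, Pi.pow_apply]
  field_simp
  ring

theorem Smooth5.hasDerivAt_line {F : ℝ → ℝ → ℝ → ℝ → ℝ → ℝ} (hF : Smooth5 F)
    (hj : j ∈ admissible 2) :
    HasDerivAt (fun t : ℝ => F (s1 (j + t • v)) (s2 (j + t • v)) (s3 (j + t • v)) (s4 (j + t • v))
        (s5 (j + t • v)))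
      (EffGrav.p1 F (s1 j) (s2 j) (s3 j) (s4 j) (s5 j) * v .E1 0
        + EffGrav.p2 F (s1 j) (s2 j) (s3 j) (s4 j) (s5 j) * v .K2 0
        + EffGrav.p3 F (s1 j) (s2 j) (s3 j) (s4 j) (s5 j) * ds3 j v
        + EffGrav.p4 F (s1 j) (s2 j) (s3 j) (s4 j) (s5 j) * ds4 j v
        + EffGrav.p5 F (s1 j) (s2 j) (s3 j) (s4 j) (s5 j) * ds5 j v) 0 := by
  have h := hF.hasDerivAt_comp (EffGrav.hasDerivAt_line j v .E1 0)
    (EffGrav.hasDerivAt_line j v .K2 0) (hasDerivAt_s3_line v hj) (hasDerivAt_s4_line v hj)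
    (hasDerivAt_s5_line v hj) (by simpa using hj.1)
  simp only [zero_smul, add_zero] at h
  exact h

theorem Smooth5.fderiv_heff {F : ℝ → ℝ → ℝ → ℝ → ℝ → ℝ} (hF : Smooth5 F)
    (hj : j ∈ admissible 2) :
    fderiv ℝ (heff F) j v = v .E2 0 * F (s1 j) (s2 j) (s3 j) (s4 j) (s5 j) + j .E2 0 *
      (EffGrav.p1 F (s1 j) (s2 j) (s3 j) (s4 j) (s5 j) * v .E1 0
        + EffGrav.p2 F (s1 j) (s2 j) (s3 j) (s4 j) (s5 j) * v .K2 0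
        + EffGrav.p3 F (s1 j) (s2 j) (s3 j) (s4 j) (s5 j) * ds3 j v
        + EffGrav.p4 F (s1 j) (s2 j) (s3 j) (s4 j) (s5 j) * ds4 j v
        + EffGrav.p5 F (s1 j) (s2 j) (s3 j) (s4 j) (s5 j) * ds5 j v) := by
  apply fderiv_apply_eq_of_hasDerivAt
  · exact (hF.contDiffOn_heff.differentiableOn (by simp)).differentiableAt
      ((isOpen_admissible 2).mem_nhds hj)
  · have h := (EffGrav.hasDerivAt_line j v .E2 0).mul (hF.hasDerivAt_line v hj)
    simp only [zero_smul, add_zero] at h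
    exact h

end line

/-- The bracket with a smeared functional is the derivative along its Hamiltonian vector field. -/
theorem bracketAt_eq (G : ℝ) {k l : ℕ} (f : Jet k → ℝ) (h : Jet l → ℝ) (N : ℝ → ℝ) (φ : Fields)
    (x : ℝ) :
    bracketAt G f h N φ x = fderiv ℝ f (jet k φ x) (jet k (hamVec G h N φ) x) := by
  have e : ∀ v : Jet k, v = ∑ i, ∑ n, v i n • (Pi.single i (Pi.single n 1) : Jet k) := by
    intro v
    funext i n
    simp [Finset.sum_apply, Pi.single_apply, Finset.sum_ite_eq, ite_apply]
  conv_rhs => rw [e (jet k (hamVec G h N φ) x)]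
  simp only [map_sum, map_smul, bracketAt, pd, smul_eq_mul]
  exact Finset.sum_congr rfl fun i _ => Finset.sum_congr rfl fun n _ => mul_comm _ _

theorem sum_var {A : Type*} [AddCommMonoid A] (f : Var → A) :
    ∑ i, f i = f .K1 + f .K2 + f .E1 + f .E2 := by
  have : (Finset.univ : Finset Var) = {.K1, .K2, .E1, .E2} := rfl
  rw [this]
  simp [add_assoc]

/-! ### Partial derivatives of the constraint density in jet coordinates -/

section pd

variable {F : ℝ → ℝ → ℝ → ℝ → ℝ → ℝ} {j : Jet 2}

theorem Smooth5.pd_K1_zero (hF : Smooth5 F) (hj : j ∈ admissible 2) :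
    pd (heff F) .K1 0 j = EffGrav.p3 F (s1 j) (s2 j) (s3 j) (s4 j) (s5 j) := by
  have h2 : j .E2 0 ≠ 0 := hj.2
  rw [pd, hF.fderiv_heff _ hj]
  simp [ds3, ds4, ds5]
  field_simp

theorem Smooth5.pd_K1_of_ne (hF : Smooth5 F) (hj : j ∈ admissible 2) {n : Fin 3} (hn : n ≠ 0) :
    pd (heff F) .K1 n j = 0 := by
  rw [pd, hF.fderiv_heff _ hj]
  simp [ds3, ds4, ds5, hn.symm]

theorem Smooth5.pd_K2_zero (hF : Smooth5 F) (hj : j ∈ admissible 2) :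
    pd (heff F) .K2 0 j = j .E2 0 * EffGrav.p2 F (s1 j) (s2 j) (s3 j) (s4 j) (s5 j) := by
  rw [pd, hF.fderiv_heff _ hj]
  simp [ds3, ds4, ds5]

theorem Smooth5.pd_K2_of_ne (hF : Smooth5 F) (hj : j ∈ admissible 2) {n : Fin 3} (hn : n ≠ 0) :
    pd (heff F) .K2 n j = 0 := by
  rw [pd, hF.fderiv_heff _ hj]
  simp [ds3, ds4, ds5, hn.symm]

theorem Smooth5.pd_E1_zero (hF : Smooth5 F) (hj : j ∈ admissible 2) :
    pd (heff F) .E1 0 j = j .E2 0 * EffGrav.p1 F (s1 j) (s2 j) (s3 j) (s4 j) (s5 j) := by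
  rw [pd, hF.fderiv_heff _ hj]
  simp [ds3, ds4, ds5]

theorem Smooth5.pd_E1_one (hF : Smooth5 F) (hj : j ∈ admissible 2) :
    pd (heff F) .E1 1 j = EffGrav.p4 F (s1 j) (s2 j) (s3 j) (s4 j) (s5 j)
      - j .E2 1 / (j .E2 0) ^ 2 * EffGrav.p5 F (s1 j) (s2 j) (s3 j) (s4 j) (s5 j) := by
  have h2 : j .E2 0 ≠ 0 := hj.2
  rw [pd, hF.fderiv_heff _ hj]
  simp [ds3, ds4, ds5]
  field_simp
  ring

theorem Smooth5.pd_E1_two (hF : Smooth5 F) (hj : j ∈ admissible 2) :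
    pd (heff F) .E1 2 j = EffGrav.p5 F (s1 j) (s2 j) (s3 j) (s4 j) (s5 j) / j .E2 0 := by
  have h2 : j .E2 0 ≠ 0 := hj.2
  rw [pd, hF.fderiv_heff _ hj]
  simp [ds3, ds4, ds5]
  field_simp

theorem Smooth5.pd_E2_zero (hF : Smooth5 F) (hj : j ∈ admissible 2) :
    pd (heff F) .E2 0 j = F (s1 j) (s2 j) (s3 j) (s4 j) (s5 j)
      - s3 j * EffGrav.p3 F (s1 j) (s2 j) (s3 j) (s4 j) (s5 j)
      - s4 j * EffGrav.p4 F (s1 j) (s2 j) (s3 j) (s4 j) (s5 j)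
      + (3 * j .E1 1 * j .E2 1 / (j .E2 0) ^ 3 - 2 * j .E1 2 / (j .E2 0) ^ 2)
        * EffGrav.p5 F (s1 j) (s2 j) (s3 j) (s4 j) (s5 j) := by
  have h2 : j .E2 0 ≠ 0 := hj.2
  rw [pd, hF.fderiv_heff _ hj]
  generalize EffGrav.p3 F (s1 j) (s2 j) (s3 j) (s4 j) (s5 j) = x3
  generalize EffGrav.p4 F (s1 j) (s2 j) (s3 j) (s4 j) (s5 j) = x4
  generalize EffGrav.p5 F (s1 j) (s2 j) (s3 j) (s4 j) (s5 j) = x5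
  simp [ds3, ds4, ds5]
  simp only [s3, s4]
  field_simp
  ring

theorem Smooth5.pd_E2_one (hF : Smooth5 F) (hj : j ∈ admissible 2) :
    pd (heff F) .E2 1 j = -(j .E1 1 / (j .E2 0) ^ 2
      * EffGrav.p5 F (s1 j) (s2 j) (s3 j) (s4 j) (s5 j)) := by
  have h2 : j .E2 0 ≠ 0 := hj.2
  rw [pd, hF.fderiv_heff _ hj]
  simp [ds3, ds4, ds5]
  field_simp

theorem Smooth5.pd_E2_two (hF : Smooth5 F) (hj : j ∈ admissible 2) :
    pd (heff F) .E2 2 j = 0 := by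
  rw [pd, hF.fderiv_heff _ hj]
  simp [ds3, ds4, ds5]

end pd

end EffGrav

end

open scoped ContDiff

noncomputable section

namespace EffGrav

/-! ### Variational derivatives of the constraints -/

theorem ContDiff.hasDerivAt_deriv {g : ℝ → ℝ} (hg : ContDiff ℝ ∞ g) (x : ℝ) :
    HasDerivAt g (deriv g x) x :=
  (hg.differentiable (by simp) x).hasDerivAt

theorem ContDiff.smooth_deriv {g : ℝ → ℝ} (hg : ContDiff ℝ ∞ g) : ContDiff ℝ ∞ (deriv g) :=
  hg.deriv'

/-- A function of the basic scalars, evaluated along fields. -/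
def along (F : ℝ → ℝ → ℝ → ℝ → ℝ → ℝ) (φ : Fields) (x : ℝ) : ℝ :=
  F (s1 (jet 2 φ x)) (s2 (jet 2 φ x)) (s3 (jet 2 φ x)) (s4 (jet 2 φ x)) (s5 (jet 2 φ x))

section phase

variable {φ : Fields}

theorem IsPhasePoint.contDiff_comp_jet (hφ : IsPhasePoint φ) {k : ℕ} {f : Jet k → ℝ}
    (hf : ContDiffOn ℝ ∞ f (admissible k)) : ContDiff ℝ ∞ fun x => f (jet k φ x) :=
  hf.comp_contDiff (contDiff_jet hφ.smooth k) fun x => hφ.jet_mem k x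

theorem IsPhasePoint.contDiff_along (hφ : IsPhasePoint φ) {F : ℝ → ℝ → ℝ → ℝ → ℝ → ℝ}
    (hF : Smooth5 F) : ContDiff ℝ ∞ (along F φ) :=
  hφ.contDiff_comp_jet hF.comp_scal

theorem s1_jet (φ : Fields) (x : ℝ) : s1 (jet 2 φ x) = φ .E1 x := jet_zero φ x _
theorem s2_jet (φ : Fields) (x : ℝ) : s2 (jet 2 φ x) = φ .K2 x := jet_zero φ x _
theorem s3_jet (φ : Fields) (x : ℝ) : s3 (jet 2 φ x) = φ .K1 x / φ .E2 x := by
  simp only [s3, jet_zero]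
theorem s4_jet (φ : Fields) (x : ℝ) : s4 (jet 2 φ x) = deriv (φ .E1) x / φ .E2 x := by
  simp only [s4, jet_zero, jet_one]
theorem s5_jet' (φ : Fields) (x : ℝ) : s5 (jet 2 φ x) =
    (deriv (deriv (φ .E1)) x * φ .E2 x - deriv (φ .E1) x * deriv (φ .E2) x) / φ .E2 x ^ 3 := by
  simp only [s5, jet_zero, jet_one, jet_two, div_div]
  ring

theorem IsPhasePoint.deriv_s4 (hφ : IsPhasePoint φ) (x : ℝ) :
    deriv (fun y => s4 (jet 2 φ y)) x = φ .E2 x * s5 (jet 2 φ x) := by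
  rw [s5_jet φ hφ x, mul_div_cancel₀ _ (hφ.E2_ne x)]

theorem IsPhasePoint.deriv_along (hφ : IsPhasePoint φ) {F : ℝ → ℝ → ℝ → ℝ → ℝ → ℝ}
    (hF : Smooth5 F) (x : ℝ) :
    deriv (along F φ) x = along (p1 F) φ x * deriv (φ .E1) x + along (p2 F) φ x * deriv (φ .K2) x
      + along (p3 F) φ x * deriv (fun y => s3 (jet 2 φ y)) x
      + along (p4 F) φ x * (φ .E2 x * s5 (jet 2 φ x))
      + along (p5 F) φ x * deriv (fun y => s5 (jet 2 φ y)) x := by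
  have h1 : HasDerivAt (fun y => s1 (jet 2 φ y)) (deriv (φ .E1) x) x := by
    simpa only [s1_jet] using ContDiff.hasDerivAt_deriv (hφ.smooth .E1) x
  have h2 : HasDerivAt (fun y => s2 (jet 2 φ y)) (deriv (φ .K2) x) x := by
    simpa only [s2_jet] using ContDiff.hasDerivAt_deriv (hφ.smooth .K2) x
  have h4 := ContDiff.hasDerivAt_deriv (hφ.contDiff_comp_jet contDiffOn_s4) x
  rw [hφ.deriv_s4] at h4
  exact (hF.hasDerivAt_comp h1 h2
    (ContDiff.hasDerivAt_deriv (hφ.contDiff_comp_jet contDiffOn_s3) x) h4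
    (ContDiff.hasDerivAt_deriv (hφ.contDiff_comp_jet contDiffOn_s5) x)
    (hφ.jet_mem 2 x).1).deriv

variable {F : ℝ → ℝ → ℝ → ℝ → ℝ → ℝ} {N : ℝ → ℝ}

theorem varDeriv_two (f : Jet 2 → ℝ) (N : ℝ → ℝ) (φ : Fields) (i : Var) (x : ℝ) :
    varDeriv f N φ i x = N x * pd f i 0 (jet 2 φ x)
      - deriv (fun y => N y * pd f i 1 (jet 2 φ y)) x
      + deriv (deriv fun y => N y * pd f i 2 (jet 2 φ y)) x := by
  simp [varDeriv, Fin.sum_univ_three, iteratedDeriv_succ]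
  ring

theorem varDeriv_one (f : Jet 1 → ℝ) (N : ℝ → ℝ) (φ : Fields) (i : Var) (x : ℝ) :
    varDeriv f N φ i x = N x * pd f i 0 (jet 1 φ x)
      - deriv (fun y => N y * pd f i 1 (jet 1 φ y)) x := by
  simp [varDeriv, Fin.sum_univ_two, iteratedDeriv_succ]
  ring

/-- K_1 enters only undifferentiated, so no derivative falls on N. The same holds for K_2; all
derivatives of N in the brackets come from E^1 and E^2. -/
theorem varDeriv_heff_K1 (hφ : IsPhasePoint φ) (hF : Smooth5 F) (x : ℝ) :
    varDeriv (heff F) N φ .K1 x = N x * along (p3 F) φ x := by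
  rw [varDeriv_two]
  simp only [hF.pd_K1_zero (hφ.jet_mem 2 _),
    hF.pd_K1_of_ne (hφ.jet_mem 2 _) (show (1 : Fin 3) ≠ 0 by decide),
    hF.pd_K1_of_ne (hφ.jet_mem 2 _) (show (2 : Fin 3) ≠ 0 by decide)]
  simp [along]

theorem varDeriv_heff_K2 (hφ : IsPhasePoint φ) (hF : Smooth5 F) (x : ℝ) :
    varDeriv (heff F) N φ .K2 x = N x * (φ .E2 x * along (p2 F) φ x) := by
  rw [varDeriv_two]
  simp only [hF.pd_K2_zero (hφ.jet_mem 2 _),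
    hF.pd_K2_of_ne (hφ.jet_mem 2 _) (show (1 : Fin 3) ≠ 0 by decide),
    hF.pd_K2_of_ne (hφ.jet_mem 2 _) (show (2 : Fin 3) ≠ 0 by decide), jet_zero]
  simp [along]

theorem deriv_mul_smooth {g h : ℝ → ℝ} (hg : ContDiff ℝ ∞ g) (hh : ContDiff ℝ ∞ h) (x : ℝ) :
    deriv (fun y => g y * h y) x = deriv g x * h x + g x * deriv h x :=
  ((ContDiff.hasDerivAt_deriv hg x).mul (ContDiff.hasDerivAt_deriv hh x)).deriv

theorem deriv_deriv_mul_smooth {g h : ℝ → ℝ} (hg : ContDiff ℝ ∞ g) (hh : ContDiff ℝ ∞ h)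
    (x : ℝ) :
    deriv (deriv fun y => g y * h y) x
      = deriv (deriv g) x * h x + 2 * deriv g x * deriv h x + g x * deriv (deriv h) x := by
  have e : (deriv fun y => g y * h y) = fun y => deriv g y * h y + g y * deriv h y :=
    funext fun y => deriv_mul_smooth hg hh y
  have g1 := ContDiff.smooth_deriv hg
  have h1 := ContDiff.smooth_deriv hh
  rw [e]
  refine ((((ContDiff.hasDerivAt_deriv g1 x).mul (ContDiff.hasDerivAt_deriv hh x)).add
    ((ContDiff.hasDerivAt_deriv hg x).mul (ContDiff.hasDerivAt_deriv h1 x))).deriv).trans ?_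
  ring

theorem deriv_inv_smooth {e : ℝ → ℝ} (he : ContDiff ℝ ∞ e) (h0 : ∀ x, e x ≠ 0) :
    deriv (fun y => (e y)⁻¹) = fun y => -deriv e y / e y ^ 2 :=
  funext fun y => ((ContDiff.hasDerivAt_deriv he y).inv (h0 y)).deriv

/-- The total derivatives of F_4 and F_5 are left unexpanded: in the antisymmetrised bracket only
the coefficients of N' and N'' matter, and these need no chain rule beyond first order. -/
theorem varDeriv_heff_E1 (hφ : IsPhasePoint φ) (hF : Smooth5 F) (hN : ContDiff ℝ ∞ N) (x : ℝ) :
    varDeriv (heff F) N φ .E1 x = N x * (φ .E2 x * along (p1 F) φ x)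
      - (deriv N x * along (p4 F) φ x + N x * deriv (along (p4 F) φ) x)
      + (deriv (deriv N) x * along (p5 F) φ x + 2 * deriv N x * deriv (along (p5 F) φ) x
        + N x * deriv (deriv (along (p5 F) φ)) x) / φ .E2 x
      - (deriv N x * along (p5 F) φ x + N x * deriv (along (p5 F) φ) x)
        * deriv (φ .E2) x / φ .E2 x ^ 2 := by
  have h4 := hφ.contDiff_along hF.p4
  have h5 := hφ.contDiff_along hF.p5
  have hE := hφ.smooth .E2
  have hE0 := hφ.E2_ne
  have hi : ContDiff ℝ ∞ fun y => (φ .E2 y)⁻¹ := hE.inv hE0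
  have hi' : ContDiff ℝ ∞ fun y => -deriv (φ .E2) y / φ .E2 y ^ 2 := by
    rw [← deriv_inv_smooth hE hE0]; exact ContDiff.smooth_deriv hi
  have hN5 : ContDiff ℝ ∞ fun y => N y * along (p5 F) φ y := hN.mul h5
  rw [varDeriv_two]
  have e0 : pd (heff F) .E1 0 (jet 2 φ x) = φ .E2 x * along (p1 F) φ x := by
    rw [hF.pd_E1_zero (hφ.jet_mem 2 _), jet_zero]; rfl
  have e1 : (fun y => N y * pd (heff F) .E1 1 (jet 2 φ y)) = fun y => N y * along (p4 F) φ y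
      + N y * along (p5 F) φ y * (-deriv (φ .E2) y / φ .E2 y ^ 2) := by
    funext y
    rw [hF.pd_E1_one (hφ.jet_mem 2 _), jet_zero, jet_one]
    simp only [along]
    ring
  have e2 : (fun y => N y * pd (heff F) .E1 2 (jet 2 φ y))
      = fun y => N y * along (p5 F) φ y * (φ .E2 y)⁻¹ := by
    funext y
    rw [hF.pd_E1_two (hφ.jet_mem 2 _), jet_zero]
    simp only [along]
    ring
  have e3 : deriv (fun y => N y * along (p4 F) φ y
        + N y * along (p5 F) φ y * (-deriv (φ .E2) y / φ .E2 y ^ 2)) x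
      = deriv (fun y => N y * along (p4 F) φ y) x
        + deriv (fun y => N y * along (p5 F) φ y * (-deriv (φ .E2) y / φ .E2 y ^ 2)) x :=
    ((ContDiff.hasDerivAt_deriv (hN.mul h4) x).add
      (ContDiff.hasDerivAt_deriv (hN5.mul hi') x)).deriv
  rw [e0, e1, e2, e3, deriv_deriv_mul_smooth hN5 hi, deriv_mul_smooth hN5 hi',
    deriv_deriv_mul_smooth hN h5, deriv_mul_smooth hN h5, deriv_mul_smooth hN h4,
    deriv_inv_smooth hE hE0]
  ring

/-- Differentiating E^1'/(E^2)^2 combines with the second-order terms of ∂H/∂E^2 to leave exactly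
−s_5 F_5. -/
theorem varDeriv_heff_E2 (hφ : IsPhasePoint φ) (hF : Smooth5 F) (hN : ContDiff ℝ ∞ N) (x : ℝ) :
    varDeriv (heff F) N φ .E2 x = N x * (along F φ x - s3 (jet 2 φ x) * along (p3 F) φ x
        - s4 (jet 2 φ x) * along (p4 F) φ x - s5 (jet 2 φ x) * along (p5 F) φ x)
      + (deriv N x * along (p5 F) φ x + N x * deriv (along (p5 F) φ) x)
        * deriv (φ .E1) x / φ .E2 x ^ 2 := by
  have h5 := hφ.contDiff_along hF.p5
  have hE := hφ.smooth .E2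
  have hE0 := hφ.E2_ne
  have hN5 : ContDiff ℝ ∞ fun y => N y * along (p5 F) φ y := hN.mul h5
  have hq : HasDerivAt (fun y => deriv (φ .E1) y / φ .E2 y ^ 2)
      ((deriv (deriv (φ .E1)) x * φ .E2 x ^ 2 - deriv (φ .E1) x * (2 * φ .E2 x * deriv (φ .E2) x))
        / (φ .E2 x ^ 2) ^ 2) x := by
    have := (ContDiff.hasDerivAt_deriv (ContDiff.smooth_deriv (hφ.smooth .E1)) x).div
      ((ContDiff.hasDerivAt_deriv hE x).pow 2) (pow_ne_zero 2 (hE0 x))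
    simp only [Nat.cast_ofNat, Nat.add_one_sub_one, pow_one] at this
    exact this
  rw [varDeriv_two]
  have e1 : (fun y => N y * pd (heff F) .E2 1 (jet 2 φ y)) =
      fun y => -(N y * along (p5 F) φ y * (deriv (φ .E1) y / φ .E2 y ^ 2)) := by
    funext y
    rw [hF.pd_E2_one (hφ.jet_mem 2 _), jet_zero, jet_one]
    simp only [along]
    ring
  simp only [hF.pd_E2_two (hφ.jet_mem 2 _), mul_zero, deriv_const', add_zero]
  rw [e1, ((ContDiff.hasDerivAt_deriv hN5 x).fun_mul hq).fun_neg.deriv, deriv_mul_smooth hN h5,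
    hF.pd_E2_zero (hφ.jet_mem 2 _)]
  simp only [jet_zero, jet_one, jet_two, along, s5_jet' φ x]
  have := hE0 x
  field_simp
  ring

end phase

end EffGrav

end

open scoped ContDiff

noncomputable section

namespace EffGrav

/-! ### Brackets of the smeared constraints -/

theorem integral_deriv_eq_zero {Y : ℝ → ℝ} (hY : ContDiff ℝ ∞ Y) (hc : HasCompactSupport Y) :
    ∫ x, deriv Y x = 0 :=
  MeasureTheory.integral_eq_zero_of_hasDerivAt_of_integrable
    (fun x => ContDiff.hasDerivAt_deriv hY x)
    ((ContDiff.smooth_deriv hY).continuous.integrable_of_hasCompactSupport hc.deriv)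
    (hY.continuous.integrable_of_hasCompactSupport hc)

theorem integral_add_deriv {X Y : ℝ → ℝ} (hX : Continuous X) (hXc : HasCompactSupport X)
    (hY : ContDiff ℝ ∞ Y) (hc : HasCompactSupport Y) :
    ∫ x, (X x + deriv Y x) = ∫ x, X x := by
  rw [MeasureTheory.integral_add (hX.integrable_of_hasCompactSupport hXc)
    ((ContDiff.smooth_deriv hY).continuous.integrable_of_hasCompactSupport hc.deriv),
    integral_deriv_eq_zero hY hc, add_zero]

/-- The Wronskian of two smearing functions. -/
def wronskian (N₁ N₂ : ℝ → ℝ) (x : ℝ) : ℝ := N₁ x * deriv N₂ x - N₂ x * deriv N₁ x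

theorem contDiff_wronskian {N₁ N₂ : ℝ → ℝ} (h₁ : ContDiff ℝ ∞ N₁) (h₂ : ContDiff ℝ ∞ N₂) :
    ContDiff ℝ ∞ (wronskian N₁ N₂) :=
  (h₁.mul (ContDiff.smooth_deriv h₂)).sub (h₂.mul (ContDiff.smooth_deriv h₁))

theorem hasCompactSupport_wronskian {N₁ N₂ : ℝ → ℝ} (h₁ : HasCompactSupport N₁)
    (h₂ : HasCompactSupport N₂) : HasCompactSupport (wronskian N₁ N₂) :=
  HasCompactSupport.sub (h₁.mul_right (f' := deriv N₂)) (h₂.mul_right (f' := deriv N₁))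

theorem deriv_wronskian {N₁ N₂ : ℝ → ℝ} (h₁ : ContDiff ℝ ∞ N₁) (h₂ : ContDiff ℝ ∞ N₂) (x : ℝ) :
    deriv (wronskian N₁ N₂) x = N₁ x * deriv (deriv N₂) x - N₂ x * deriv (deriv N₁) x := by
  have := (((ContDiff.hasDerivAt_deriv h₁ x).mul
    (ContDiff.hasDerivAt_deriv (ContDiff.smooth_deriv h₂) x)).sub
    ((ContDiff.hasDerivAt_deriv h₂ x).mul
    (ContDiff.hasDerivAt_deriv (ContDiff.smooth_deriv h₁) x))).deriv
  refine Eq.trans this ?_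
  ring

/-- The coefficient in the bracket of two Hamiltonian constraints `E^2 F`; `u`, `v`, `y` are the
derivatives `(∂_x s_i) / E^2` of `s_2`, `s_3`, `s_5`. -/
def clos (F : ℝ → ℝ → ℝ → ℝ → ℝ → ℝ) (a b z c w u v y : ℝ) : ℝ :=
  -2 * p3 F a b z c w * p4 F a b z c w + c * p2 F a b z c w * p5 F a b z c w
    + 2 * p3 F a b z c w * (c * p1 (p5 F) a b z c w + u * p2 (p5 F) a b z c w
      + v * p3 (p5 F) a b z c w + w * p4 (p5 F) a b z c w + y * p5 (p5 F) a b z c w)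
    - 2 * p5 F a b z c w * (c * p1 (p3 F) a b z c w + u * p2 (p3 F) a b z c w
      + v * p3 (p3 F) a b z c w + w * p4 (p3 F) a b z c w + y * p5 (p3 F) a b z c w)

/-- The coefficient `clos F` along fields. -/
def closAlong (F : ℝ → ℝ → ℝ → ℝ → ℝ → ℝ) (φ : Fields) (x : ℝ) : ℝ :=
  clos F (s1 (jet 2 φ x)) (s2 (jet 2 φ x)) (s3 (jet 2 φ x)) (s4 (jet 2 φ x)) (s5 (jet 2 φ x))
    (deriv (φ .K2) x / φ .E2 x) (deriv (fun y => s3 (jet 2 φ y)) x / φ .E2 x)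
    (deriv (fun y => s5 (jet 2 φ y)) x / φ .E2 x)

section phase

variable {φ : Fields} {F : ℝ → ℝ → ℝ → ℝ → ℝ → ℝ}

/-- The expanded coefficient is the chain rule applied to F_3 D F_5 − F_5 D F_3 with D = (1/E^2)
∂_x. The unexpanded form is what the bracket produces, and it makes smoothness evident. -/
theorem closAlong_eq (hφ : IsPhasePoint φ) (hF : Smooth5 F) (x : ℝ) :
    closAlong F φ x = -2 * along (p3 F) φ x * along (p4 F) φ x
      + s4 (jet 2 φ x) * along (p2 F) φ x * along (p5 F) φ x
      + 2 * (along (p3 F) φ x * deriv (along (p5 F) φ) x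
        - along (p5 F) φ x * deriv (along (p3 F) φ) x) / φ .E2 x := by
  have h0 := hφ.E2_ne x
  have h4 : deriv (φ .E1) x = φ .E2 x * s4 (jet 2 φ x) := by
    rw [s4_jet, mul_div_cancel₀ _ h0]
  rw [hφ.deriv_along hF.p5, hφ.deriv_along hF.p3, h4]
  simp only [closAlong, clos, along]
  field_simp
  ring

theorem contDiff_closAlong (hφ : IsPhasePoint φ) (hF : Smooth5 F) :
    ContDiff ℝ ∞ (closAlong F φ) := by
  have e : closAlong F φ = fun x => -2 * along (p3 F) φ x * along (p4 F) φ x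
      + s4 (jet 2 φ x) * along (p2 F) φ x * along (p5 F) φ x
      + 2 * (along (p3 F) φ x * deriv (along (p5 F) φ) x
        - along (p5 F) φ x * deriv (along (p3 F) φ) x) / φ .E2 x :=
    funext fun x => closAlong_eq hφ hF x
  have h2 := hφ.contDiff_along hF.p2
  have h3 := hφ.contDiff_along hF.p3
  have h4 := hφ.contDiff_along hF.p4
  have h5 := hφ.contDiff_along hF.p5
  have h3' := ContDiff.smooth_deriv h3
  have h5' := ContDiff.smooth_deriv h5
  have hs := hφ.contDiff_comp_jet contDiffOn_s4
  rw [e]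
  exact (((contDiff_const.mul h3).mul h4).add ((hs.mul h2).mul h5)).add
    ((contDiff_const.mul ((h3.mul h5').sub (h5.mul h3'))).div (hφ.smooth .E2) hφ.E2_ne)

/-- Antisymmetry in N_1, N_2 leaves the Wronskian W and N_1 N_2'' − N_2 N_1'' = W'. The W' term has
coefficient 2 G F_3 F_5 / E^2 and is integrated by parts. -/
theorem bracket_heff_heff (hφ : IsPhasePoint φ) (hF : Smooth5 F) (G : ℝ) {N₁ N₂ : ℝ → ℝ}
    (h₁ : IsTest N₁) (h₂ : IsTest N₂) :
    bracket G (heff F) N₁ (heff F) N₂ φ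
      = ∫ x, G * closAlong F φ x * wronskian N₁ N₂ x := by
  have a3 := hφ.contDiff_along hF.p3
  have a5 := hφ.contDiff_along hF.p5
  have hE0 := hφ.E2_ne
  have hE : ContDiff ℝ ∞ fun x => (φ .E2 x)⁻¹ := (hφ.smooth .E2).inv hE0
  have hW := contDiff_wronskian h₁.1 h₂.1
  have hWc := hasCompactSupport_wronskian h₁.2 h₂.2
  have h35 : ContDiff ℝ ∞ fun x => 2 * G * (along (p3 F) φ x * along (p5 F) φ x) :=
    contDiff_const.mul (a3.mul a5)
  have hq : ContDiff ℝ ∞ fun x => 2 * G * (along (p3 F) φ x * along (p5 F) φ x) * (φ .E2 x)⁻¹ :=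
    h35.mul hE
  have hY : ContDiff ℝ ∞ fun x => 2 * G * (along (p3 F) φ x * along (p5 F) φ x) * (φ .E2 x)⁻¹
      * wronskian N₁ N₂ x := hq.mul hW
  have hX : ContDiff ℝ ∞ fun x => G * closAlong F φ x * wronskian N₁ N₂ x :=
    (contDiff_const.mul (contDiff_closAlong hφ hF)).mul hW
  -- Adding the total derivative of 2 G F_3 F_5 W / E^2 turns the claim into an equality of
  -- integrands.
  rw [← integral_add_deriv hX.continuous hWc.mul_left hY hWc.mul_left]
  unfold bracket
  congr 1
  funext x
  have d1 : deriv (fun x => 2 * G * (along (p3 F) φ x * along (p5 F) φ x)) x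
      = 2 * G * (deriv (along (p3 F) φ) x * along (p5 F) φ x
        + along (p3 F) φ x * deriv (along (p5 F) φ) x) :=
    (((ContDiff.hasDerivAt_deriv a3 x).mul (ContDiff.hasDerivAt_deriv a5 x)).const_mul _).deriv
  rw [varDeriv_heff_K1 hφ hF, varDeriv_heff_K1 hφ hF, varDeriv_heff_K2 hφ hF,
    varDeriv_heff_K2 hφ hF, varDeriv_heff_E1 hφ hF h₁.1, varDeriv_heff_E1 hφ hF h₂.1,
    varDeriv_heff_E2 hφ hF h₁.1, varDeriv_heff_E2 hφ hF h₂.1, deriv_mul_smooth hq hW,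
    deriv_mul_smooth h35 hE, d1, deriv_wronskian h₁.1 h₂.1,
    deriv_inv_smooth (hφ.smooth .E2) hE0, closAlong_eq hφ hF]
  simp only [wronskian, s4_jet]
  have := hE0 x
  field_simp
  ring

/-! The diffeomorphism constraint. -/

theorem contDiff_diffeo (G : ℝ) : ContDiff ℝ ∞ (diffeo G) := by
  unfold diffeo
  fun_prop

theorem fderiv_diffeo (G : ℝ) (j v : Jet 1) :
    fderiv ℝ (diffeo G) j v = 1 / (2 * G) * (-(v .K1 0 * j .E1 1 + j .K1 0 * v .E1 1)
      + 2 * (v .E2 0 * j .K2 1 + j .E2 0 * v .K2 1)) := by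
  apply fderiv_apply_eq_of_hasDerivAt ((contDiff_diffeo G).differentiable (by simp) j)
  have h := ((((hasDerivAt_line j v .K1 0).mul (hasDerivAt_line j v .E1 1)).neg.add
    (((hasDerivAt_line j v .E2 0).const_mul 2).mul (hasDerivAt_line j v .K2 1))).const_mul
    (1 / (2 * G)))
  simp only [zero_smul, add_zero] at h
  refine h.congr_deriv ?_
  ring

variable {M : ℝ → ℝ} (G : ℝ)

theorem varDeriv_diffeo_K1 (x : ℝ) :
    varDeriv (diffeo G) M φ .K1 x = -(M x * deriv (φ .E1) x) / (2 * G) := by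
  rw [varDeriv_one]
  simp [pd, fderiv_diffeo, jet_one, jet_zero]
  ring

theorem varDeriv_diffeo_E2 (x : ℝ) :
    varDeriv (diffeo G) M φ .E2 x = M x * deriv (φ .K2) x / G := by
  rw [varDeriv_one]
  simp [pd, fderiv_diffeo, jet_one, jet_zero]
  ring

theorem varDeriv_diffeo_E1 (hφ : IsPhasePoint φ) (hM : ContDiff ℝ ∞ M) (x : ℝ) :
    varDeriv (diffeo G) M φ .E1 x
      = (deriv M x * φ .K1 x + M x * deriv (φ .K1) x) / (2 * G) := by
  rw [varDeriv_one]
  have e : (fun y => M y * pd (diffeo G) .E1 1 (jet 1 φ y))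
      = fun y => -(1 / (2 * G)) * (M y * φ .K1 y) := by
    funext y
    simp [pd, fderiv_diffeo, jet_zero]
    ring
  rw [e, deriv_const_mul_field, deriv_mul_smooth hM (hφ.smooth _)]
  simp [pd, fderiv_diffeo]
  ring

theorem varDeriv_diffeo_K2 (hφ : IsPhasePoint φ) (hM : ContDiff ℝ ∞ M) (x : ℝ) :
    varDeriv (diffeo G) M φ .K2 x
      = -(deriv M x * φ .E2 x + M x * deriv (φ .E2) x) / G := by
  rw [varDeriv_one]
  have e : (fun y => M y * pd (diffeo G) .K2 1 (jet 1 φ y))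
      = fun y => (1 / G) * (M y * φ .E2 y) := by
    funext y
    simp [pd, fderiv_diffeo, jet_zero]
    ring
  rw [e, deriv_const_mul_field, deriv_mul_smooth hM (hφ.smooth _)]
  simp [pd, fderiv_diffeo]
  ring

/-- The integrands already agree pointwise: the N_1 N_2 terms cancel by antisymmetry and only the
Wronskian survives. -/
theorem bracket_diffeo_diffeo (hφ : IsPhasePoint φ) {G : ℝ} (hG : 0 < G) {N₁ N₂ : ℝ → ℝ}
    (h₁ : IsTest N₁) (h₂ : IsTest N₂) :
    bracket G (diffeo G) N₁ (diffeo G) N₂ φ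
      = smear (diffeo G) (fun x => N₁ x * deriv N₂ x - N₂ x * deriv N₁ x) φ := by
  unfold bracket smear
  congr 1
  funext x
  rw [varDeriv_diffeo_K1, varDeriv_diffeo_K1, varDeriv_diffeo_E2, varDeriv_diffeo_E2,
    varDeriv_diffeo_E1 G hφ h₁.1, varDeriv_diffeo_E1 G hφ h₂.1,
    varDeriv_diffeo_K2 G hφ h₁.1, varDeriv_diffeo_K2 G hφ h₂.1]
  simp only [diffeo, jet_zero, jet_one]
  field_simp
  ring

end phase

end EffGrav

end

open scoped ContDiff

noncomputable section

namespace EffGrav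

/-! ### The closure conditions -/

section phase

variable {φ : Fields} {F : ℝ → ℝ → ℝ → ℝ → ℝ → ℝ}

theorem contDiffOn_pd {k : ℕ} {f : Jet k → ℝ} (hf : ContDiffOn ℝ ∞ f (admissible k)) (i : Var)
    (n : Fin (k + 1)) : ContDiffOn ℝ ∞ (pd f i n) (admissible k) :=
  contDiffOn_fderiv_apply (isOpen_admissible k) hf _

theorem fderiv_eq_sum_pd {k : ℕ} (f : Jet k → ℝ) (j v : Jet k) :
    fderiv ℝ f j v = ∑ i, ∑ n, pd f i n j * v i n := by
  have e : v = ∑ i, ∑ n, v i n • (Pi.single i (Pi.single n 1) : Jet k) := by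
    funext i n
    simp [Finset.sum_apply, Pi.single_apply, Finset.sum_ite_eq, ite_apply]
  conv_lhs => rw [e]
  simp only [map_sum, map_smul, pd, smul_eq_mul]
  exact Finset.sum_congr rfl fun i _ => Finset.sum_congr rfl fun n _ => mul_comm _ _

theorem fderiv_jet_two (f : Jet 2 → ℝ) (φ ψ : Fields) (x : ℝ) :
    fderiv ℝ f (jet 2 φ x) (jet 2 ψ x) = ∑ i, (pd f i 0 (jet 2 φ x) * ψ i x
      + pd f i 1 (jet 2 φ x) * deriv (ψ i) x + pd f i 2 (jet 2 φ x) * deriv (deriv (ψ i)) x) := by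
  rw [fderiv_eq_sum_pd]
  refine Finset.sum_congr rfl fun i _ => (Fin.sum_univ_three _).trans ?_
  rw [jet_zero, jet_one, jet_two]

/-- This is the defining duality of the variational derivative; compact support of N removes the
boundary terms. -/
theorem integral_varDeriv_mul (hφ : IsPhasePoint φ) {f : Jet 2 → ℝ}
    (hf : ContDiffOn ℝ ∞ f (admissible 2)) {N : ℝ → ℝ} (hN : IsTest N) {ψ : Fields}
    (hψ : ∀ i, ContDiff ℝ ∞ (ψ i)) :
    ∫ x, ∑ i, varDeriv f N φ i x * ψ i x
      = ∫ x, N x * fderiv ℝ f (jet 2 φ x) (jet 2 ψ x) := by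
  have hp : ∀ i n, ContDiff ℝ ∞ fun x => pd f i n (jet 2 φ x) := fun i n =>
    hφ.contDiff_comp_jet (contDiffOn_pd hf i n)
  have hQ : ∀ i n, ContDiff ℝ ∞ fun x => N x * pd f i n (jet 2 φ x) := fun i n => hN.1.mul (hp i n)
  have hQc : ∀ i n, HasCompactSupport fun x => N x * pd f i n (jet 2 φ x) := fun i n =>
    hN.2.mul_right
  -- The boundary terms of one integration by parts for first derivatives and two for second
  -- derivatives.
  let Y : Var → ℝ → ℝ := fun i x => -(N x * pd f i 1 (jet 2 φ x)) * ψ i x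
    + deriv (fun y => N y * pd f i 2 (jet 2 φ y)) x * ψ i x
    - N x * pd f i 2 (jet 2 φ x) * deriv (ψ i) x
  have hY : ∀ i, ContDiff ℝ ∞ (Y i) := fun i =>
    (((hQ i 1).neg.mul (hψ i)).add ((ContDiff.smooth_deriv (hQ i 2)).mul (hψ i))).sub
      ((hQ i 2).mul (ContDiff.smooth_deriv (hψ i)))
  have hYc : ∀ i, HasCompactSupport (Y i) := fun i =>
    (((hQc i 1).neg.mul_right (f' := ψ i)).add ((hQc i 2).deriv.mul_right (f' := ψ i))).sub
      ((hQc i 2).mul_right (f' := deriv (ψ i)))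
  have hdY : ∀ i x, varDeriv f N φ i x * ψ i x
      = N x * (pd f i 0 (jet 2 φ x) * ψ i x + pd f i 1 (jet 2 φ x) * deriv (ψ i) x
        + pd f i 2 (jet 2 φ x) * deriv (deriv (ψ i)) x) + deriv (Y i) x := by
    intro i x
    have h := ((((ContDiff.hasDerivAt_deriv (hQ i 1) x).neg.mul
      (ContDiff.hasDerivAt_deriv (hψ i) x)).add
      ((ContDiff.hasDerivAt_deriv (ContDiff.smooth_deriv (hQ i 2)) x).mul
      (ContDiff.hasDerivAt_deriv (hψ i) x))).sub
      ((ContDiff.hasDerivAt_deriv (hQ i 2) x).mul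
      (ContDiff.hasDerivAt_deriv (ContDiff.smooth_deriv (hψ i)) x)))
    have h' : deriv (Y i) x = _ := h.deriv
    rw [h', varDeriv_two]
    simp only [Pi.neg_apply]
    ring
  have hXs : ContDiff ℝ ∞ fun x => fderiv ℝ f (jet 2 φ x) (jet 2 ψ x) := by
    simp only [fderiv_eq_sum_pd]
    exact ContDiff.sum fun i _ => ContDiff.sum fun n _ =>
      (hp i n).mul (contDiff_iteratedDeriv (hψ i) n)
  have key : (fun x => ∑ i, varDeriv f N φ i x * ψ i x)
      = fun x => N x * fderiv ℝ f (jet 2 φ x) (jet 2 ψ x)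
        + deriv (fun y => Y .K1 y + Y .K2 y + Y .E1 y + Y .E2 y) x := by
    funext x
    have h := ((((ContDiff.hasDerivAt_deriv (hY .K1) x).add
      (ContDiff.hasDerivAt_deriv (hY .K2) x)).add (ContDiff.hasDerivAt_deriv (hY .E1) x)).add
      (ContDiff.hasDerivAt_deriv (hY .E2) x))
    have h' : deriv (fun y => Y .K1 y + Y .K2 y + Y .E1 y + Y .E2 y) x = _ := h.deriv
    rw [h', fderiv_jet_two, sum_var, sum_var]
    simp only [hdY]
    ring
  rw [key]
  exact integral_add_deriv (hN.1.mul hXs).continuous hN.2.mul_right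
    ((((hY .K1).add (hY .K2)).add (hY .E1)).add (hY .E2))
    ((((hYc .K1).add (hYc .K2)).add (hYc .E1)).add (hYc .E2))

/-- The Lie derivative of the fields along `M`: `K_1` and `E^2` are densities. -/
def lie (M : ℝ → ℝ) (φ : Fields) : Fields
  | .K1 => fun x => deriv M x * φ .K1 x + M x * deriv (φ .K1) x
  | .E1 => fun x => M x * deriv (φ .E1) x
  | .K2 => fun x => M x * deriv (φ .K2) x
  | .E2 => fun x => deriv M x * φ .E2 x + M x * deriv (φ .E2) x

/-- H_x generates spatial diffeomorphisms, so its brackets can be computed as Lie derivatives. -/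
theorem hamVec_diffeo (hφ : IsPhasePoint φ) {G : ℝ} (hG : 0 < G) {M : ℝ → ℝ}
    (hM : ContDiff ℝ ∞ M) : hamVec G (diffeo G) M φ = lie M φ := by
  funext i x
  cases i
  · simp only [hamVec, lie, varDeriv_diffeo_E1 G hφ hM]; field_simp
  · simp only [hamVec, lie, varDeriv_diffeo_E2]; field_simp
  · simp only [hamVec, lie, varDeriv_diffeo_K1]; field_simp; try ring
  · simp only [hamVec, lie, varDeriv_diffeo_K2 G hφ hM]; field_simp; try ring

theorem contDiff_lie (hφ : IsPhasePoint φ) {M : ℝ → ℝ} (hM : ContDiff ℝ ∞ M) (i : Var) :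
    ContDiff ℝ ∞ (lie M φ i) := by
  have hd := ContDiff.smooth_deriv hM
  cases i
  · exact (hd.mul (hφ.smooth _)).add (hM.mul (ContDiff.smooth_deriv (hφ.smooth _)))
  · exact hM.mul (ContDiff.smooth_deriv (hφ.smooth _))
  · exact hM.mul (ContDiff.smooth_deriv (hφ.smooth _))
  · exact (hd.mul (hφ.smooth _)).add (hM.mul (ContDiff.smooth_deriv (hφ.smooth _)))

/-- K_1 and E^2 are densities of equal weight, so s_3 is a scalar and the terms with M' cancel. The
analogous facts for s_4 and s_5 follow from D = (1/E^2) ∂_x taking scalars to scalars. -/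
theorem ds3_lie (hφ : IsPhasePoint φ) (M : ℝ → ℝ) (x : ℝ) :
    ds3 (jet 2 φ x) (jet 2 (lie M φ) x) = M x * deriv (fun y => s3 (jet 2 φ y)) x := by
  have h0 := hφ.E2_ne x
  have h : deriv (fun y => φ .K1 y / φ .E2 y) x = _ :=
    ((ContDiff.hasDerivAt_deriv (hφ.smooth .K1) x).div
      (ContDiff.hasDerivAt_deriv (hφ.smooth .E2) x) h0).deriv
  simp only [s3_jet]
  rw [h]
  simp only [ds3, jet_zero, lie]
  field_simp
  ring

theorem ds4_lie (hφ : IsPhasePoint φ) {M : ℝ → ℝ} (hM : ContDiff ℝ ∞ M) (x : ℝ) :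
    ds4 (jet 2 φ x) (jet 2 (lie M φ) x) = M x * (φ .E2 x * s5 (jet 2 φ x)) := by
  have h0 := hφ.E2_ne x
  simp only [ds4, jet_zero, jet_one, lie, s5_jet',
    deriv_mul_smooth hM (ContDiff.smooth_deriv (hφ.smooth .E1))]
  field_simp
  ring

theorem ds5_lie (hφ : IsPhasePoint φ) {M : ℝ → ℝ} (hM : ContDiff ℝ ∞ M) (x : ℝ) :
    ds5 (jet 2 φ x) (jet 2 (lie M φ) x) = M x * deriv (fun y => s5 (jet 2 φ y)) x := by
  have h0 := hφ.E2_ne x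
  have hE2 := hφ.smooth .E2
  have hE1' := ContDiff.smooth_deriv (hφ.smooth .E1)
  have hE2' := ContDiff.smooth_deriv hE2
  have hE1'' := ContDiff.smooth_deriv hE1'
  have h : deriv (fun y => (deriv (deriv (φ .E1)) y * φ .E2 y
      - deriv (φ .E1) y * deriv (φ .E2) y) / φ .E2 y ^ 3) x = _ :=
    ((((ContDiff.hasDerivAt_deriv hE1'' x).mul (ContDiff.hasDerivAt_deriv hE2 x)).sub
      ((ContDiff.hasDerivAt_deriv hE1' x).mul (ContDiff.hasDerivAt_deriv hE2' x))).div
      ((ContDiff.hasDerivAt_deriv hE2 x).pow 3) (pow_ne_zero 3 h0)).deriv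
  have h2 : deriv (lie M φ .E2) x = deriv (deriv M) x * φ .E2 x + 2 * deriv M x * deriv (φ .E2) x
      + M x * deriv (deriv (φ .E2)) x := by
    rw [← deriv_deriv_mul_smooth hM hE2]
    congr 1
    exact funext fun y => (deriv_mul_smooth hM hE2 y).symm
  simp only [s5_jet']
  rw [h]
  simp only [ds5, jet_zero, jet_one, jet_two, h2]
  simp only [lie, deriv_mul_smooth hM hE1', deriv_deriv_mul_smooth hM hE1', Pi.mul_apply,
    Pi.sub_apply, Pi.pow_apply]
  field_simp
  ring

/-- E^2 times a function of scalars is a density of weight one, and the Lie derivative of such a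
density is a total derivative. -/
theorem fderiv_heff_lie (hφ : IsPhasePoint φ) (hF : Smooth5 F) {M : ℝ → ℝ}
    (hM : ContDiff ℝ ∞ M) (x : ℝ) :
    fderiv ℝ (heff F) (jet 2 φ x) (jet 2 (lie M φ) x)
      = deriv (fun y => M y * heff F (jet 2 φ y)) x := by
  have e : (fun y => heff F (jet 2 φ y)) = fun y => φ .E2 y * along F φ y := by
    funext y
    simp only [heff, jet_zero, along]
  have hs : ContDiff ℝ ∞ fun y => heff F (jet 2 φ y) := by
    rw [e]; exact (hφ.smooth _).mul (hφ.contDiff_along hF)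
  rw [deriv_mul_smooth hM hs, e, deriv_mul_smooth (hφ.smooth _) (hφ.contDiff_along hF),
    hφ.deriv_along hF, hF.fderiv_heff _ (hφ.jet_mem 2 x), ds3_lie hφ, ds4_lie hφ hM, ds5_lie hφ hM]
  simp only [jet_zero, lie, heff, along]
  ring

/-- The Hamiltonian flow of H_x is a Lie derivative; duality turns the bracket into the integral of
N (M H_eff)', and one integration by parts finishes. -/
theorem bracket_heff_diffeo (hφ : IsPhasePoint φ) (hF : Smooth5 F) {G : ℝ} (hG : 0 < G)
    {N M : ℝ → ℝ} (hN : IsTest N) (hM : IsTest M) :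
    bracket G (heff F) N (diffeo G) M φ = -smear (heff F) (fun x => M x * deriv N x) φ := by
  have e : bracket G (heff F) N (diffeo G) M φ
      = ∫ x, ∑ i, varDeriv (heff F) N φ i x * lie M φ i x := by
    unfold bracket
    congr 1
    funext x
    rw [varDeriv_diffeo_K1, varDeriv_diffeo_E2, varDeriv_diffeo_E1 G hφ hM.1,
      varDeriv_diffeo_K2 G hφ hM.1, sum_var]
    simp only [lie]
    field_simp
    ring
  have hs : ContDiff ℝ ∞ fun y => heff F (jet 2 φ y) := hφ.contDiff_comp_jet hF.contDiffOn_heff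
  have hMs : ContDiff ℝ ∞ fun y => M y * heff F (jet 2 φ y) := hM.1.mul hs
  rw [e, integral_varDeriv_mul hφ hF.contDiffOn_heff hN (contDiff_lie hφ hM.1)]
  simp only [fderiv_heff_lie hφ hF hM.1]
  have hY : ContDiff ℝ ∞ fun y => N y * (M y * heff F (jet 2 φ y)) := hN.1.mul hMs
  have hX : ContDiff ℝ ∞ fun y => -(heff F (jet 2 φ y) * (M y * deriv N y)) :=
    (hs.mul (hM.1.mul (ContDiff.smooth_deriv hN.1))).neg
  have hc0 : HasCompactSupport fun y => M y * deriv N y := hM.2.mul_right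
  have hc1 : HasCompactSupport fun y => heff F (jet 2 φ y) * (M y * deriv N y) := hc0.mul_left
  have hXc : HasCompactSupport fun y => -(heff F (jet 2 φ y) * (M y * deriv N y)) :=
    hc1.comp_left (g := Neg.neg) neg_zero
  have hYc : HasCompactSupport fun y => N y * (M y * heff F (jet 2 φ y)) := hN.2.mul_right
  rw [smear, ← MeasureTheory.integral_neg, ← integral_add_deriv hX.continuous hXc hY hYc]
  refine congrArg _ (funext fun x => ?_)
  rw [deriv_mul_smooth hN.1 hMs]
  ring

/-- Every product of two test functions is a combination of Wronskians, so the fundamental lemma of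
the calculus of variations applies. -/
theorem eq_zero_of_integral_mul_wronskian {Q : ℝ → ℝ} (hQ : Continuous Q)
    (h : ∀ N₁ N₂, IsTest N₁ → IsTest N₂ → ∫ x, Q x * wronskian N₁ N₂ x = 0) (x : ℝ) : Q x = 0 := by
  have hc : ∀ g k, IsTest g → IsTest k → ∫ x, k x * (Q x * g x) = 0 := by
    intro g k hg hk
    have hxg : IsTest fun x => x * g x := ⟨contDiff_id.mul hg.1, hg.2.mul_left⟩
    have hxk : IsTest fun x => x * k x := ⟨contDiff_id.mul hk.1, hk.2.mul_left⟩
    have i1 : MeasureTheory.Integrable fun x => Q x * wronskian (fun x => x * g x) k x :=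
      (hQ.mul (contDiff_wronskian hxg.1 hk.1).continuous).integrable_of_hasCompactSupport
        (hasCompactSupport_wronskian hxg.2 hk.2).mul_left
    have i2 : MeasureTheory.Integrable fun x => Q x * wronskian (fun x => x * k x) g x :=
      (hQ.mul (contDiff_wronskian hxk.1 hg.1).continuous).integrable_of_hasCompactSupport
        (hasCompactSupport_wronskian hxk.2 hg.2).mul_left
    -- The identity W(x g, k) + W(x k, g) = −2 g k: the terms with derivatives of g and k cancel.
    have e : (fun x => k x * (Q x * g x)) = fun x => (-1 / 2) *
        (Q x * wronskian (fun x => x * g x) k x + Q x * wronskian (fun x => x * k x) g x) := by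
      funext x
      have d : ∀ r, IsTest r → deriv (fun x => x * r x) x = r x + x * deriv r x := by
        intro r hr
        rw [deriv_mul_smooth (g := fun x => x) contDiff_id hr.1]
        simp
      simp only [wronskian, d g hg, d k hk]
      ring
    rw [e, MeasureTheory.integral_const_mul, MeasureTheory.integral_add i1 i2, h _ _ hxg hk,
      h _ _ hxk hg]
    simp
  -- A bump equal to 1 at x makes Q g compactly supported without changing the value at x.
  let g : ContDiffBump x := default
  have hg : IsTest g := ⟨g.contDiff, g.hasCompactSupport⟩
  have hcont : Continuous fun y => Q y * g y := hQ.mul g.continuous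
  have h0 := ae_eq_zero_of_integral_contDiff_smul_eq_zero
    (μ := MeasureTheory.volume) hcont.locallyIntegrable
    (fun k hk hkc => by simpa using hc g k hg ⟨hk, hkc⟩)
  have h1 : (fun y => Q y * g y) = fun _ => 0 :=
    (hcont.ae_eq_iff_eq _ continuous_const).1 h0
  have h2 := congrFun h1 x
  have h3 : g x = 1 := g.one_of_mem_closedBall (Metric.mem_closedBall_self g.rIn_pos.le)
  simpa [h3] using h2

/-- All powers of E^2 cancel, so both sides of the closure relation are functions of the scalars and
their D-derivatives. The bracket also shows that H_x vanishes exactly where D s_2 = s_3 s_4 / 2. -/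
theorem diffeo_mul_structS (hφ : IsPhasePoint φ) (G : ℝ) (k : ℕ) (x : ℝ) :
    diffeo G (jet 1 φ x) * structS (jet k φ x) = 1 / (2 * G) * (s1 (jet 2 φ x) *
      (2 * (deriv (φ .K2) x / φ .E2 x) - s3 (jet 2 φ x) * s4 (jet 2 φ x))) := by
  have h0 := hφ.E2_ne x
  simp only [diffeo, structS, s1, s3, s4, jet_zero, jet_one]
  field_simp
  ring

theorem contDiffOn_structS (k : ℕ) : ContDiffOn ℝ ∞ (structS : Jet k → ℝ) (admissible k) := by
  unfold structS
  exact ContDiffOn.div (by fun_prop) (by fun_prop) fun j hj => pow_ne_zero 2 hj.2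

/-- The bracket of two Hamiltonian constraints closes iff it does so pointwise. -/
theorem ham_ham_iff (hφ : IsPhasePoint φ) (hF : Smooth5 F) {G : ℝ} (hG : 0 < G) {k : ℕ}
    {μ : Jet k → ℝ} (hμ : ContDiffOn ℝ ∞ μ (admissible k)) :
    (∀ N₁ N₂, IsTest N₁ → IsTest N₂ → bracket G (heff F) N₁ (heff F) N₂ φ
      = smear (diffeo G) (fun x => μ (jet k φ x) * structS (jet k φ x)
          * (N₁ x * deriv N₂ x - N₂ x * deriv N₁ x)) φ) ↔
    ∀ x, 2 * G ^ 2 * closAlong F φ x = μ (jet k φ x) * (s1 (jet 2 φ x) *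
      (2 * (deriv (φ .K2) x / φ .E2 x) - s3 (jet 2 φ x) * s4 (jet 2 φ x))) := by
  have hm : ∀ N₁ N₂, smear (diffeo G) (fun x => μ (jet k φ x) * structS (jet k φ x)
      * (N₁ x * deriv N₂ x - N₂ x * deriv N₁ x)) φ
      = ∫ x, diffeo G (jet 1 φ x) * structS (jet k φ x) * μ (jet k φ x) * wronskian N₁ N₂ x := by
    intro N₁ N₂
    unfold smear wronskian
    congr 1
    funext x
    ring
  have hcd : Continuous fun x => diffeo G (jet 1 φ x) * structS (jet k φ x) * μ (jet k φ x) :=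
    (((contDiff_diffeo G).comp (contDiff_jet hφ.smooth 1)).continuous.mul
      (hφ.contDiff_comp_jet (contDiffOn_structS k)).continuous).mul
      (hφ.contDiff_comp_jet hμ).continuous
  have hcc : Continuous fun x => G * closAlong F φ x :=
    continuous_const.mul (contDiff_closAlong hφ hF).continuous
  constructor
  · intro h x
    have hsub : Continuous fun x => G * closAlong F φ x
        - diffeo G (jet 1 φ x) * structS (jet k φ x) * μ (jet k φ x) := hcc.sub hcd
    -- The difference of the two coefficients integrates to zero against every Wronskian.
    have h0 := eq_zero_of_integral_mul_wronskian hsub (fun N₁ N₂ h₁ h₂ => by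
      have hW := (contDiff_wronskian h₁.1 h₂.1).continuous
      have hWc := hasCompactSupport_wronskian h₁.2 h₂.2
      have h' := h N₁ N₂ h₁ h₂
      rw [bracket_heff_heff hφ hF G h₁ h₂, hm] at h'
      simp only [sub_mul]
      have i1 : MeasureTheory.Integrable fun x => G * closAlong F φ x * wronskian N₁ N₂ x :=
        (hcc.mul hW).integrable_of_hasCompactSupport hWc.mul_left
      have i2 : MeasureTheory.Integrable fun x => diffeo G (jet 1 φ x) * structS (jet k φ x)
          * μ (jet k φ x) * wronskian N₁ N₂ x :=
        (hcd.mul hW).integrable_of_hasCompactSupport hWc.mul_left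
      rw [MeasureTheory.integral_sub i1 i2, h', sub_self]) x
    have e : 2 * G ^ 2 * closAlong F φ x = 2 * G * (G * closAlong F φ x) := by ring
    rw [e, sub_eq_zero.1 h0, diffeo_mul_structS hφ]
    field_simp
  · intro h N₁ N₂ h₁ h₂
    rw [bracket_heff_heff hφ hF G h₁ h₂, hm]
    congr 1
    funext x
    have h' := h x
    have e : G * closAlong F φ x = 1 / (2 * G) * (2 * G ^ 2 * closAlong F φ x) := by field_simp
    rw [diffeo_mul_structS hφ, e, h']
    ring

end phase

end EffGrav

end

open scoped ContDiff

noncomputable section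

namespace EffGrav

/-! ### Hamiltonian vector fields and models that are affine in `s_3`, `s_5` -/

/-- A function of `(s_1, s_2, s_4)` evaluated on jets. -/
def onJet (M : ℝ → ℝ → ℝ → ℝ) (j : Jet 2) : ℝ := M (s1 j) (s2 j) (s4 j)

theorem Smooth3.contDiffOn_onJet {M : ℝ → ℝ → ℝ → ℝ} (hM : Smooth3 M) :
    ContDiffOn ℝ ∞ (onJet M) (admissible 2) :=
  hM.lift5.comp_scal

theorem Smooth3.hasDerivAt_onJet {M : ℝ → ℝ → ℝ → ℝ} (hM : Smooth3 M) {j : Jet 2}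
    (hj : j ∈ admissible 2) (v : Jet 2) :
    HasDerivAt (fun t : ℝ => onJet M (j + t • v)) (onJet (EffGrav.d1 M) j * v .E1 0
      + onJet (EffGrav.d2 M) j * v .K2 0 + onJet (EffGrav.d4 M) j * ds4 j v) 0 := by
  have h := hM.hasDerivAt_comp (hasDerivAt_line j v .E1 0) (hasDerivAt_line j v .K2 0)
    (hasDerivAt_s4_line v hj) (by simpa using hj.1)
  simp only [zero_smul, add_zero] at h
  exact h

theorem Smooth3.fderiv_onJet {M : ℝ → ℝ → ℝ → ℝ} (hM : Smooth3 M) {j : Jet 2}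
    (hj : j ∈ admissible 2) (v : Jet 2) :
    fderiv ℝ (onJet M) j v = onJet (EffGrav.d1 M) j * v .E1 0
      + onJet (EffGrav.d2 M) j * v .K2 0 + onJet (EffGrav.d4 M) j * ds4 j v :=
  fderiv_apply_eq_of_hasDerivAt ((hM.contDiffOn_onJet.differentiableOn (by simp)).differentiableAt
    ((isOpen_admissible 2).mem_nhds hj)) (hM.hasDerivAt_onJet hj v)

theorem hasDerivAt_structS_line {k : ℕ} {j : Jet k} (hj : j ∈ admissible k) (v : Jet k) :
    HasDerivAt (fun t : ℝ => structS (j + t • v))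
      (v .E1 0 / j .E2 0 ^ 2 - 2 * j .E1 0 * v .E2 0 / j .E2 0 ^ 3) 0 := by
  have h2 : j .E2 0 ≠ 0 := hj.2
  refine ((hasDerivAt_line j v .E1 0).div ((hasDerivAt_line j v .E2 0).pow 2)
    (by simpa using h2)).congr_deriv ?_
  simp only [zero_smul, add_zero, Pi.pow_apply]
  field_simp
  simp only [Nat.cast_ofNat, Nat.add_one_sub_one, pow_one]
  ring

theorem Smooth3.fderiv_onJet_mul_structS {μ : ℝ → ℝ → ℝ → ℝ} (hμ : Smooth3 μ) {j : Jet 2}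
    (hj : j ∈ admissible 2) (v : Jet 2) :
    fderiv ℝ (fun j => onJet μ j * structS j) j v
      = (onJet (EffGrav.d1 μ) j * v .E1 0 + onJet (EffGrav.d2 μ) j * v .K2 0
          + onJet (EffGrav.d4 μ) j * ds4 j v) * structS j
        + onJet μ j * (v .E1 0 / j .E2 0 ^ 2 - 2 * j .E1 0 * v .E2 0 / j .E2 0 ^ 3) := by
  apply fderiv_apply_eq_of_hasDerivAt
  · exact ((hμ.contDiffOn_onJet.mul (contDiffOn_structS 2)).differentiableOn
      (by simp)).differentiableAt ((isOpen_admissible 2).mem_nhds hj)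
  · have h := (hμ.hasDerivAt_onJet hj v).mul (hasDerivAt_structS_line hj v)
    simp only [zero_smul, add_zero] at h
    exact h

section phase

variable {φ : Fields} {F : ℝ → ℝ → ℝ → ℝ → ℝ → ℝ} {N : ℝ → ℝ}

theorem hamVec_E1 (hφ : IsPhasePoint φ) (hF : Smooth5 F) (G : ℝ) (N : ℝ → ℝ) :
    hamVec G (heff F) N φ .E1 = fun x => -(2 * G) * (N x * along (p3 F) φ x) := by
  funext x
  simp only [hamVec, varDeriv_heff_K1 hφ hF]
  ring

theorem hamVec_E2 (hφ : IsPhasePoint φ) (hF : Smooth5 F) (G : ℝ) (N : ℝ → ℝ) :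
    hamVec G (heff F) N φ .E2 = fun x => -G * (N x * (φ .E2 x * along (p2 F) φ x)) := by
  funext x
  simp only [hamVec, varDeriv_heff_K2 hφ hF]
  ring

/-- The term in N' has coefficient −2 G F_3 / E^2. Together with the N' term in the variation of K_2
it is all that the covariance condition sees for a function of s_1, s_2, s_4. -/
theorem ds4_hamVec (hφ : IsPhasePoint φ) (hF : Smooth5 F) (G : ℝ) (hN : ContDiff ℝ ∞ N) (x : ℝ) :
    ds4 (jet 2 φ x) (jet 2 (hamVec G (heff F) N φ) x)
      = G * (N x * s4 (jet 2 φ x) * along (p2 F) φ x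
        - 2 * (deriv N x * along (p3 F) φ x + N x * deriv (along (p3 F) φ) x) / φ .E2 x) := by
  have h0 := hφ.E2_ne x
  simp only [ds4, jet_zero, jet_one, hamVec_E1 hφ hF, hamVec_E2 hφ hF, deriv_const_mul_field,
    deriv_mul_smooth hN (hφ.contDiff_along hF.p3), s4_jet]
  field_simp
  ring

theorem jet_hamVec_K2 (hφ : IsPhasePoint φ) (hF : Smooth5 F) (G : ℝ) (hN : ContDiff ℝ ∞ N)
    (x : ℝ) :
    jet 2 (hamVec G (heff F) N φ) x .K2 0 = G * (N x * (along F φ x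
        - s3 (jet 2 φ x) * along (p3 F) φ x
        - s4 (jet 2 φ x) * along (p4 F) φ x - s5 (jet 2 φ x) * along (p5 F) φ x)
      + (deriv N x * along (p5 F) φ x + N x * deriv (along (p5 F) φ) x)
        * s4 (jet 2 φ x) / φ .E2 x) := by
  have h0 := hφ.E2_ne x
  rw [jet_zero]
  simp only [hamVec, varDeriv_heff_E2 hφ hF hN]
  rw [s4_jet]
  field_simp

theorem deriv_onJet (hφ : IsPhasePoint φ) {M : ℝ → ℝ → ℝ → ℝ} (hM : Smooth3 M) (x : ℝ) :
    deriv (fun y => onJet M (jet 2 φ y)) x = onJet (d1 M) (jet 2 φ x) * deriv (φ .E1) x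
      + onJet (d2 M) (jet 2 φ x) * deriv (φ .K2) x
      + onJet (d4 M) (jet 2 φ x) * (φ .E2 x * s5 (jet 2 φ x)) := by
  have h1 : HasDerivAt (fun y => s1 (jet 2 φ y)) (deriv (φ .E1) x) x := by
    simpa only [s1_jet] using ContDiff.hasDerivAt_deriv (hφ.smooth .E1) x
  have h2 : HasDerivAt (fun y => s2 (jet 2 φ y)) (deriv (φ .K2) x) x := by
    simpa only [s2_jet] using ContDiff.hasDerivAt_deriv (hφ.smooth .K2) x
  have h4 := ContDiff.hasDerivAt_deriv (hφ.contDiff_comp_jet contDiffOn_s4) x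
  rw [hφ.deriv_s4] at h4
  exact (hM.hasDerivAt_comp h1 h2 h4 (hφ.jet_mem 2 x).1).deriv

end phase

/-! ### Closure for constraints affine in s_3 and s_5 -/

section lin

variable {f0 f3 f5 : ℝ → ℝ → ℝ → ℝ}

/-- F_3 and F_5 no longer depend on s_3 and s_5, so the terms with v and y drop out. -/
theorem clos_lin (h0 : Smooth3 f0) (h3 : Smooth3 f3) (h5 : Smooth3 f5) {a : ℝ} (ha : 0 < a)
    (b z c w u v y : ℝ) :
    clos (lin f0 f3 f5) a b z c w u v y
      = -2 * f3 a b c * (d4 f0 a b c + d4 f3 a b c * z + d4 f5 a b c * w)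
        + c * (d2 f0 a b c + d2 f3 a b c * z + d2 f5 a b c * w) * f5 a b c
        + 2 * f3 a b c * (c * d1 f5 a b c + u * d2 f5 a b c + w * d4 f5 a b c)
        - 2 * f5 a b c * (c * d1 f3 a b c + u * d2 f3 a b c + w * d4 f3 a b c) := by
  have e1 : ∀ f : ℝ → ℝ → ℝ → ℝ, p1 (fun a b _ c _ => f a b c) a b z c w = d1 f a b c :=
    fun f => rfl
  have e2 : ∀ f : ℝ → ℝ → ℝ → ℝ, p2 (fun a b _ c _ => f a b c) a b z c w = d2 f a b c :=
    fun f => rfl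
  have e4 : ∀ f : ℝ → ℝ → ℝ → ℝ, p4 (fun a b _ c _ => f a b c) a b z c w = d4 f a b c :=
    fun f => rfl
  have e3 : ∀ f : ℝ → ℝ → ℝ → ℝ, p3 (fun a b _ c _ => f a b c) a b z c w = 0 :=
    fun f => deriv_const _ _
  have e5 : ∀ f : ℝ → ℝ → ℝ → ℝ, p5 (fun a b _ c _ => f a b c) a b z c w = 0 :=
    fun f => deriv_const _ _
  simp only [clos, p2_lin h0 h3 h5 ha, p4_lin h0 h3 h5 ha, p3_lin, p5_lin, e1, e2, e3, e4, e5, lin]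
  ring

end lin

theorem massForm_eq_lin (M P B : ℝ → ℝ → ℝ → ℝ) :
    massForm M P B = lin (fun a b c => -2 * (d1 M a b c + B a b c)) (fun a b c => -d2 M a b c)
      (fun a b c => -2 * P a b c) := by
  funext a b z c w
  simp only [massForm, lin]
  ring

theorem Smooth3.add {M N : ℝ → ℝ → ℝ → ℝ} (hM : Smooth3 M) (hN : Smooth3 N) :
    Smooth3 fun a b c => M a b c + N a b c := ContDiffOn.add hM hN
theorem Smooth3.sub {M N : ℝ → ℝ → ℝ → ℝ} (hM : Smooth3 M) (hN : Smooth3 N) :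
    Smooth3 fun a b c => M a b c - N a b c := ContDiffOn.sub hM hN
theorem Smooth3.mul {M N : ℝ → ℝ → ℝ → ℝ} (hM : Smooth3 M) (hN : Smooth3 N) :
    Smooth3 fun a b c => M a b c * N a b c := ContDiffOn.mul hM hN
theorem Smooth3.neg {M : ℝ → ℝ → ℝ → ℝ} (hM : Smooth3 M) :
    Smooth3 fun a b c => -M a b c := ContDiffOn.neg hM
theorem Smooth3.const_mul (r : ℝ) {M : ℝ → ℝ → ℝ → ℝ} (hM : Smooth3 M) :
    Smooth3 fun a b c => r * M a b c := ContDiffOn.mul contDiffOn_const hM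
theorem smooth3_fst : Smooth3 fun a _ _ => a := contDiffOn_fst
theorem smooth3_const (r : ℝ) : Smooth3 fun _ _ _ => r := contDiffOn_const

theorem Smooth3.continuous_last {M : ℝ → ℝ → ℝ → ℝ} (hM : Smooth3 M) {a : ℝ} (ha : 0 < a)
    (b : ℝ) : Continuous fun c => M a b c :=
  (ContDiffOn.continuousOn hM).comp_continuous (f := fun c : ℝ => (a, b, c)) (by fun_prop)
    fun _ => ha

/-- The set s_4 ≠ 0 is dense. This justifies cancelling a factor s_4 in identities between smooth
functions. -/
theorem Smooth3.eq_of_eq_of_ne_zero {M N : ℝ → ℝ → ℝ → ℝ} (hM : Smooth3 M) (hN : Smooth3 N)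
    {a : ℝ} (ha : 0 < a) (b : ℝ) (h : ∀ c, c ≠ 0 → M a b c = N a b c) (c : ℝ) :
    M a b c = N a b c :=
  congrFun (Continuous.ext_on (dense_compl_singleton (0 : ℝ)) (hM.continuous_last ha b)
    (hN.continuous_last ha b) fun c hc => h c hc) c

/-! ### Models defined by a mass function -/

section mass

variable {M μ P B : ℝ → ℝ → ℝ → ℝ}

theorem IsQuotient.d1_d4 (hP : IsQuotient M P) {a b c : ℝ} (ha : 0 < a) :
    d1 (d4 M) a b c = c * d1 P a b c :=
  (d1_congr hP.2 ha).trans ((hP.1.hasDerivAt_d1 ha).const_mul c).deriv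

theorem IsQuotient.d2_d4 (hP : IsQuotient M P) {a b c : ℝ} (ha : 0 < a) :
    d2 (d4 M) a b c = c * d2 P a b c :=
  (d2_congr hP.2 ha).trans ((hP.1.hasDerivAt_d2 ha).const_mul c).deriv

/-- With ∂_4 M = s_4 P both sides of the first covariance equation carry a factor s_4, which cancels
off s_4 = 0 and then everywhere by continuity. -/
theorem mul_mu_eq (hM : Smooth3 M) (hμ : Smooth3 μ) (hP : IsQuotient M P) {G : ℝ} (hG : 0 < G)
    (hE : CovarianceEquations G M μ) {a : ℝ} (ha : 0 < a) (b c : ℝ) :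
    a * μ a b c
      = 2 * G ^ 2 * (2 * (d2 M a b c * d2 P a b c) - 2 * (P a b c * d2 (d2 M) a b c)) := by
  refine Smooth3.eq_of_eq_of_ne_zero (smooth3_fst.mul hμ)
    (Smooth3.const_mul (2 * G ^ 2) (((hM.d2.mul hP.1.d2).const_mul 2).sub
      ((hP.1.mul hM.d2.d2).const_mul 2))) ha b (fun c hc => ?_) c
  have h := hE.eq_mu a b c ha
  rw [hP.d2_d4 ha, hP.2 a b c ha, div_eq_iff (by positivity)] at h
  apply mul_right_cancel₀ hc
  linear_combination h

theorem smooth5_massForm (hM : Smooth3 M) (hP : IsQuotient M P) (hB : Smooth3 B) :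
    Smooth5 (massForm M P B) := by
  rw [massForm_eq_lin]
  exact smooth5_lin ((hM.d1.add hB).const_mul _) hM.d2.neg (hP.1.const_mul _)

/-- Here f3 = −∂_2 M and f5 = −2P. The u-terms reproduce μ through `mul_mu_eq`. Equality of mixed
derivatives of M turns the s_3 terms into the matching multiple of the same determinant, cancels the
s_5 terms, and cancels the contributions of ∂_1 M. What is left is the Jacobian of M and B, which
vanishes by hypothesis. -/
theorem clos_massForm (hM : Smooth3 M) (hμ : Smooth3 μ) (hP : IsQuotient M P) (hB : Smooth3 B)
    {G : ℝ} (hG : 0 < G) (hE : CovarianceEquations G M μ)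
    (hMB : ∀ a b c, 0 < a → d2 M a b c * d4 B a b c - d4 M a b c * d2 B a b c = 0)
    {a : ℝ} (ha : 0 < a) (b z c w u v y : ℝ) :
    2 * G ^ 2 * clos (massForm M P B) a b z c w u v y = μ a b c * (a * (2 * u - z * c)) := by
  rw [massForm_eq_lin, clos_lin ((hM.d1.add hB).const_mul _) hM.d2.neg (hP.1.const_mul _) ha]
  have e40 : d4 (fun a b c => -2 * (d1 M a b c + B a b c)) a b c
      = -2 * (d4 (d1 M) a b c + d4 B a b c) :=
    (((hM.d1.hasDerivAt_d4 ha).add (hB.hasDerivAt_d4 ha)).const_mul _).deriv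
  have e20 : d2 (fun a b c => -2 * (d1 M a b c + B a b c)) a b c
      = -2 * (d2 (d1 M) a b c + d2 B a b c) :=
    (((hM.d1.hasDerivAt_d2 ha).add (hB.hasDerivAt_d2 ha)).const_mul _).deriv
  have e13 : d1 (fun a b c => -d2 M a b c) a b c = -d1 (d2 M) a b c :=
    (hM.d2.hasDerivAt_d1 ha).neg.deriv
  have e23 : d2 (fun a b c => -d2 M a b c) a b c = -d2 (d2 M) a b c :=
    (hM.d2.hasDerivAt_d2 ha).neg.deriv
  have e43 : d4 (fun a b c => -d2 M a b c) a b c = -d4 (d2 M) a b c :=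
    (hM.d2.hasDerivAt_d4 ha).neg.deriv
  have e15 : d1 (fun a b c => -2 * P a b c) a b c = -2 * d1 P a b c :=
    ((hP.1.hasDerivAt_d1 ha).const_mul _).deriv
  have e25 : d2 (fun a b c => -2 * P a b c) a b c = -2 * d2 P a b c :=
    ((hP.1.hasDerivAt_d2 ha).const_mul _).deriv
  have e45 : d4 (fun a b c => -2 * P a b c) a b c = -2 * d4 P a b c :=
    ((hP.1.hasDerivAt_d4 ha).const_mul _).deriv
  have hmu := mul_mu_eq hM hμ hP hG hE ha b c
  have hB' := hMB a b c ha
  rw [hP.2 a b c ha] at hB'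
  have h14 : d4 (d1 M) a b c = c * d1 P a b c := by rw [← hM.d1_d4 ha, hP.d1_d4 ha]
  have h24 : d4 (d2 M) a b c = c * d2 P a b c := by rw [← hM.d2_d4 ha, hP.d2_d4 ha]
  rw [e40, e20, e13, e23, e43, e15, e25, e45, h14, h24, hM.d1_d2 ha]
  linear_combination (-(2 * u - z * c)) * hmu - 8 * G ^ 2 * hB'

theorem along_p3_massForm (φ : Fields) :
    along (p3 (massForm M P B)) φ = fun y => onJet (fun a b c => -d2 M a b c) (jet 2 φ y) := by
  rw [massForm_eq_lin, p3_lin]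
  rfl

theorem along_p5_massForm (φ : Fields) :
    along (p5 (massForm M P B)) φ = fun y => onJet (fun a b c => -2 * P a b c) (jet 2 φ y) := by
  rw [massForm_eq_lin, p5_lin]
  rfl

theorem closedAlgebra_massForm (hM : Smooth3 M) (hμ : Smooth3 μ) (hP : IsQuotient M P)
    (hB : Smooth3 B) {G : ℝ} (hG : 0 < G) (hE : CovarianceEquations G M μ)
    (hMB : ∀ a b c, 0 < a → d2 M a b c * d4 B a b c - d4 M a b c * d2 B a b c = 0) :
    ClosedAlgebra G (heff (massForm M P B)) (onJet μ) where
  diffeo_diffeo _ hφ _ _ h₁ h₂ := bracket_diffeo_diffeo hφ hG h₁ h₂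
  ham_diffeo _ hφ _ _ hN hN' := bracket_heff_diffeo hφ (smooth5_massForm hM hP hB) hG hN hN'
  ham_ham _ hφ := (ham_ham_iff hφ (smooth5_massForm hM hP hB) hG hμ.contDiffOn_onJet).2 fun x =>
    clos_massForm hM hμ hP hB hG hE hMB (hφ.jet_mem 2 x).1 _ _ _ _ _ _ _

/-- The two sides differ only by terms in α'. These enter through the variations of K_2 and s_4 and
combine to the Jacobian of μ and M in (s_2, s_4). -/
theorem covarianceConditions_massForm (hM : Smooth3 M) (hμ : Smooth3 μ) (hP : IsQuotient M P)
    (hB : Smooth3 B) {G : ℝ} (hE : CovarianceEquations G M μ) :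
    CovarianceConditions G (heff (massForm M P B)) (onJet μ) where
  indep j hj n hn := (smooth5_massForm hM hP hB).pd_K1_of_ne hj hn
  bracket_eq φ hφ α N hα hN x := by
    have hF := smooth5_massForm hM hP hB
    have hj := hφ.jet_mem 2 x
    have hαN : ContDiff ℝ ∞ fun y => α y * N y := hα.mul hN
    have h0 := hφ.E2_ne x
    have ha : 0 < s1 (jet 2 φ x) := hj.1
    have h := hE.eq_dmu (s1 (jet 2 φ x)) (s2 (jet 2 φ x)) (s4 (jet 2 φ x)) ha
    rw [hP.2 _ _ _ ha] at h
    simp only [bracketAt_eq, hμ.fderiv_onJet_mul_structS hj, ds4_hamVec hφ hF G hN,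
      ds4_hamVec hφ hF G hαN, jet_hamVec_K2 hφ hF G hN, jet_hamVec_K2 hφ hF G hαN,
      deriv_mul_smooth hα hN, jet_zero, hamVec_E1 hφ hF, hamVec_E2 hφ hF]
    simp only [along_p3_massForm, along_p5_massForm, onJet]
    linear_combination (2 * G * structS (jet 2 φ x) * deriv α x * N x / φ .E2 x) * h

/-- When H_x = 0, D s_2 = s_3 s_4 / 2, so D M = s_4 (∂_1 M + s_3 ∂_2 M / 2 + P s_5) = −s_4 F / 2 and
diffeomorphisms preserve M on H_eff = 0. The bracket with H_eff[N] reduces in the same way to a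
multiple of F ∂_2 M. Both steps use that there is no additional term B. -/
theorem isDiracObservable_massForm (hM : Smooth3 M) (hP : IsQuotient M P) {G : ℝ} (hG : 0 < G) :
    IsDiracObservable G (heff (massForm M P fun _ _ _ => 0)) (onJet M) := by
  intro φ hφ hh hd N Nx hN hNx x
  have hB : Smooth3 fun _ _ _ => (0 : ℝ) := smooth3_const 0
  have hF := smooth5_massForm hM hP hB
  have hj := hφ.jet_mem 2 x
  have ha : 0 < s1 (jet 2 φ x) := hj.1
  have h0 := hφ.E2_ne x
  have hF0 : massForm M P (fun _ _ _ => 0) (s1 (jet 2 φ x)) (s2 (jet 2 φ x)) (s3 (jet 2 φ x))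
      (s4 (jet 2 φ x)) (s5 (jet 2 φ x)) = 0 := by
    have := hh x
    simp only [heff, jet_zero] at this
    exact (mul_eq_zero.1 this).resolve_left h0
  have hE1 : deriv (φ .E1) x = φ .E2 x * s4 (jet 2 φ x) := by
    rw [s4_jet, mul_div_cancel₀ _ h0]
  -- The constraint H_x = 0 solved for ∂_x K_2.
  have hK2 : deriv (φ .K2) x = φ .E2 x * (s3 (jet 2 φ x) * s4 (jet 2 φ x)) / 2 := by
    have := hd x
    simp only [diffeo, jet_zero, jet_one, hE1] at this
    rw [s3_jet]
    field_simp at this ⊢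
    rw [mul_zero, mul_eq_zero] at this
    linarith [this.resolve_left h0]
  rw [bracketAt_eq, bracketAt_eq, hM.fderiv_onJet hj, hM.fderiv_onJet hj, hamVec_diffeo hφ hG hNx,
    ds4_lie hφ hNx, ds4_hamVec hφ hF G hN, jet_hamVec_K2 hφ hF G hN, jet_zero, jet_zero, jet_zero,
    hamVec_E1 hφ hF, along_p3_massForm, along_p5_massForm,
    deriv_onJet hφ hM.d2.neg, deriv_onJet hφ (hP.1.const_mul _), hE1, hK2]
  simp only [lie, along, hE1, hK2, hF0]
  rw [massForm_eq_lin, p2_lin ((hM.d1.add hB).const_mul _) hM.d2.neg (hP.1.const_mul _) ha,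
    p4_lin ((hM.d1.add hB).const_mul _) hM.d2.neg (hP.1.const_mul _) ha]
  simp only [massForm] at hF0
  simp only [onJet, lin]
  generalize s1 (jet 2 φ x) = a at *
  generalize s2 (jet 2 φ x) = b at *
  generalize s3 (jet 2 φ x) = z at *
  generalize s4 (jet 2 φ x) = c at *
  generalize s5 (jet 2 φ x) = w at *
  have e40 : d4 (fun a b c => -2 * (d1 M a b c + 0)) a b c = -2 * (d4 (d1 M) a b c) := by
    simp only [add_zero]
    exact ((hM.d1.hasDerivAt_d4 ha).const_mul _).deriv
  have e20 : d2 (fun a b c => -2 * (d1 M a b c + 0)) a b c = -2 * (d2 (d1 M) a b c) := by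
    simp only [add_zero]
    exact ((hM.d1.hasDerivAt_d2 ha).const_mul _).deriv
  have e13 : d1 (fun a b c => -d2 M a b c) a b c = -d1 (d2 M) a b c :=
    (hM.d2.hasDerivAt_d1 ha).neg.deriv
  have e23 : d2 (fun a b c => -d2 M a b c) a b c = -d2 (d2 M) a b c :=
    (hM.d2.hasDerivAt_d2 ha).neg.deriv
  have e43 : d4 (fun a b c => -d2 M a b c) a b c = -d4 (d2 M) a b c :=
    (hM.d2.hasDerivAt_d4 ha).neg.deriv
  have e15 : d1 (fun a b c => -2 * P a b c) a b c = -2 * d1 P a b c :=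
    ((hP.1.hasDerivAt_d1 ha).const_mul _).deriv
  have e25 : d2 (fun a b c => -2 * P a b c) a b c = -2 * d2 P a b c :=
    ((hP.1.hasDerivAt_d2 ha).const_mul _).deriv
  have e45 : d4 (fun a b c => -2 * P a b c) a b c = -2 * d4 P a b c :=
    ((hP.1.hasDerivAt_d4 ha).const_mul _).deriv
  have h14 : d4 (d1 M) a b c = c * d1 P a b c := by rw [← hM.d1_d4 ha, hP.d1_d4 ha]
  have h24 : d4 (d2 M) a b c = c * d2 P a b c := by rw [← hM.d2_d4 ha, hP.d2_d4 ha]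
  rw [e40, e20, e13, e23, e43, e15, e25, e45, h14, h24, hM.d1_d2 ha, hP.2 a b c ha]
  field_simp
  -- The first coefficient is the transport of M along Nx, the second its evolution under N; each
  -- multiplies F = 0.
  linear_combination (-Nx x * φ .E2 x ^ 2 * c - 2 * G * N x * φ .E2 x * d2 M a b c) * hF0

end mass

end EffGrav

end

open scoped ContDiff

noncomputable section

namespace EffGrav

/-! ### Level coordinates of a mass function -/

/-- A box in `ℝ³`. -/
def box (p : ℝ × ℝ × ℝ) (ε : ℝ) : Set (ℝ × ℝ × ℝ) :=
  Metric.ball p.1 ε ×ˢ Metric.ball p.2.1 ε ×ˢ Metric.ball p.2.2 ε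

theorem box_eq_ball (p : ℝ × ℝ × ℝ) (ε : ℝ) : box p ε = Metric.ball p ε := by
  rw [box, ball_prod_same, ball_prod_same]

theorem Smooth3.isOpen_regularSet {M : ℝ → ℝ → ℝ → ℝ} (hM : Smooth3 M) :
    IsOpen (regularSet M) := by
  have h2 := hM.d2.continuousOn.isOpen_inter_preimage isOpen_pos_fst
    (isOpen_compl_singleton (x := (0 : ℝ)))
  have h4 := hM.d4.continuousOn.isOpen_inter_preimage isOpen_pos_fst
    (isOpen_compl_singleton (x := (0 : ℝ)))
  have e : regularSet M = {q | 0 < q.1} ∩ (fun q => EffGrav.d2 M q.1 q.2.1 q.2.2) ⁻¹' {0}ᶜ ∪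
      {q | 0 < q.1} ∩ (fun q => EffGrav.d4 M q.1 q.2.1 q.2.2) ⁻¹' {0}ᶜ := by
    rw [← Set.inter_union_distrib_left]
    rfl
  rw [e]
  exact h2.union h4

/-- The inverse function theorem for q ↦ (s_1, M, l). The image is cut down to a box, so that level
sets of (s_1, M) become intervals in the third coordinate. -/
theorem exists_chart_of_injective {M : ℝ → ℝ → ℝ → ℝ} (hM : Smooth3 M)
    (l : ℝ × ℝ × ℝ →L[ℝ] ℝ) {U : Set (ℝ × ℝ × ℝ)} (hU : IsOpen U) (hUr : U ⊆ {q | 0 < q.1})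
    (hinj : ∀ q ∈ U, ∀ h : ℝ × ℝ × ℝ, h.1 = 0 → fderiv ℝ (unc3 M) q h = 0 → l h = 0 → h = 0)
    {q₀ : ℝ × ℝ × ℝ} (hq₀ : q₀ ∈ U) :
    ∃ (V : Set (ℝ × ℝ × ℝ)) (Ψ : ℝ × ℝ × ℝ → ℝ × ℝ × ℝ) (p₀ : ℝ × ℝ × ℝ) (ε : ℝ),
      0 < ε ∧ IsOpen V ∧ q₀ ∈ V ∧ V ⊆ U ∧ ContDiffOn ℝ ∞ Ψ (box p₀ ε) ∧
      (∀ p ∈ box p₀ ε, Ψ p ∈ V ∧ (Ψ p).1 = p.1 ∧ unc3 M (Ψ p) = p.2.1) ∧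
      (∀ q ∈ V, (q.1, unc3 M q, l q) ∈ box p₀ ε ∧ Ψ (q.1, unc3 M q, l q) = q) ∧
      p₀ = (q₀.1, unc3 M q₀, l q₀) := by
  have hMd : ∀ q ∈ U, ContDiffAt ℝ ∞ (unc3 M) q := fun q hq =>
    ContDiffOn.contDiffAt hM (isOpen_pos_fst.mem_nhds (hUr hq))
  let Φ : ℝ × ℝ × ℝ → ℝ × ℝ × ℝ := fun q => (q.1, unc3 M q, l q)
  have hΦ : ∀ q ∈ U, ContDiffAt ℝ ∞ Φ q := fun q hq =>
    contDiffAt_fst.prodMk ((hMd q hq).prodMk l.contDiff.contDiffAt)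
  have hΦ' : ∀ q ∈ U, ∃ L : (ℝ × ℝ × ℝ) ≃L[ℝ] (ℝ × ℝ × ℝ),
      HasFDerivAt Φ (L : (ℝ × ℝ × ℝ) →L[ℝ] (ℝ × ℝ × ℝ)) q := by
    intro q hq
    let A : (ℝ × ℝ × ℝ) →L[ℝ] (ℝ × ℝ × ℝ) :=
      (ContinuousLinearMap.fst ℝ ℝ (ℝ × ℝ)).prod ((fderiv ℝ (unc3 M) q).prod l)
    have hA : HasFDerivAt Φ A q :=
      hasFDerivAt_fst.prodMk (((hMd q hq).differentiableAt (by simp)).hasFDerivAt.prodMk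
        l.hasFDerivAt)
    have hi : Function.Injective (A : (ℝ × ℝ × ℝ) →ₗ[ℝ] (ℝ × ℝ × ℝ)) := by
      refine (injective_iff_map_eq_zero _).2 fun h hh => ?_
      have hh' : (h.1, fderiv ℝ (unc3 M) q h, l h) = (0, 0, 0) := hh
      simp only [Prod.mk.injEq] at hh'
      exact hinj q hq h hh'.1 hh'.2.1 hh'.2.2
    -- An injective endomorphism of a finite-dimensional space is invertible.
    refine ⟨(LinearEquiv.ofInjectiveEndo _ hi).toContinuousLinearEquiv, ?_⟩
    convert hA using 1
    exact ContinuousLinearMap.ext fun _ => rfl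
  obtain ⟨L₀, hL₀⟩ := hΦ' q₀ hq₀
  let e₀ := (hΦ q₀ hq₀).toOpenPartialHomeomorph Φ hL₀ (by simp)
  have hs₀ : q₀ ∈ e₀.source := (hΦ q₀ hq₀).mem_toOpenPartialHomeomorph_source hL₀ (by simp)
  have he₀ : ∀ q, e₀ q = Φ q := fun q => rfl
  let e₁ := e₀.restrOpen U hU
  have hs₁ : e₁.source = e₀.source ∩ U := e₀.restrOpen_source U hU
  have he₁ : ∀ q, e₁ q = Φ q := fun q => rfl
  have hq₁ : q₀ ∈ e₁.source := by rw [hs₁]; exact ⟨hs₀, hq₀⟩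
  -- The sup metric makes a ball in the target a product box; its preimage is the domain of the
  -- chart.
  obtain ⟨ε, hε, hball⟩ := Metric.isOpen_iff.1 e₁.open_target (Φ q₀) (e₁.map_source hq₁)
  rw [← box_eq_ball] at hball
  have hbo : IsOpen (box (Φ q₀) ε) := by rw [box_eq_ball]; exact Metric.isOpen_ball
  refine ⟨e₁.source ∩ e₁ ⁻¹' box (Φ q₀) ε, e₁.symm, Φ q₀, ε, hε,
    e₁.isOpen_inter_preimage hbo, ⟨hq₁, ?_⟩, ?_, ?_, ?_, ?_, rfl⟩
  · rw [Set.mem_preimage, he₁, box_eq_ball]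
    exact Metric.mem_ball_self hε
  · rintro q ⟨hq, -⟩
    rw [hs₁] at hq
    exact hq.2
  · intro p hp
    have hpt := hball hp
    have hpU : e₁.symm p ∈ U := (hs₁ ▸ e₁.map_target hpt : e₁.symm p ∈ e₀.source ∩ U).2
    obtain ⟨L, hL⟩ := hΦ' _ hpU
    exact (e₁.contDiffAt_symm hpt hL (hΦ _ hpU)).contDiffWithinAt
  · intro p hp
    have hpt := hball hp
    have hr : Φ (e₁.symm p) = p := e₁.right_inv hpt
    refine ⟨⟨e₁.map_target hpt, ?_⟩, (congrArg Prod.fst hr :),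
      (congrArg (fun r : ℝ × ℝ × ℝ => r.2.1) hr :)⟩
    rw [Set.mem_preimage, he₁, hr]
    exact hp
  · rintro q ⟨hq, hqb⟩
    exact ⟨hqb, e₁.left_inv hq⟩

/-- At a regular point one of ∂_2 M, ∂_4 M is nonzero; the third coordinate l is then s_4 or s_2
respectively, the direction not used by M. -/
theorem exists_chart {M : ℝ → ℝ → ℝ → ℝ} (hM : Smooth3 M) {U : Set (ℝ × ℝ × ℝ)} (hU : IsOpen U)
    {q₀ : ℝ × ℝ × ℝ} (hq₀ : q₀ ∈ U) (hr : q₀ ∈ regularSet M) :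
    ∃ (V : Set (ℝ × ℝ × ℝ)) (Ψ : ℝ × ℝ × ℝ → ℝ × ℝ × ℝ) (p₀ : ℝ × ℝ × ℝ) (ε : ℝ)
      (l : ℝ × ℝ × ℝ →L[ℝ] ℝ),
      0 < ε ∧ IsOpen V ∧ q₀ ∈ V ∧ V ⊆ U ∩ regularSet M ∧ ContDiffOn ℝ ∞ Ψ (box p₀ ε) ∧
      (∀ p ∈ box p₀ ε, Ψ p ∈ V ∧ (Ψ p).1 = p.1 ∧ unc3 M (Ψ p) = p.2.1) ∧
      (∀ q ∈ V, (q.1, unc3 M q, l q) ∈ box p₀ ε ∧ Ψ (q.1, unc3 M q, l q) = q) ∧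
      p₀ = (q₀.1, unc3 M q₀, l q₀) := by
  have hUr := hU.inter hM.isOpen_regularSet
  rcases hr.2 with h | h
  · have ho := hM.d2.continuousOn.isOpen_inter_preimage isOpen_pos_fst
      (isOpen_compl_singleton (x := (0 : ℝ)))
    obtain ⟨V, Ψ, p₀, ε, h1, h2, h3, h4, h5⟩ := exists_chart_of_injective hM
      ((ContinuousLinearMap.snd ℝ ℝ ℝ).comp (ContinuousLinearMap.snd ℝ ℝ (ℝ × ℝ)))
      (hUr.inter ho) (fun q hq => hq.2.1) (fun q hq v hv1 hv2 hv3 => by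
        obtain ⟨a, b, c⟩ := q
        obtain ⟨v1, v2, v3⟩ := v
        obtain rfl : v1 = 0 := hv1
        obtain rfl : v3 = 0 := hv3
        have e : ((0, v2, 0) : ℝ × ℝ × ℝ) = v2 • (0, 1, 0) := by simp
        rw [e, map_smul, ← hM.d2_eq hq.2.1, smul_eq_mul, mul_eq_zero] at hv2
        rw [hv2.resolve_right hq.2.2]
        rfl) (q₀ := q₀) ⟨⟨hq₀, hr⟩, hr.1, h⟩
    exact ⟨V, Ψ, p₀, ε, _, h1, h2, h3, h4.trans Set.inter_subset_left, h5⟩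
  · have ho := hM.d4.continuousOn.isOpen_inter_preimage isOpen_pos_fst
      (isOpen_compl_singleton (x := (0 : ℝ)))
    obtain ⟨V, Ψ, p₀, ε, h1, h2, h3, h4, h5⟩ := exists_chart_of_injective hM
      ((ContinuousLinearMap.fst ℝ ℝ ℝ).comp (ContinuousLinearMap.snd ℝ ℝ (ℝ × ℝ)))
      (hUr.inter ho) (fun q hq => hq.2.1) (fun q hq v hv1 hv2 hv3 => by
        obtain ⟨a, b, c⟩ := q
        obtain ⟨v1, v2, v3⟩ := v
        obtain rfl : v1 = 0 := hv1
        obtain rfl : v2 = 0 := hv3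
        have e : ((0, 0, v3) : ℝ × ℝ × ℝ) = v3 • (0, 0, 1) := by simp
        rw [e, map_smul, ← hM.d4_eq hq.2.1, smul_eq_mul, mul_eq_zero] at hv2
        rw [hv2.resolve_right hq.2.2]
        rfl) (q₀ := q₀) ⟨⟨hq₀, hr⟩, hr.1, h⟩
    exact ⟨V, Ψ, p₀, ε, _, h1, h2, h3, h4.trans Set.inter_subset_left, h5⟩

/-- In a chart with box-shaped image, each level set is the continuous image of a convex set. -/
theorem exists_isLevelDomain {M : ℝ → ℝ → ℝ → ℝ} (hM : Smooth3 M) {q₀ : ℝ × ℝ × ℝ}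
    (hr : q₀ ∈ regularSet M) : ∃ V, q₀ ∈ V ∧ IsLevelDomain M V := by
  obtain ⟨V, Ψ, p₀, ε, l, -, hV, hq, hVr, hΨ, hΨV, hVΨ, -⟩ := exists_chart hM isOpen_univ trivial hr
  refine ⟨V, hq, hV, fun q hq => (hVr hq).2, fun a m => ?_⟩
  have e : {q ∈ V | q.1 = a ∧ M q.1 q.2.1 q.2.2 = m}
      = Ψ '' (box p₀ ε ∩ {p | p.1 = a ∧ p.2.1 = m}) := by
    ext q
    constructor
    · rintro ⟨hq, h1, h2⟩
      exact ⟨_, ⟨(hVΨ q hq).1, h1, h2⟩, (hVΨ q hq).2⟩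
    · rintro ⟨p, ⟨hp, h1, h2⟩, rfl⟩
      obtain ⟨h3, h4, h5⟩ := hΨV p hp
      exact ⟨h3, h4.trans h1, h5.trans h2⟩
  rw [e]
  refine IsPreconnected.image ?_ _ (hΨ.continuousOn.mono Set.inter_subset_left)
  apply Convex.isPreconnected
  rw [box_eq_ball]
  refine (convex_ball _ _).inter ?_
  rintro x ⟨hx1, hx2⟩ y ⟨hy1, hy2⟩ s t - - hst
  simp only [Set.mem_ofPred_eq, Prod.fst_add, Prod.snd_add, Prod.smul_fst, Prod.smul_snd, hx1, hx2,
    hy1, hy2, smul_eq_mul, ← add_mul, hst, one_mul, and_self]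

/-- A function Poisson commuting with `M` is locally a function of `s_1` and `M`. -/
theorem eq_of_level {M B : ℝ → ℝ → ℝ → ℝ} (hM : Smooth3 M) (hB : Smooth3 B)
    (hMB : ∀ a b c, 0 < a → d2 M a b c * d4 B a b c - d4 M a b c * d2 B a b c = 0)
    {V : Set (ℝ × ℝ × ℝ)} {Ψ : ℝ × ℝ × ℝ → ℝ × ℝ × ℝ} {p₀ : ℝ × ℝ × ℝ} {ε : ℝ}
    (hVr : V ⊆ regularSet M) (hΨ : ContDiffOn ℝ ∞ Ψ (box p₀ ε))
    (hΨV : ∀ p ∈ box p₀ ε, Ψ p ∈ V ∧ (Ψ p).1 = p.1 ∧ unc3 M (Ψ p) = p.2.1)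
    {a m c c' : ℝ} (h : (a, m, c) ∈ box p₀ ε) (h' : (a, m, c') ∈ box p₀ ε) :
    unc3 B (Ψ (a, m, c)) = unc3 B (Ψ (a, m, c')) := by
  have hbo : IsOpen (box p₀ ε) := by rw [box_eq_ball]; exact Metric.isOpen_ball
  have hin : ∀ t ∈ Metric.ball p₀.2.2 ε, (a, m, t) ∈ box p₀ ε := fun t ht => ⟨h.1, h.2.1, ht⟩
  have hd : ∀ t ∈ Metric.ball p₀.2.2 ε, HasDerivAt (fun t => unc3 B (Ψ (a, m, t))) 0 t := by
    intro t ht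
    obtain ⟨hV, h1, -⟩ := hΨV _ (hin t ht)
    obtain ⟨ha, hr⟩ := hVr hV
    have hl : HasDerivAt (fun t : ℝ => (a, m, t)) ((0, 0, 1) : ℝ × ℝ × ℝ) t :=
      (hasDerivAt_const _ _).prodMk ((hasDerivAt_const _ _).prodMk (hasDerivAt_id t))
    have hγ := ((hΨ.contDiffAt (hbo.mem_nhds (hin t ht))).differentiableAt
      (by simp)).hasFDerivAt.comp_hasDerivAt t hl
    obtain ⟨v1, v2, v4, hv⟩ : ∃ v1 v2 v4 : ℝ,
        fderiv ℝ Ψ (a, m, t) (0, 0, 1) = (v1, v2, v4) := ⟨_, _, _, rfl⟩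
    rw [hv] at hγ
    have g1 : HasDerivAt (fun t => (Ψ (a, m, t)).1) v1 t :=
      (ContinuousLinearMap.fst ℝ ℝ (ℝ × ℝ)).hasFDerivAt.comp_hasDerivAt t hγ
    have g' : HasDerivAt (fun t => (Ψ (a, m, t)).2) (v2, v4) t :=
      (ContinuousLinearMap.snd ℝ ℝ (ℝ × ℝ)).hasFDerivAt.comp_hasDerivAt t hγ
    have g2 : HasDerivAt (fun t => (Ψ (a, m, t)).2.1) v2 t :=
      (ContinuousLinearMap.fst ℝ ℝ ℝ).hasFDerivAt.comp_hasDerivAt t g'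
    have g4 : HasDerivAt (fun t => (Ψ (a, m, t)).2.2) v4 t :=
      (ContinuousLinearMap.snd ℝ ℝ ℝ).hasFDerivAt.comp_hasDerivAt t g'
    have hnear : ∀ᶠ s in nhds t, s ∈ Metric.ball p₀.2.2 ε := Metric.isOpen_ball.mem_nhds ht
    have hv1 : v1 = 0 := by
      refine g1.unique ((hasDerivAt_const t a).congr_of_eventuallyEq ?_)
      filter_upwards [hnear] with s hs using (hΨV _ (hin s hs)).2.1
    have kM := hM.hasDerivAt_comp g1 g2 g4 ha
    have kM0 := kM.unique ((hasDerivAt_const t m).congr_of_eventuallyEq (by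
      filter_upwards [hnear] with s hs using (hΨV _ (hin s hs)).2.2))
    have kB := hB.hasDerivAt_comp g1 g2 g4 ha
    refine kB.congr_deriv ?_
    have hc := hMB _ (Ψ (a, m, t)).2.1 (Ψ (a, m, t)).2.2 ha
    subst hv1
    -- The tangent (0, v2, v4) is annihilated by dM. The vanishing Jacobian makes the gradients of B
    -- and M in (s_2, s_4) parallel, so it is annihilated by dB too; multiplication by the nonzero
    -- partial of M avoids a division.
    rcases hr with hr | hr
    · apply mul_left_cancel₀ hr
      linear_combination v4 * hc + d2 B _ _ _ * kM0
    · apply mul_left_cancel₀ hr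
      linear_combination -v2 * hc + d4 B _ _ _ * kM0
  exact IsOpen.is_const_of_deriv_eq_zero (f := fun t => unc3 B (Ψ (a, m, t))) Metric.isOpen_ball
    (convex_ball _ _).isPreconnected
    (fun t ht => (hd t ht).differentiableAt.differentiableWithinAt)
    (fun t ht => (hd t ht).deriv) h.2.2 h'.2.2

/-- B is locally constant on the level sets of (s_1, M), and connectedness of these sets in V makes
it constant there. Smoothness of the resulting function of (s_1, M) is read off in a chart. -/
theorem isRTerm_of_commute {M B : ℝ → ℝ → ℝ → ℝ} (hM : Smooth3 M) (hB : Smooth3 B)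
    (hMB : ∀ a b c, 0 < a → d2 M a b c * d4 B a b c - d4 M a b c * d2 B a b c = 0) :
    IsRTerm M B := by
  refine ⟨hB, fun V hV => ?_⟩
  have hwell : ∀ q ∈ V, ∀ q' ∈ V, q.1 = q'.1 → unc3 M q = unc3 M q' → unc3 B q = unc3 B q' := by
    intro q hq q' hq' h1 h2
    have hloc : ∀ x ∈ {r ∈ V | r.1 = q'.1 ∧ M r.1 r.2.1 r.2.2 = unc3 M q'},
        ∀ᶠ y in nhdsWithin x {r ∈ V | r.1 = q'.1 ∧ M r.1 r.2.1 r.2.2 = unc3 M q'},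
          unc3 B x = unc3 B y := by
      rintro x ⟨hx, hx1, hx2⟩
      obtain ⟨W, Ψ, p₀, ε, l, -, hW, hxW, hWr, hΨ, hΨW, hWΨ, -⟩ :=
        exists_chart hM hV.isOpen hx (hV.regular hx)
      have hWn : W ∈ nhdsWithin x {r ∈ V | r.1 = q'.1 ∧ M r.1 r.2.1 r.2.2 = unc3 M q'} :=
        mem_nhdsWithin_of_mem_nhds (hW.mem_nhds hxW)
      filter_upwards [hWn, self_mem_nhdsWithin] with y hyW hy
      obtain ⟨-, hy1, hy2⟩ := hy
      have e1 := hWΨ x hxW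
      have e2 := hWΨ y hyW
      have hx2' : unc3 M x = unc3 M q' := hx2
      have hy2' : unc3 M y = unc3 M q' := hy2
      rw [hx1, hx2'] at e1
      rw [hy1, hy2'] at e2
      rw [← e1.2, ← e2.2]
      exact eq_of_level hM hB hMB (fun r hr => (hWr hr).2) hΨ hΨW e1.1 e2.1
    exact (hV.connected q'.1 (unc3 M q')).induction₂ (fun x y => unc3 B x = unc3 B y) hloc
      (fun x y z _ _ _ hxy hyz => hxy.trans hyz) (fun x y _ _ hxy => hxy.symm)
      ⟨hq, h1, h2⟩ ⟨hq', rfl, rfl⟩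
  classical
  -- The value of B at any point of the level; values outside the image of V are irrelevant.
  let R : ℝ → ℝ → ℝ := fun a m =>
    if h : ∃ q ∈ V, q.1 = a ∧ unc3 M q = m then unc3 B h.choose else 0
  have hR : ∀ q ∈ V, unc3 B q = R q.1 (unc3 M q) := by
    intro q hq
    have h : ∃ q' ∈ V, q'.1 = q.1 ∧ unc3 M q' = unc3 M q := ⟨q, hq, rfl, rfl⟩
    simp only [R, dif_pos h]
    exact hwell _ hq _ h.choose_spec.1 h.choose_spec.2.1.symm h.choose_spec.2.2.symm
  refine ⟨R, ?_, hR⟩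
  rintro _ ⟨q, hq, rfl⟩
  obtain ⟨W, Ψ, p₀, ε, l, hε, hW, hqW, hWr, hΨ, hΨW, hWΨ, hp₀⟩ :=
    exists_chart hM hV.isOpen hq (hV.regular hq)
  have hbo : IsOpen (box p₀ ε) := by rw [box_eq_ball]; exact Metric.isOpen_ball
  have hmem : (q.1, unc3 M q, l q) ∈ box p₀ ε := (hWΨ q hqW).1
  -- Freezing the third chart coordinate gives a smooth section of (s_1, M), along which B equals R.
  have hι : ContDiff ℝ ∞ fun p : ℝ × ℝ => ((p.1, p.2, l q) : ℝ × ℝ × ℝ) := by fun_prop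
  have hc : ContDiffAt ℝ ∞ (fun p : ℝ × ℝ => unc3 B (Ψ (p.1, p.2, l q))) (q.1, unc3 M q) := by
    have h1 : ContDiffAt ℝ ∞ (fun p : ℝ × ℝ => Ψ (p.1, p.2, l q)) (q.1, unc3 M q) :=
      ContDiffAt.comp (g := Ψ) (q.1, unc3 M q) (hΨ.contDiffAt (hbo.mem_nhds hmem)) hι.contDiffAt
    refine ContDiffAt.comp (g := unc3 B) (q.1, unc3 M q) ?_ h1
    exact ContDiffOn.contDiffAt hB (isOpen_pos_fst.mem_nhds (hWr (hΨW _ hmem).1).2.1)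
  refine ContDiffAt.contDiffWithinAt (hc.congr_of_eventuallyEq ?_)
  have hn : ∀ᶠ p : ℝ × ℝ in nhds (q.1, unc3 M q), (p.1, p.2, l q) ∈ box p₀ ε :=
    hι.continuous.continuousAt.eventually_mem (hbo.mem_nhds hmem)
  filter_upwards [hn] with p hp
  obtain ⟨h1, h2, h3⟩ := hΨW _ hp
  rw [hR _ (hWr h1).1, h2, h3]

/-- At a critical point of M(s_1, ·, ·) both terms vanish. At a regular point B = R(s_1, M) nearby,
and the chain rule makes the two gradients in (s_2, s_4) proportional. -/
theorem IsRTerm.commute {M B : ℝ → ℝ → ℝ → ℝ} (hM : Smooth3 M) (hB : IsRTerm M B)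
    {a : ℝ} (b c : ℝ) (ha : 0 < a) : d2 M a b c * d4 B a b c - d4 M a b c * d2 B a b c = 0 := by
  by_cases hr : (a, b, c) ∈ regularSet M
  · obtain ⟨V, hqV, hV⟩ := exists_isLevelDomain hM hr
    obtain ⟨R, -, hR⟩ := hB.2 V hV
    obtain ⟨W, Ψ, p₀, ε, l, hε, hW, hqW, hWr, hΨ, hΨW, hWΨ, hp₀⟩ := exists_chart hM hV.isOpen hqV hr
    have hbo : IsOpen (box p₀ ε) := by rw [box_eq_ball]; exact Metric.isOpen_ball
    have hmem : (a, M a b c, l (a, b, c)) ∈ box p₀ ε := (hWΨ _ hqW).1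
    let r : ℝ → ℝ := fun m => unc3 B (Ψ (a, m, l (a, b, c)))
    have hι : ContDiff ℝ ∞ fun m : ℝ => ((a, m, l (a, b, c)) : ℝ × ℝ × ℝ) := by fun_prop
    have hrd : HasDerivAt r (deriv r (M a b c)) (M a b c) := by
      have h1 : ContDiffAt ℝ ∞ (fun m : ℝ => Ψ (a, m, l (a, b, c))) (M a b c) :=
        ContDiffAt.comp (g := Ψ) _ (hΨ.contDiffAt (hbo.mem_nhds hmem)) hι.contDiffAt
      have h2 : ContDiffAt ℝ ∞ r (M a b c) := by
        refine ContDiffAt.comp (g := unc3 B) (M a b c) ?_ h1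
        exact ContDiffOn.contDiffAt hB.1 (isOpen_pos_fst.mem_nhds (hWr (hΨW _ hmem).1).2.1)
      exact (h2.differentiableAt (by simp)).hasDerivAt
    have hn : ∀ᶠ m in nhds (M a b c), (a, m, l (a, b, c)) ∈ box p₀ ε :=
      hι.continuous.continuousAt.eventually_mem (hbo.mem_nhds hmem)
    have hBr : ∀ b' c', (a, b', c') ∈ W → (a, M a b' c', l (a, b, c)) ∈ box p₀ ε →
        B a b' c' = r (M a b' c') := by
      intro b' c' hq hb
      obtain ⟨h1, h2, h3⟩ := hΨW _ hb
      have h2' : (Ψ (a, M a b' c', l (a, b, c))).1 = a := h2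
      calc B a b' c' = R a (M a b' c') := hR _ (hWr hq).1
        _ = R (Ψ (a, M a b' c', l (a, b, c))).1 (unc3 M (Ψ (a, M a b' c', l (a, b, c)))) := by
          rw [h2', h3]
        _ = r (M a b' c') := (hR _ (hWr h1).1).symm
    have k2 : d2 B a b c = deriv r (M a b c) * d2 M a b c := by
      have hd := hM.hasDerivAt_d2 (b := b) (c := c) ha
      refine (HasDerivAt.congr_of_eventuallyEq (HasDerivAt.comp b hrd hd) ?_).deriv
      have w1 : ∀ᶠ t in nhds b, (a, t, c) ∈ W :=
        (show Continuous fun t : ℝ => (a, t, c) by fun_prop).continuousAt.eventually_mem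
          (hW.mem_nhds hqW)
      filter_upwards [w1, hd.continuousAt.eventually hn] with t h1 h2 using hBr t c h1 h2
    have k4 : d4 B a b c = deriv r (M a b c) * d4 M a b c := by
      have hd := hM.hasDerivAt_d4 (b := b) (c := c) ha
      refine (HasDerivAt.congr_of_eventuallyEq (HasDerivAt.comp c hrd hd) ?_).deriv
      have w1 : ∀ᶠ t in nhds c, (a, b, t) ∈ W :=
        (show Continuous fun t : ℝ => (a, b, t) by fun_prop).continuousAt.eventually_mem
          (hW.mem_nhds hqW)
      filter_upwards [w1, hd.continuousAt.eventually hn] with t h1 h2 using hBr b t h1 h2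
    rw [k2, k4]
    ring
  · have h : d2 M a b c = 0 ∧ d4 M a b c = 0 := by
      by_contra hne
      exact hr ⟨ha, by tauto⟩
    rw [h.1, h.2]
    ring

end EffGrav

end

open scoped ContDiff

noncomputable section

namespace EffGrav

/-! ### Fields with prescribed jets -/

theorem exists_smooth_iteratedDeriv_eq (k : ℕ) (c : Fin (k + 1) → ℝ) :
    ∃ g : ℝ → ℝ, ContDiff ℝ ∞ g ∧ ∀ n : Fin (k + 1), iteratedDeriv n g 0 = c n := by
  refine ⟨fun x => ∑ m : Fin (k + 1), c m / (m : ℕ).factorial * x ^ (m : ℕ),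
    ContDiff.sum fun m _ => contDiff_const.mul (contDiff_id.pow _), fun n => ?_⟩
  rw [iteratedDeriv_fun_sum fun m _ => (contDiff_const.mul (contDiff_id.pow _)).contDiffAt,
    Finset.sum_eq_single n]
  · rw [iteratedDeriv_const_mul_field, iteratedDeriv_pow]
    simp only [Nat.descFactorial_self, Nat.sub_self, pow_zero, mul_one]
    field_simp
  · intro m _ hmn
    rw [iteratedDeriv_const_mul_field, iteratedDeriv_pow]
    have hne : (m : ℕ) ≠ n := fun h => hmn (Fin.ext h)
    rcases lt_or_gt_of_ne hne with h | h
    · simp [Nat.descFactorial_of_lt h]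
    · simp [Nat.sub_ne_zero_of_lt h]
  · simp

/-- Interpolating between g and the constant g 0 with a cutoff keeps the germ at 0. On the support
of the cutoff both ends of the convex combination have the sign of g 0. -/
theorem exists_eventuallyEq_same_sign {g : ℝ → ℝ} (hg : ContDiff ℝ ∞ g) (h0 : g 0 ≠ 0) :
    ∃ r : ℝ → ℝ, ContDiff ℝ ∞ r ∧ r =ᶠ[nhds 0] g ∧ ∀ x, 0 < r x * g 0 := by
  have hpos : ∀ᶠ x in nhds (0 : ℝ), 0 < g x * g 0 :=
    (hg.continuous.mul continuous_const).continuousAt.eventually_mem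
      (Ioi_mem_nhds (mul_self_pos.2 h0))
  obtain ⟨δ, hδ, hball⟩ := Metric.eventually_nhds_iff_ball.1 hpos
  let χ : ContDiffBump (0 : ℝ) := ⟨δ / 2, δ, by positivity, by linarith⟩
  refine ⟨fun x => g 0 + χ x * (g x - g 0),
    contDiff_const.add (χ.contDiff.mul (hg.sub contDiff_const)), ?_, fun x => ?_⟩
  · filter_upwards [χ.eventuallyEq_one] with x hx
    rw [hx]
    simp
  · change 0 < (g 0 + χ x * (g x - g 0)) * g 0
    have h1 : 0 ≤ χ x := χ.nonneg
    have h2 : χ x ≤ 1 := χ.le_one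
    have h3 : 0 < g 0 * g 0 := mul_self_pos.2 h0
    by_cases hx : x ∈ Metric.ball (0 : ℝ) δ
    · have h4 := hball x hx
      rcases h2.lt_or_eq with h5 | h5
      · nlinarith [mul_nonneg h1 h4.le, mul_pos (sub_pos.2 h5) h3]
      · rw [h5]
        linarith
    · have : χ x = 0 := χ.zero_of_le_dist (by simpa using hx)
      rw [this]
      linarith

/-- Taylor polynomials realise the jet; E^1 and E^2 are then modified away from 0 so that they stay
positive and nonzero respectively. Hence pointwise identities along fields are identities between
independent jet variables. -/
theorem exists_jet_eq {k : ℕ} {J : Jet k} (hJ : J ∈ admissible k) :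
    ∃ φ, IsPhasePoint φ ∧ jet k φ 0 = J := by
  choose g hg hgJ using fun i => exists_smooth_iteratedDeriv_eq k (J i)
  have hg0 : ∀ i, g i 0 = J i 0 := fun i => by simpa using hgJ i 0
  obtain ⟨r, hr, hre, hrp⟩ := exists_eventuallyEq_same_sign (hg .E1) (by rw [hg0]; exact hJ.1.ne')
  obtain ⟨s, hs, hse, hsp⟩ := exists_eventuallyEq_same_sign (hg .E2) (by rw [hg0]; exact hJ.2)
  refine ⟨fun | .K1 => g .K1 | .K2 => g .K2 | .E1 => r | .E2 => s, ⟨?_, ?_, ?_⟩, ?_⟩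
  · intro i
    cases i
    exacts [hg _, hg _, hr, hs]
  · intro x
    exact pos_of_mul_pos_left (hrp x) (by rw [hg0]; exact hJ.1.le)
  · intro x
    exact left_ne_zero_of_mul (hsp x).ne'
  · funext i n
    cases i
    · exact hgJ _ n
    · exact hgJ _ n
    · exact (hre.iteratedDeriv_eq n).trans (hgJ _ n)
    · exact (hse.iteratedDeriv_eq n).trans (hgJ _ n)

/-- Truncation of jets. -/
def trunc {k l : ℕ} (h : k ≤ l) (J : Jet l) : Jet k :=
  fun i n => J i (Fin.castLE (Nat.succ_le_succ h) n)

/-- A third order jet with prescribed scalars and prescribed derivatives of `s_2`, `s_3`, `s_5`. -/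
theorem exists_phasePoint {a : ℝ} (ha : 0 < a) (b z c w u v y : ℝ) :
    ∃ φ, IsPhasePoint φ ∧ φ .E2 0 = 1 ∧ deriv (φ .E2) 0 = 0 ∧ s1 (jet 2 φ 0) = a ∧
      s2 (jet 2 φ 0) = b ∧ s3 (jet 2 φ 0) = z ∧ s4 (jet 2 φ 0) = c ∧ s5 (jet 2 φ 0) = w ∧
      deriv (φ .K2) 0 = u ∧ deriv (fun t => s3 (jet 2 φ t)) 0 = v ∧
      deriv (fun t => s5 (jet 2 φ t)) 0 = y := by
  -- With E^2 = 1 and its first two derivatives zero, D is ∂_x to the order needed: the entries of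
  -- E^1 are s_1, s_4, s_5, D s_5, those of K_1 are s_3, D s_3, and those of K_2 are s_2, D s_2.
  let J : Jet 3 := fun
    | .K1 => ![z, v, 0, 0]
    | .K2 => ![b, u, 0, 0]
    | .E1 => ![a, c, w, y]
    | .E2 => ![1, 0, 0, 0]
  have hJ : J ∈ admissible 3 := ⟨ha, one_ne_zero⟩
  obtain ⟨φ, hφ, hφJ⟩ := exists_jet_eq hJ
  have h : ∀ (i) (n : Fin 4), iteratedDeriv n (φ i) 0 = J i n := fun i n => congrFun (congrFun hφJ i) n
  have hE0 : φ .E1 0 = a := by simpa [J] using h .E1 0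
  have hE1 : deriv (φ .E1) 0 = c := by simpa [J, iteratedDeriv_succ] using h .E1 1
  have hE2 : deriv (deriv (φ .E1)) 0 = w := by simpa [J, iteratedDeriv_succ] using h .E1 2
  have hE3 : deriv (deriv (deriv (φ .E1))) 0 = y := by simpa [J, iteratedDeriv_succ] using h .E1 3
  have hF0 : φ .E2 0 = 1 := by simpa [J] using h .E2 0
  have hF1 : deriv (φ .E2) 0 = 0 := by simpa [J, iteratedDeriv_succ] using h .E2 1
  have hF2 : deriv (deriv (φ .E2)) 0 = 0 := by simpa [J, iteratedDeriv_succ] using h .E2 2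
  have hK0 : φ .K1 0 = z := by simpa [J] using h .K1 0
  have hK1 : deriv (φ .K1) 0 = v := by simpa [J, iteratedDeriv_succ] using h .K1 1
  have hL0 : φ .K2 0 = b := by simpa [J] using h .K2 0
  have hL1 : deriv (φ .K2) 0 = u := by simpa [J, iteratedDeriv_succ] using h .K2 1
  have d3 : deriv (fun t => φ .K1 t / φ .E2 t) 0 = _ :=
    ((ContDiff.hasDerivAt_deriv (hφ.smooth .K1) 0).div
      (ContDiff.hasDerivAt_deriv (hφ.smooth .E2) 0) (hφ.E2_ne 0)).deriv
  have hE1' := ContDiff.smooth_deriv (hφ.smooth .E1)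
  have hE2' := ContDiff.smooth_deriv (hφ.smooth .E2)
  have hE1'' := ContDiff.smooth_deriv hE1'
  have d5 : deriv (fun y => (deriv (deriv (φ .E1)) y * φ .E2 y
      - deriv (φ .E1) y * deriv (φ .E2) y) / φ .E2 y ^ 3) 0 = _ :=
    ((((ContDiff.hasDerivAt_deriv hE1'' 0).mul
      (ContDiff.hasDerivAt_deriv (hφ.smooth .E2) 0)).sub
      ((ContDiff.hasDerivAt_deriv hE1' 0).mul (ContDiff.hasDerivAt_deriv hE2' 0))).div
      ((ContDiff.hasDerivAt_deriv (hφ.smooth .E2) 0).pow 3)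
      (pow_ne_zero 3 (hφ.E2_ne 0))).deriv
  refine ⟨φ, hφ, hF0, hF1, ?_, ?_, ?_, ?_, ?_, hL1, ?_, ?_⟩
  · rw [s1_jet, hE0]
  · rw [s2_jet, hL0]
  · rw [s3_jet, hK0, hF0, div_one]
  · rw [s4_jet, hE1, hF0, div_one]
  · rw [s5_jet', hE1, hE2, hF0, hF1]
    simp
  · simp only [s3_jet]
    rw [d3, hK0, hK1, hF0, hF1]
    simp
  · simp only [s5_jet']
    rw [d5]
    simp only [Pi.mul_apply, Pi.sub_apply, Pi.pow_apply, hE1, hE2, hE3, hF0, hF1, hF2]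
    simp

end EffGrav

end

open scoped ContDiff

noncomputable section

namespace EffGrav

/-! ### Consequences of closure and covariance -/

/-- The `u`-coefficient of `clos F`. -/
def closU (F : ℝ → ℝ → ℝ → ℝ → ℝ → ℝ) (a b z c w : ℝ) : ℝ :=
  2 * (p3 F a b z c w * p2 (p5 F) a b z c w - p5 F a b z c w * p2 (p3 F) a b z c w)

theorem Smooth5.mul {F H : ℝ → ℝ → ℝ → ℝ → ℝ → ℝ} (hF : Smooth5 F) (hH : Smooth5 H) :
    Smooth5 fun a b z c w => F a b z c w * H a b z c w := ContDiffOn.mul hF hH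
theorem Smooth5.sub {F H : ℝ → ℝ → ℝ → ℝ → ℝ → ℝ} (hF : Smooth5 F) (hH : Smooth5 H) :
    Smooth5 fun a b z c w => F a b z c w - H a b z c w := ContDiffOn.sub hF hH
theorem Smooth5.const_mul (r : ℝ) {F : ℝ → ℝ → ℝ → ℝ → ℝ → ℝ} (hF : Smooth5 F) :
    Smooth5 fun a b z c w => r * F a b z c w := ContDiffOn.mul contDiffOn_const hF

theorem smooth5_closU {F : ℝ → ℝ → ℝ → ℝ → ℝ → ℝ} (hF : Smooth5 F) : Smooth5 (closU F) :=
  ((hF.p3.mul hF.p5.p2).sub (hF.p5.mul hF.p3.p2)).const_mul 2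

/-! ### The modification factor as a function of the scalars; pointwise covariance -/

section closure

variable {F : ℝ → ℝ → ℝ → ℝ → ℝ → ℝ} {G : ℝ} {k : ℕ} {μ : Jet k → ℝ}

/-- The coefficient is affine in u; it is expanded about u = z c / 2, the zero of H_x. -/
theorem clos_eq_add (F : ℝ → ℝ → ℝ → ℝ → ℝ → ℝ) (a b z c w u v y : ℝ) :
    clos F a b z c w u v y = clos F a b z c w (z * c / 2) v y
      + (u - z * c / 2) * closU F a b z c w := by
  simp only [clos, closU]
  ring

theorem ClosedAlgebra.pointwise (h : ClosedAlgebra G (heff F) μ) (hG : 0 < G) (hF : Smooth5 F)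
    (hμ : ContDiffOn ℝ ∞ μ (admissible k)) {φ : Fields} (hφ : IsPhasePoint φ) (x : ℝ) :
    2 * G ^ 2 * closAlong F φ x = μ (jet k φ x) * (s1 (jet 2 φ x) *
      (2 * (deriv (φ .K2) x / φ .E2 x) - s3 (jet 2 φ x) * s4 (jet 2 φ x))) :=
  (ham_ham_iff hφ hF hG hμ).1 (h.ham_ham φ hφ) x

/-- On H_x = 0 the right side of the closure relation vanishes whatever μ is; the jets with u = z c
/ 2 and arbitrary remaining values are realised by fields. -/
theorem ClosedAlgebra.clos_half (h : ClosedAlgebra G (heff F) μ) (hG : 0 < G) (hF : Smooth5 F)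
    (hμ : ContDiffOn ℝ ∞ μ (admissible k)) {a : ℝ} (ha : 0 < a) (b z c w v y : ℝ) :
    clos F a b z c w (z * c / 2) v y = 0 := by
  obtain ⟨φ, hφ, e0, -, e1, e2, e3, e4, e5, eu, ev, ey⟩ :=
    exists_phasePoint ha b z c w (z * c / 2) v y
  have := h.pointwise hG hF hμ hφ 0
  rw [closAlong, e0, e1, e2, e3, e4, e5, eu, ev, ey, div_one, div_one, div_one,
    show 2 * (z * c / 2) - z * c = 0 by ring, mul_zero, mul_zero] at this
  exact (mul_eq_zero.1 this).resolve_left (by positivity)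

/-- The modification factor as a function of the basic scalars. -/
def muOf (G : ℝ) (F : ℝ → ℝ → ℝ → ℝ → ℝ → ℝ) (a b z c w : ℝ) : ℝ := G ^ 2 * closU F a b z c w / a

theorem smooth5_muOf (G : ℝ) (hF : Smooth5 F) : Smooth5 (muOf G F) :=
  ContDiffOn.div ((smooth5_closU hF).const_mul (G ^ 2)) contDiffOn_fst fun _ hq => ne_of_gt hq

/-- Off H_x = 0 the factor u − s_3 s_4 / 2 cancels from both sides of the closure relation, which
leaves the u-coefficient. -/
theorem ClosedAlgebra.mu_eq_of_ne (h : ClosedAlgebra G (heff F) μ) (hG : 0 < G) (hF : Smooth5 F)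
    (hμ : ContDiffOn ℝ ∞ μ (admissible k)) {φ : Fields} (hφ : IsPhasePoint φ) {x : ℝ}
    (hne : deriv (φ .K2) x / φ .E2 x - s3 (jet 2 φ x) * s4 (jet 2 φ x) / 2 ≠ 0) :
    μ (jet k φ x) = along (muOf G F) φ x := by
  have ha : 0 < s1 (jet 2 φ x) := (hφ.jet_mem 2 x).1
  have h1 := h.pointwise hG hF hμ hφ x
  rw [closAlong, clos_eq_add, h.clos_half hG hF hμ ha] at h1
  rw [along, muOf, eq_div_iff ha.ne']
  apply mul_left_cancel₀ hne
  linear_combination (-1 / 2) * h1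

theorem jet_add_smul {k : ℕ} {φ ψ : Fields} (hφ : ∀ i, ContDiff ℝ ∞ (φ i))
    (hψ : ∀ i, ContDiff ℝ ∞ (ψ i)) (t x : ℝ) :
    jet k (fun i y => φ i y + t * ψ i y) x = jet k φ x + t • jet k ψ x := by
  funext i n
  have h1 : ContDiffAt ℝ (n : ℕ) (φ i) x := ((hφ i).of_le (by exact_mod_cast le_top)).contDiffAt
  have h2 : ContDiffAt ℝ (n : ℕ) (ψ i) x := ((hψ i).of_le (by exact_mod_cast le_top)).contDiffAt
  simp only [jet, Pi.add_apply, Pi.smul_apply, smul_eq_mul]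
  rw [iteratedDeriv_fun_add h1 (contDiffAt_const.mul h2), iteratedDeriv_const_mul_field]

/-- The remaining points with H_x = 0 are limits of points with H_x ≠ 0 and the same scalars, and μ
is continuous. -/
theorem ClosedAlgebra.mu_eq (h : ClosedAlgebra G (heff F) μ) (hG : 0 < G) (hF : Smooth5 F)
    (hμ : ContDiffOn ℝ ∞ μ (admissible k)) {φ : Fields} (hφ : IsPhasePoint φ) (x : ℝ) :
    μ (jet k φ x) = along (muOf G F) φ x := by
  -- Adding t (y − x) to K_2 changes ∂_x K_2 at x and no other jet entry there, so the scalars s_1,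
  -- …, s_5 are unaffected.
  let ψ : Fields := fun
    | .K1 => fun _ => 0
    | .K2 => fun y => y - x
    | .E1 => fun _ => 0
    | .E2 => fun _ => 0
  have hψ : ∀ i, ContDiff ℝ ∞ (ψ i) := by
    intro i
    cases i
    exacts [contDiff_const, contDiff_id.sub contDiff_const, contDiff_const, contDiff_const]
  let Φ : ℝ → Fields := fun t i y => φ i y + t * ψ i y
  have hE1 : ∀ t, Φ t .E1 = φ .E1 := fun t => by simp [Φ, ψ]
  have hE2 : ∀ t, Φ t .E2 = φ .E2 := fun t => by simp [Φ, ψ]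
  have hK1 : ∀ t, Φ t .K1 = φ .K1 := fun t => by simp [Φ, ψ]
  have hK2 : ∀ t, Φ t .K2 x = φ .K2 x := fun t => by simp [Φ, ψ]
  have hK2' : ∀ t, deriv (Φ t .K2) x = deriv (φ .K2) x + t := fun t => by
    have := ((ContDiff.hasDerivAt_deriv (hφ.smooth .K2) x).add
      (((hasDerivAt_id x).sub_const x).const_mul t)).deriv
    rw [mul_one] at this
    exact this
  have hΦ : ∀ t, IsPhasePoint (Φ t) := fun t =>
    ⟨fun i => (hφ.smooth i).add (contDiff_const.mul (hψ i)), fun y => by rw [hE1]; exact hφ.E1_pos y,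
      fun y => by rw [hE2]; exact hφ.E2_ne y⟩
  have hs1 : ∀ t, s1 (jet 2 (Φ t) x) = s1 (jet 2 φ x) := fun t => by simp only [s1_jet, hE1]
  have hs2 : ∀ t, s2 (jet 2 (Φ t) x) = s2 (jet 2 φ x) := fun t => by simp only [s2_jet, hK2]
  have hs3 : ∀ t, s3 (jet 2 (Φ t) x) = s3 (jet 2 φ x) := fun t => by simp only [s3_jet, hK1, hE2]
  have hs4 : ∀ t, s4 (jet 2 (Φ t) x) = s4 (jet 2 φ x) := fun t => by simp only [s4_jet, hE1, hE2]
  have hs5 : ∀ t, s5 (jet 2 (Φ t) x) = s5 (jet 2 φ x) := fun t => by simp only [s5_jet', hE1, hE2]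
  have hev : ∀ᶠ t in nhdsWithin (0 : ℝ) {0}ᶜ, μ (jet k (Φ t) x) = along (muOf G F) φ x := by
    -- For small t ≠ 0 the perturbed fields have H_x ≠ 0 at x: if the quantity vanishes at t = 0 it
    -- equals t / E^2, otherwise continuity suffices.
    have hn : ∀ᶠ t in nhdsWithin (0 : ℝ) {0}ᶜ, deriv (φ .K2) x / φ .E2 x + t / φ .E2 x
        - s3 (jet 2 φ x) * s4 (jet 2 φ x) / 2 ≠ 0 := by
      by_cases h0 : deriv (φ .K2) x / φ .E2 x - s3 (jet 2 φ x) * s4 (jet 2 φ x) / 2 = 0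
      · filter_upwards [self_mem_nhdsWithin] with t ht
        have e : deriv (φ .K2) x / φ .E2 x + t / φ .E2 x
          - s3 (jet 2 φ x) * s4 (jet 2 φ x) / 2 = t / φ .E2 x := by linear_combination h0
        rw [e]
        exact div_ne_zero ht (hφ.E2_ne x)
      · have hc : Continuous fun t : ℝ => deriv (φ .K2) x / φ .E2 x + t / φ .E2 x
          - s3 (jet 2 φ x) * s4 (jet 2 φ x) / 2 := by fun_prop
        exact (hc.continuousAt.eventually_ne (by simpa using h0)).filter_mono nhdsWithin_le_nhds
    filter_upwards [hn] with t ht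
    rw [h.mu_eq_of_ne hG hF hμ (hΦ t) (by
      rw [hK2', hE2, hs3, hs4, add_div]
      exact ht)]
    simp only [along, hs1, hs2, hs3, hs4, hs5]
  have hc : ContinuousAt (fun t : ℝ => μ (jet k (Φ t) x)) 0 := by
    have e : ∀ t : ℝ, jet k (Φ t) x = jet k φ x + t • jet k ψ x := fun t =>
      jet_add_smul hφ.smooth hψ t x
    have hj : ContinuousAt (fun t : ℝ => jet k (Φ t) x) 0 := by
      simp only [e]
      fun_prop
    have h0 : jet k (Φ 0) x ∈ admissible k := (hΦ 0).jet_mem k x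
    exact ContinuousAt.comp (g := μ) (hμ.continuousOn.continuousAt
      ((isOpen_admissible k).mem_nhds h0)) hj
  have hlim := tendsto_nhds_unique (hc.tendsto.mono_left nhdsWithin_le_nhds)
    (tendsto_const_nhds.congr' (hev.mono fun t ht => ht.symm))
  have e0 : Φ 0 = φ := by
    funext i y
    simp [Φ]
  rw [e0] at hlim
  exact hlim

/-- The formula for μ holds on all admissible jets, hence on an open set where it can be
differentiated. The order l is high enough to contain the arguments of both sides. -/
theorem ClosedAlgebra.mu_trunc (h : ClosedAlgebra G (heff F) μ) (hG : 0 < G) (hF : Smooth5 F)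
    (hμ : ContDiffOn ℝ ∞ μ (admissible k)) {l : ℕ} (hkl : k ≤ l) (hl : 2 ≤ l) {J : Jet l}
    (hJ : J ∈ admissible l) :
    μ (trunc hkl J) = muOf G F (s1 (trunc hl J)) (s2 (trunc hl J)) (s3 (trunc hl J))
      (s4 (trunc hl J)) (s5 (trunc hl J)) := by
  obtain ⟨φ, hφ, rfl⟩ := exists_jet_eq hJ
  exact h.mu_eq hG hF hμ hφ 0

/-- Although μ is declared on jets of order k, its derivative is that of `muOf G F` composed with
the scalars, so second-order variations are enough. -/
theorem bracketAt_mul_structS (h : ClosedAlgebra G (heff F) μ) (hG : 0 < G) (hF : Smooth5 F)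
    (hμ : ContDiffOn ℝ ∞ μ (admissible k)) {φ : Fields} (hφ : IsPhasePoint φ) (N : ℝ → ℝ) (x : ℝ)
    {v : Jet 2} (hv : v = jet 2 (hamVec G (heff F) N φ) x) :
    bracketAt G (fun j => μ j * structS j) (heff F) N φ x
      = (along (p1 (muOf G F)) φ x * v .E1 0 + along (p2 (muOf G F)) φ x * v .K2 0
        + along (p3 (muOf G F)) φ x * ds3 (jet 2 φ x) v
        + along (p4 (muOf G F)) φ x * ds4 (jet 2 φ x) v
        + along (p5 (muOf G F)) φ x * ds5 (jet 2 φ x) v) * structS (jet 2 φ x)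
        + along (muOf G F) φ x *
          (v .E1 0 / φ .E2 x ^ 2 - 2 * φ .E1 x * v .E2 0 / φ .E2 x ^ 3) := by
  rw [bracketAt_eq]
  apply fderiv_apply_eq_of_hasDerivAt
  · exact ((hμ.mul (contDiffOn_structS k)).differentiableOn (by simp)).differentiableAt
      ((isOpen_admissible k).mem_nhds (hφ.jet_mem k x))
  -- Jets of order k + 2 truncate both to order k, where μ lives, and to order 2, where the scalars
  -- live.
  have hk : k ≤ k + 2 := by omega
  have h2 : 2 ≤ k + 2 := by omega
  have hd := ((smooth5_muOf G hF).hasDerivAt_line v (hφ.jet_mem 2 x)).mul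
    (hasDerivAt_structS_line (hφ.jet_mem 2 x) v)
  simp only [zero_smul, add_zero, jet_zero] at hd
  refine HasDerivAt.congr_of_eventuallyEq hd ?_
  let J : ℝ → Jet (k + 2) := fun t =>
    jet (k + 2) φ x + t • jet (k + 2) (hamVec G (heff F) N φ) x
  have hJ : ∀ᶠ t in nhds (0 : ℝ), J t ∈ admissible (k + 2) := by
    have hc : Continuous J := by fun_prop
    refine hc.continuousAt.eventually_mem ((isOpen_admissible _).mem_nhds ?_)
    have e : J 0 = jet (k + 2) φ x := by simp [J]
    rw [e]
    exact hφ.jet_mem _ x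
  filter_upwards [hJ] with t ht
  have h3 := h.mu_trunc hG hF hμ hk h2 ht
  have e1 : trunc hk (J t) = jet k φ x + t • jet k (hamVec G (heff F) N φ) x := rfl
  have e2 : trunc h2 (J t) = jet 2 φ x + t • v := by rw [hv]; rfl
  rw [e1, e2] at h3
  have e3 : structS (jet k φ x + t • jet k (hamVec G (heff F) N φ) x)
      = structS (jet 2 φ x + t • v) := by rw [hv]; rfl
  simp only [Pi.mul_apply]
  rw [h3, e3]

/-- The brackets of `μ S` with `H_eff[N]`, evaluated where `N` vanishes. -/
theorem cov_at_zero (h : ClosedAlgebra G (heff F) μ) (hG : 0 < G) (hF : Smooth5 F)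
    (hμ : ContDiffOn ℝ ∞ μ (admissible k)) (hc : CovarianceConditions G (heff F) μ)
    {φ : Fields} (hφ : IsPhasePoint φ) (e0 : φ .E2 0 = 1) (e1 : deriv (φ .E2) 0 = 0)
    {N : ℝ → ℝ} (hN : ContDiff ℝ ∞ N) (hN0 : N 0 = 0) :
    deriv N 0 * (s4 (jet 2 φ 0) * along (p5 F) φ 0 * along (p2 (muOf G F)) φ 0
        - 2 * along (p4 F) φ 0 * along (p3 (muOf G F)) φ 0
        - 2 * along (p3 F) φ 0 * along (p4 (muOf G F)) φ 0
        + s4 (jet 2 φ 0) * along (p2 F) φ 0 * along (p5 (muOf G F)) φ 0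
        + 4 * (along (p3 (muOf G F)) φ 0 * deriv (along (p5 F) φ) 0
          - along (p5 (muOf G F)) φ 0 * deriv (along (p3 F) φ) 0))
      + 2 * deriv (deriv N) 0 * (along (p3 (muOf G F)) φ 0 * along (p5 F) φ 0
        - along (p5 (muOf G F)) φ 0 * along (p3 F) φ 0) = 0 := by
  -- The roles are α = N and constant smearing 1: at a zero of N the left side vanishes, hence so
  -- does the bracket with H_eff[N].
  have hb := hc.bracket_eq φ hφ N (fun _ => 1) hN contDiff_const 0
  simp only [mul_one] at hb
  rw [hN0, zero_mul, bracketAt_mul_structS h hG hF hμ hφ N 0 rfl] at hb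
  have a3 := hφ.contDiff_along hF.p3
  have a2 := hφ.contDiff_along hF.p2
  have hE2a : ContDiff ℝ ∞ fun y => φ .E2 y * along (p2 F) φ y := (hφ.smooth _).mul a2
  have vE10 : jet 2 (hamVec G (heff F) N φ) 0 .E1 0 = 0 := by
    rw [jet_zero, hamVec_E1 hφ hF]; simp [hN0]
  have vE11 : jet 2 (hamVec G (heff F) N φ) 0 .E1 1 = -(2 * G) * (deriv N 0 * along (p3 F) φ 0) := by
    rw [jet_one, hamVec_E1 hφ hF, deriv_const_mul_field, deriv_mul_smooth hN a3, hN0]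
    ring
  have vE12 : jet 2 (hamVec G (heff F) N φ) 0 .E1 2
      = -(2 * G) * (deriv (deriv N) 0 * along (p3 F) φ 0
        + 2 * deriv N 0 * deriv (along (p3 F) φ) 0) := by
    have e : deriv (fun y => -(2 * G) * (N y * along (p3 F) φ y))
        = fun y => -(2 * G) * deriv (fun y => N y * along (p3 F) φ y) y :=
      funext fun y => deriv_const_mul_field _
    rw [jet_two, hamVec_E1 hφ hF, e, deriv_const_mul_field, deriv_deriv_mul_smooth hN a3, hN0]
    ring
  have vE20 : jet 2 (hamVec G (heff F) N φ) 0 .E2 0 = 0 := by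
    rw [jet_zero, hamVec_E2 hφ hF]; simp [hN0]
  have vE21 : jet 2 (hamVec G (heff F) N φ) 0 .E2 1 = -G * (deriv N 0 * along (p2 F) φ 0) := by
    rw [jet_one, hamVec_E2 hφ hF, deriv_const_mul_field, deriv_mul_smooth hN hE2a, hN0, e0]
    ring
  have vK2 : jet 2 (hamVec G (heff F) N φ) 0 .K2 0
      = G * (deriv N 0 * along (p5 F) φ 0 * s4 (jet 2 φ 0)) := by
    rw [jet_hamVec_K2 hφ hF G hN, hN0, e0]
    ring
  have vK1 : jet 2 (hamVec G (heff F) N φ) 0 .K1 0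
      = 2 * G * (-(deriv N 0 * along (p4 F) φ 0) + deriv (deriv N) 0 * along (p5 F) φ 0
        + 2 * deriv N 0 * deriv (along (p5 F) φ) 0) := by
    rw [jet_zero]
    simp only [hamVec, varDeriv_heff_E1 hφ hF hN, hN0, e0, e1]
    ring
  have hs4 : s4 (jet 2 φ 0) = deriv (φ .E1) 0 := by rw [s4_jet, e0, div_one]
  have hS : structS (jet 2 φ 0) = φ .E1 0 := by simp only [structS, jet_zero, e0]; ring
  rw [hS] at hb
  simp only [ds3, ds4, ds5, vE10, vE11, vE12, vE20, vE21, vK2, vK1, jet_zero, jet_one, jet_two,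
    e0, e1, hs4] at hb
  rw [hs4]
  have hpos := hφ.E1_pos 0
  apply mul_left_cancel₀ (mul_ne_zero hG.ne' hpos.ne')
  linear_combination -hb

/-- The value of N'' at a zero of N gives the first relation. The coefficient of N' is affine in the
free variable u, and its linear part gives the second. The third is what remains once ∂_3 μ and ∂_5
μ vanish. -/
theorem cov_conditions (h : ClosedAlgebra G (heff F) μ) (hG : 0 < G) (hF : Smooth5 F)
    (hμ : ContDiffOn ℝ ∞ μ (admissible k)) (hc : CovarianceConditions G (heff F) μ)
    {a : ℝ} (ha : 0 < a) (b z c w : ℝ) :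
    p3 (muOf G F) a b z c w * p5 F a b z c w = p5 (muOf G F) a b z c w * p3 F a b z c w ∧
    p3 (muOf G F) a b z c w * p2 (p5 F) a b z c w = p5 (muOf G F) a b z c w * p2 (p3 F) a b z c w ∧
    (p3 (muOf G F) a b z c w = 0 → p5 (muOf G F) a b z c w = 0 →
      c * p5 F a b z c w * p2 (muOf G F) a b z c w
        - 2 * p3 F a b z c w * p4 (muOf G F) a b z c w = 0) := by
  have key : ∀ u n m : ℝ, n * (c * p5 F a b z c w * p2 (muOf G F) a b z c w
      - 2 * p4 F a b z c w * p3 (muOf G F) a b z c w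
      - 2 * p3 F a b z c w * p4 (muOf G F) a b z c w
      + c * p2 F a b z c w * p5 (muOf G F) a b z c w
      + 4 * (p3 (muOf G F) a b z c w * (p1 (p5 F) a b z c w * c + p2 (p5 F) a b z c w * u
          + p4 (p5 F) a b z c w * w)
        - p5 (muOf G F) a b z c w * (p1 (p3 F) a b z c w * c + p2 (p3 F) a b z c w * u
          + p4 (p3 F) a b z c w * w)))
      + 4 * m * (p3 (muOf G F) a b z c w * p5 F a b z c w
        - p5 (muOf G F) a b z c w * p3 F a b z c w) = 0 := by
    intro u n m
    obtain ⟨φ, hφ, e0, e0', e1, e2, e3, e4, e5, eu, ev, ey⟩ := exists_phasePoint ha b z c w u 0 0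
    have hE1 : deriv (φ .E1) 0 = c := by rw [← e4, s4_jet, e0, div_one]
    -- N vanishes at 0 with N' = n and N'' = 2m there.
    let N : ℝ → ℝ := fun x => x * (n + m * x)
    have hN : ContDiff ℝ ∞ N := contDiff_id.mul (contDiff_const.add (contDiff_const.mul contDiff_id))
    have hN1 : deriv N = fun x => n + 2 * m * x := by
      funext x
      have := ((hasDerivAt_id x).mul (((hasDerivAt_id x).const_mul m).const_add n)).deriv
      refine Eq.trans this ?_
      simp only [id]
      ring
    have hN2 : deriv (deriv N) 0 = 2 * m := by
      rw [hN1]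
      have := (((hasDerivAt_id (0 : ℝ)).const_mul (2 * m)).const_add n).deriv
      refine Eq.trans this ?_
      ring
    have hk := cov_at_zero h hG hF hμ hc hφ e0 e0' hN (by simp [N])
    rw [hN2, hN1, hφ.deriv_along hF.p3, hφ.deriv_along hF.p5, hE1, eu, ev, ey, e0] at hk
    simp only [along, e1, e2, e3, e4, e5] at hk
    linear_combination hk
  -- The three choices isolate the N'' term, the N' term at u = 0, and its change at u = 1.
  have k1 := key 0 0 1
  have k2 := key 0 1 0
  have k3 := key 1 1 0
  refine ⟨by linear_combination k1 / 4, by linear_combination (k3 - k2) / 4, fun h3 h5 => ?_⟩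
  rw [h3, h5] at k2
  linear_combination k2

/-- Nondegeneracy of `μ` means that `closU F` is nonzero on a dense set. -/
theorem exists_closU_ne_zero (h : ClosedAlgebra G (heff F) μ) (hG : 0 < G) (hF : Smooth5 F)
    (hμ : ContDiffOn ℝ ∞ μ (admissible k))
    (hd : admissible k ⊆ closure {j ∈ admissible k | μ j ≠ 0})
    {q : ℝ × ℝ × ℝ × ℝ × ℝ} (hq : 0 < q.1) {U : Set (ℝ × ℝ × ℝ × ℝ × ℝ)} (hU : U ∈ nhds q) :
    ∃ q' ∈ U, 0 < q'.1 ∧ unc5 (closU F) q' ≠ 0 := by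
  obtain ⟨φ, hφ, -, -, e1, e2, e3, e4, e5, -⟩ :=
    exists_phasePoint hq q.2.1 q.2.2.1 q.2.2.2.1 q.2.2.2.2 0 0 0
  have hk : k ≤ k + 2 := by omega
  have h2 : 2 ≤ k + 2 := by omega
  let J := jet (k + 2) φ 0
  -- A k-jet is extended by the higher entries of the reference jet J. This is continuous, so k-jets
  -- near the reference with μ ≠ 0 yield scalar values near q.
  let e : Jet k → Jet (k + 2) := fun j i n =>
    if hn : (n : ℕ) < k + 1 then j i ⟨n, hn⟩ else J i n
  have hec : Continuous e := by
    refine continuous_pi fun i => continuous_pi fun n => ?_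
    by_cases hn : (n : ℕ) < k + 1
    · simp only [e, dif_pos hn]
      fun_prop
    · simp only [e, dif_neg hn]
      fun_prop
  have het : ∀ j, trunc hk (e j) = j := by
    intro j
    funext i n
    exact dif_pos n.isLt
  have hej : e (jet k φ 0) = J := by
    funext i n
    by_cases hn : (n : ℕ) < k + 1
    · simp only [e, dif_pos hn]
      rfl
    · simp only [e, dif_neg hn]
  have headm : ∀ j ∈ admissible k, e j ∈ admissible (k + 2) := fun j hj => by
    have h0 : ∀ i, e j i 0 = j i 0 := fun i => by simp [e]
    exact ⟨by rw [h0]; exact hj.1, by rw [h0]; exact hj.2⟩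
  have htc : Continuous fun j => trunc h2 (e j) :=
    continuous_pi fun i => continuous_pi fun _ => continuous_pi_iff.1 (continuous_pi_iff.1 hec i) _
  have hsc : ContinuousAt (fun j => scal (trunc h2 (e j))) (jet k φ 0) := by
    refine ContinuousAt.comp (g := scal) ?_ htc.continuousAt
    rw [hej]
    exact contDiffOn_scal.continuousOn.continuousAt ((isOpen_admissible 2).mem_nhds (hφ.jet_mem 2 0))
  have hsq : scal (trunc h2 (e (jet k φ 0))) = q := by
    rw [hej]
    change scal (jet 2 φ 0) = q
    simp only [scal, e1, e2, e3, e4, e5]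
  have hnb : (fun j => scal (trunc h2 (e j))) ⁻¹' U ∈ nhds (jet k φ 0) :=
    hsc.preimage_mem_nhds (by rw [hsq]; exact hU)
  obtain ⟨j, hjU, hj, hjμ⟩ := mem_closure_iff_nhds.1 (hd (hφ.jet_mem k 0)) _ hnb
  refine ⟨_, hjU, (headm j hj).1, fun hz => hjμ ?_⟩
  have hm := h.mu_trunc hG hF hμ hk h2 (headm j hj)
  rw [het] at hm
  have hz' : closU F (s1 (trunc h2 (e j))) (s2 (trunc h2 (e j))) (s3 (trunc h2 (e j)))
    (s4 (trunc h2 (e j))) (s5 (trunc h2 (e j))) = 0 := hz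
  rw [hm, muOf, hz', mul_zero, zero_div]

/-- A continuous function that vanishes on a dense set vanishes; every conclusion drawn by dividing
by the determinant passes through this. -/
theorem eq_zero_of_closU (h : ClosedAlgebra G (heff F) μ) (hG : 0 < G) (hF : Smooth5 F)
    (hμ : ContDiffOn ℝ ∞ μ (admissible k))
    (hd : admissible k ⊆ closure {j ∈ admissible k | μ j ≠ 0})
    {H : ℝ → ℝ → ℝ → ℝ → ℝ → ℝ} (hH : Smooth5 H)
    (h0 : ∀ a b z c w, 0 < a → closU F a b z c w ≠ 0 → H a b z c w = 0)
    {a : ℝ} (ha : 0 < a) (b z c w : ℝ) : H a b z c w = 0 := by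
  by_contra hne
  have hc : ContinuousAt (unc5 H) (a, b, z, c, w) :=
    (ContDiffOn.continuousOn hH).continuousAt (isOpen_pos_fst.mem_nhds ha)
  obtain ⟨q, hqU, hq, hqB⟩ := exists_closU_ne_zero h hG hF hμ hd (q := (a, b, z, c, w)) ha
    (hc.eventually_ne hne)
  exact hqU (h0 _ _ _ _ _ hq hqB)

end closure

end EffGrav

end

open scoped ContDiff

noncomputable section

namespace EffGrav

/-! ### Linearity of the constraint in `s_3` and `s_5` -/

section five

variable {F : ℝ → ℝ → ℝ → ℝ → ℝ → ℝ} {a b z c w : ℝ}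

theorem Smooth5.hasDerivAt_p2 (hF : Smooth5 F) (ha : 0 < a) :
    HasDerivAt (fun t => F a t z c w) (EffGrav.p2 F a b z c w) b := by
  simpa using hF.hasDerivAt_comp (hasDerivAt_const b a) (hasDerivAt_id b) (hasDerivAt_const b z)
    (hasDerivAt_const b c) (hasDerivAt_const b w) ha
theorem Smooth5.hasDerivAt_p3 (hF : Smooth5 F) (ha : 0 < a) :
    HasDerivAt (fun t => F a b t c w) (EffGrav.p3 F a b z c w) z := by
  simpa using hF.hasDerivAt_comp (hasDerivAt_const z a) (hasDerivAt_const z b) (hasDerivAt_id z)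
    (hasDerivAt_const z c) (hasDerivAt_const z w) ha
theorem Smooth5.hasDerivAt_p5 (hF : Smooth5 F) (ha : 0 < a) :
    HasDerivAt (fun t => F a b z c t) (EffGrav.p5 F a b z c w) w := by
  simpa using hF.hasDerivAt_comp (hasDerivAt_const w a) (hasDerivAt_const w b)
    (hasDerivAt_const w z) (hasDerivAt_const w c) (hasDerivAt_id w) ha

/-- The vector (x, y) is parallel to (f, g) by `h`. Subtracting the differentiated relation `h'`
from `hd` shows that it is also parallel to (f', g'). The two directions are independent by `hne`,
so it is zero. It is used with (f, g) = (F_3, F_5), primes for ∂_2, and (x, y) the s_3- or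
s_5-derivative. -/
theorem eq_zero_of_minors {f g f' g' x y x' y' : ℝ} (h : f * y = g * x)
    (h' : f' * y + f * y' = g' * x + g * x') (hd : x * g' + f * y' - (y * f' + g * x') = 0)
    (hne : 2 * (f * g' - g * f') ≠ 0) : x = 0 ∧ y = 0 := by
  have e : x * g' = y * f' := by linear_combination (1 / 2) * (hd - h')
  exact ⟨mul_left_cancel₀ hne (by linear_combination 2 * f * e + 2 * f' * h),
    mul_left_cancel₀ hne (by linear_combination 2 * g' * h + 2 * g * e)⟩

theorem p3_closU (hF : Smooth5 F) (ha : 0 < a) :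
    p3 (closU F) a b z c w = 2 * (p3 (p3 F) a b z c w * p2 (p5 F) a b z c w
      + p3 F a b z c w * p2 (p3 (p5 F)) a b z c w - (p3 (p5 F) a b z c w * p2 (p3 F) a b z c w
      + p5 F a b z c w * p2 (p3 (p3 F)) a b z c w)) := by
  rw [← hF.p5.p3_p2 ha, ← hF.p3.p3_p2 ha]
  exact (((hF.p3.hasDerivAt_p3 ha).mul (hF.p5.p2.hasDerivAt_p3 ha)).sub
    ((hF.p5.hasDerivAt_p3 ha).mul (hF.p3.p2.hasDerivAt_p3 ha))).const_mul 2 |>.deriv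

theorem p5_closU (hF : Smooth5 F) (ha : 0 < a) :
    p5 (closU F) a b z c w = 2 * (p5 (p3 F) a b z c w * p2 (p5 F) a b z c w
      + p3 F a b z c w * p2 (p5 (p5 F)) a b z c w - (p5 (p5 F) a b z c w * p2 (p3 F) a b z c w
      + p5 F a b z c w * p2 (p5 (p3 F)) a b z c w)) := by
  rw [← hF.p5.p5_p2 ha, ← hF.p3.p5_p2 ha]
  exact (((hF.p3.hasDerivAt_p5 ha).mul (hF.p5.p2.hasDerivAt_p5 ha)).sub
    ((hF.p5.hasDerivAt_p5 ha).mul (hF.p3.p2.hasDerivAt_p5 ha))).const_mul 2 |>.deriv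

theorem p3_muOf (G : ℝ) (F : ℝ → ℝ → ℝ → ℝ → ℝ → ℝ) (a b z c w : ℝ) :
    p3 (muOf G F) a b z c w = G ^ 2 * p3 (closU F) a b z c w / a := by
  simp only [p3, muOf, deriv_div_const, deriv_const_mul_field]
theorem p5_muOf (G : ℝ) (F : ℝ → ℝ → ℝ → ℝ → ℝ → ℝ) (a b z c w : ℝ) :
    p5 (muOf G F) a b z c w = G ^ 2 * p5 (closU F) a b z c w / a := by
  simp only [p5, muOf, deriv_div_const, deriv_const_mul_field]

/-- A function with vanishing second derivatives in `s_3`, `s_5` is affine in `s_3`, `s_5`. -/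
theorem Smooth5.eq_lin (hF : Smooth5 F)
    (h33 : ∀ b z c w, EffGrav.p3 (EffGrav.p3 F) a b z c w = 0)
    (h53 : ∀ b z c w, EffGrav.p5 (EffGrav.p3 F) a b z c w = 0)
    (h55 : ∀ b z c w, EffGrav.p5 (EffGrav.p5 F) a b z c w = 0) (ha : 0 < a) :
    F a b z c w = lin (fun a b c => F a b 0 c 0) (fun a b c => EffGrav.p3 F a b 0 c 0)
      (fun a b c => EffGrav.p5 F a b 0 c 0) a b z c w := by
  have const : ∀ {f : ℝ → ℝ}, (∀ t, HasDerivAt f 0 t) → ∀ t, f t = f 0 := fun hf t =>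
    is_const_of_deriv_eq_zero (fun t => (hf t).differentiableAt) (fun t => (hf t).deriv) t 0
  have e3 : ∀ z w, EffGrav.p3 F a b z c w = EffGrav.p3 F a b 0 c 0 := fun z w =>
    (const (f := fun t => EffGrav.p3 F a b t c w)
      (fun t => (hF.p3.hasDerivAt_p3 ha).congr_deriv (h33 b t c w)) z).trans
      (const (f := fun t => EffGrav.p3 F a b 0 c t)
        (fun t => (hF.p3.hasDerivAt_p5 ha).congr_deriv (h53 b 0 c t)) w)
  have e5 : ∀ w, EffGrav.p5 F a b 0 c w = EffGrav.p5 F a b 0 c 0 :=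
    const fun t => (hF.p5.hasDerivAt_p5 ha).congr_deriv (h55 b 0 c t)
  have z1 := const (f := fun t => F a b t c w - EffGrav.p3 F a b 0 c 0 * t) (fun t => by
    refine ((hF.hasDerivAt_p3 (b := b) (z := t) (c := c) (w := w) ha).sub
      ((hasDerivAt_id t).const_mul (EffGrav.p3 F a b 0 c 0))).congr_deriv ?_
    rw [e3, mul_one, sub_self]) z
  have z2 := const (f := fun t => F a b 0 c t - EffGrav.p5 F a b 0 c 0 * t) (fun t => by
    refine ((hF.hasDerivAt_p5 (b := b) (z := 0) (c := c) (w := t) ha).sub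
      ((hasDerivAt_id t).const_mul (EffGrav.p5 F a b 0 c 0))).congr_deriv ?_
    rw [e5, mul_one, sub_self]) w
  simp only [lin]
  linear_combination z1 + z2

theorem Smooth5.restrict (hF : Smooth5 F) : Smooth3 fun a b c => F a b 0 c 0 :=
  ContDiffOn.comp (t := {q : ℝ × ℝ × ℝ × ℝ × ℝ | 0 < q.1}) hF
    (f := fun q : ℝ × ℝ × ℝ => (q.1, q.2.1, 0, q.2.2, 0)) (by fun_prop) fun _ hq => hq

variable {F' : ℝ → ℝ → ℝ → ℝ → ℝ → ℝ}

theorem p1_congr (h : ∀ a b z c w, 0 < a → F a b z c w = F' a b z c w) (ha : 0 < a) :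
    p1 F a b z c w = p1 F' a b z c w :=
  Filter.EventuallyEq.deriv_eq (Filter.eventuallyEq_of_mem (Ioi_mem_nhds ha)
    fun t ht => h t b z c w ht)
theorem p2_congr (h : ∀ a b z c w, 0 < a → F a b z c w = F' a b z c w) (ha : 0 < a) :
    p2 F a b z c w = p2 F' a b z c w := by
  simp only [p2, h a _ z c w ha]
theorem p3_congr (h : ∀ a b z c w, 0 < a → F a b z c w = F' a b z c w) (ha : 0 < a) :
    p3 F a b z c w = p3 F' a b z c w := by
  simp only [p3, h a b _ c w ha]
theorem p4_congr (h : ∀ a b z c w, 0 < a → F a b z c w = F' a b z c w) (ha : 0 < a) :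
    p4 F a b z c w = p4 F' a b z c w := by
  simp only [p4, h a b z _ w ha]
theorem p5_congr (h : ∀ a b z c w, 0 < a → F a b z c w = F' a b z c w) (ha : 0 < a) :
    p5 F a b z c w = p5 F' a b z c w := by
  simp only [p5, h a b z c _ ha]

theorem closU_congr (h : ∀ a b z c w, 0 < a → F a b z c w = F' a b z c w) (ha : 0 < a) :
    closU F a b z c w = closU F' a b z c w := by
  simp only [closU, p3_congr h ha, p5_congr h ha, p2_congr (fun _ _ _ _ _ ha => p3_congr h ha) ha,
    p2_congr (fun _ _ _ _ _ ha => p5_congr h ha) ha]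

theorem clos_congr (h : ∀ a b z c w, 0 < a → F a b z c w = F' a b z c w) (ha : 0 < a)
    (u v y : ℝ) : clos F a b z c w u v y = clos F' a b z c w u v y := by
  have h3 := fun a b z c w (ha : 0 < a) => p3_congr h (b := b) (z := z) (c := c) (w := w) ha
  have h5 := fun a b z c w (ha : 0 < a) => p5_congr h (b := b) (z := z) (c := c) (w := w) ha
  simp only [clos, p2_congr h ha, p3_congr h ha, p4_congr h ha, p5_congr h ha, p1_congr h3 ha,
    p2_congr h3 ha, p3_congr h3 ha, p4_congr h3 ha, p5_congr h3 ha, p1_congr h5 ha,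
    p2_congr h5 ha, p3_congr h5 ha, p4_congr h5 ha, p5_congr h5 ha]

end five

/-! ### From closure and covariance to coefficient equations -/

section closure

variable {F : ℝ → ℝ → ℝ → ℝ → ℝ → ℝ} {G : ℝ} {k : ℕ} {μ : Jet k → ℝ}

/-- The coefficient of v in closure; nothing on the right side depends on v. -/
theorem ClosedAlgebra.p3_minor (h : ClosedAlgebra G (heff F) μ) (hG : 0 < G) (hF : Smooth5 F)
    (hμ : ContDiffOn ℝ ∞ μ (admissible k)) {a : ℝ} (ha : 0 < a) (b z c w : ℝ) :
    p3 F a b z c w * p3 (p5 F) a b z c w = p5 F a b z c w * p3 (p3 F) a b z c w := by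
  have h0 := h.clos_half hG hF hμ ha b z c w 0 0
  have h1 := h.clos_half hG hF hμ ha b z c w 1 0
  simp only [clos] at h0 h1
  linear_combination (1 / 2) * (h1 - h0)

theorem ClosedAlgebra.p5_minor (h : ClosedAlgebra G (heff F) μ) (hG : 0 < G) (hF : Smooth5 F)
    (hμ : ContDiffOn ℝ ∞ μ (admissible k)) {a : ℝ} (ha : 0 < a) (b z c w : ℝ) :
    p3 F a b z c w * p5 (p5 F) a b z c w = p5 F a b z c w * p5 (p3 F) a b z c w := by
  have h0 := h.clos_half hG hF hμ ha b z c w 0 0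
  have h1 := h.clos_half hG hF hμ ha b z c w 0 1
  simp only [clos] at h0 h1
  linear_combination (1 / 2) * (h1 - h0)

/-- The first two relations of `cov_conditions` form a homogeneous linear system for ∂_3 μ and ∂_5 μ
whose determinant is a nonzero multiple of `closU F`. Cramer's rule applies where this is nonzero,
and density does the rest. -/
theorem muOf_indep (h : ClosedAlgebra G (heff F) μ) (hG : 0 < G) (hF : Smooth5 F)
    (hμ : ContDiffOn ℝ ∞ μ (admissible k))
    (hd : admissible k ⊆ closure {j ∈ admissible k | μ j ≠ 0})
    (hc : CovarianceConditions G (heff F) μ) {a : ℝ} (ha : 0 < a) (b z c w : ℝ) :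
    p3 (muOf G F) a b z c w = 0 ∧ p5 (muOf G F) a b z c w = 0 := by
  have key : ∀ a b z c w, 0 < a → closU F a b z c w ≠ 0 →
      p3 (muOf G F) a b z c w = 0 ∧ p5 (muOf G F) a b z c w = 0 := by
    intro a b z c w ha hne
    obtain ⟨e1, e2, -⟩ := cov_conditions h hG hF hμ hc ha b z c w
    rw [closU] at hne
    constructor <;> apply mul_left_cancel₀ hne
    · linear_combination 2 * p3 F a b z c w * e2 - 2 * p2 (p3 F) a b z c w * e1
    · linear_combination 2 * p5 F a b z c w * e2 - 2 * p2 (p5 F) a b z c w * e1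
  exact ⟨eq_zero_of_closU h hG hF hμ hd (smooth5_muOf G hF).p3
      (fun a b z c w ha hne => (key a b z c w ha hne).1) ha b z c w,
    eq_zero_of_closU h hG hF hμ hd (smooth5_muOf G hF).p5
      (fun a b z c w ha hne => (key a b z c w ha hne).2) ha b z c w⟩

/-- Since μ is a multiple of `closU F` at fixed s_1, the latter does not depend on s_3 or s_5. With
the v- and y-coefficients of closure, differentiated in s_2, this is the hypothesis of
`eq_zero_of_minors`. -/
theorem eq_lin_of_covariant (h : ClosedAlgebra G (heff F) μ) (hG : 0 < G) (hF : Smooth5 F)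
    (hμ : ContDiffOn ℝ ∞ μ (admissible k))
    (hd : admissible k ⊆ closure {j ∈ admissible k | μ j ≠ 0})
    (hc : CovarianceConditions G (heff F) μ) {a : ℝ} (ha : 0 < a) (b z c w : ℝ) :
    F a b z c w = lin (fun a b c => F a b 0 c 0) (fun a b c => p3 F a b 0 c 0)
      (fun a b c => p5 F a b 0 c 0) a b z c w := by
  have h3 : ∀ a b z c w, 0 < a → closU F a b z c w ≠ 0 → p3 (p3 F) a b z c w = 0 := by
    intro a b z c w ha hne
    have e := (muOf_indep h hG hF hμ hd hc ha b z c w).1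
    rw [p3_muOf, div_eq_zero_iff, or_iff_left ha.ne', mul_eq_zero,
      or_iff_right (pow_ne_zero 2 hG.ne'), p3_closU hF ha, mul_eq_zero,
      or_iff_right two_ne_zero] at e
    have hC : ∀ t, p3 F a t z c w * p3 (p5 F) a t z c w = p5 F a t z c w * p3 (p3 F) a t z c w :=
      fun t => h.p3_minor hG hF hμ ha t z c w
    have hC' := ((hF.p3.hasDerivAt_p2 (b := b) (z := z) (c := c) (w := w) ha).mul
      (hF.p5.p3.hasDerivAt_p2 ha)).unique (((hF.p5.hasDerivAt_p2 ha).mul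
      (hF.p3.p3.hasDerivAt_p2 ha)).congr_of_eventuallyEq (Filter.Eventually.of_forall hC))
    exact (eq_zero_of_minors (hC b) hC' e hne).1
  have h5 : ∀ a b z c w, 0 < a → closU F a b z c w ≠ 0 →
      p5 (p3 F) a b z c w = 0 ∧ p5 (p5 F) a b z c w = 0 := by
    intro a b z c w ha hne
    have e := (muOf_indep h hG hF hμ hd hc ha b z c w).2
    rw [p5_muOf, div_eq_zero_iff, or_iff_left ha.ne', mul_eq_zero,
      or_iff_right (pow_ne_zero 2 hG.ne'), p5_closU hF ha, mul_eq_zero,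
      or_iff_right two_ne_zero] at e
    have hC : ∀ t, p3 F a t z c w * p5 (p5 F) a t z c w = p5 F a t z c w * p5 (p3 F) a t z c w :=
      fun t => h.p5_minor hG hF hμ ha t z c w
    have hC' := ((hF.p3.hasDerivAt_p2 (b := b) (z := z) (c := c) (w := w) ha).mul
      (hF.p5.p5.hasDerivAt_p2 ha)).unique (((hF.p5.hasDerivAt_p2 ha).mul
      (hF.p3.p5.hasDerivAt_p2 ha)).congr_of_eventuallyEq (Filter.Eventually.of_forall hC))
    exact eq_zero_of_minors (hC b) hC' e hne
  exact hF.eq_lin (fun b z c w => eq_zero_of_closU h hG hF hμ hd hF.p3.p3 h3 ha b z c w)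
    (fun b z c w => eq_zero_of_closU h hG hF hμ hd hF.p3.p5
      (fun a b z c w ha hne => (h5 a b z c w ha hne).1) ha b z c w)
    (fun b z c w => eq_zero_of_closU h hG hF hμ hd hF.p5.p5
      (fun a b z c w ha hne => (h5 a b z c w ha hne).2) ha b z c w) ha

theorem closU_lin (f0 f3 f5 : ℝ → ℝ → ℝ → ℝ) (a b z c w : ℝ) :
    closU (lin f0 f3 f5) a b z c w
      = 2 * (f3 a b c * d2 f5 a b c - f5 a b c * d2 f3 a b c) := by
  simp only [closU, p3_lin, p5_lin]
  rfl

/-- The coefficient functions of a covariant model satisfy the closure equations. -/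
theorem exists_lin_of_covariant (h : ClosedAlgebra G (heff F) μ) (hG : 0 < G) (hF : Smooth5 F)
    (hμ : ContDiffOn ℝ ∞ μ (admissible k))
    (hd : admissible k ⊆ closure {j ∈ admissible k | μ j ≠ 0})
    (hc : CovarianceConditions G (heff F) μ) :
    ∃ f0 f3 f5 μ' : ℝ → ℝ → ℝ → ℝ, Smooth3 f0 ∧ Smooth3 f3 ∧ Smooth3 f5 ∧ Smooth3 μ' ∧
      (∀ a b z c w, 0 < a → F a b z c w = lin f0 f3 f5 a b z c w) ∧
      (∀ φ, IsPhasePoint φ → ∀ x, μ (jet k φ x)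
        = μ' (s1 (jet 2 φ x)) (s2 (jet 2 φ x)) (s4 (jet 2 φ x))) ∧
      (∀ a b c, 0 < a →
        a * μ' a b c = 2 * G ^ 2 * (f3 a b c * d2 f5 a b c - f5 a b c * d2 f3 a b c)) ∧
      (∀ a b c, 0 < a → c * d2 f5 a b c = 2 * d4 f3 a b c) ∧
      (∀ a b c, 0 < a → c * f5 a b c * d2 f0 a b c - 2 * f3 a b c * d4 f0 a b c
        + 2 * c * (f3 a b c * d1 f5 a b c - f5 a b c * d1 f3 a b c) = 0) ∧
      (∀ a b c, 0 < a → c * f5 a b c * d2 μ' a b c - 2 * f3 a b c * d4 μ' a b c = 0) := by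
  obtain ⟨f0, e0⟩ : ∃ f : ℝ → ℝ → ℝ → ℝ, f = fun a b c => F a b 0 c 0 := ⟨_, rfl⟩
  obtain ⟨f3, e3⟩ : ∃ f : ℝ → ℝ → ℝ → ℝ, f = fun a b c => p3 F a b 0 c 0 := ⟨_, rfl⟩
  obtain ⟨f5, e5⟩ : ∃ f : ℝ → ℝ → ℝ → ℝ, f = fun a b c => p5 F a b 0 c 0 := ⟨_, rfl⟩
  have h0 : Smooth3 f0 := e0 ▸ hF.restrict
  have h3 : Smooth3 f3 := e3 ▸ hF.p3.restrict
  have h5 : Smooth3 f5 := e5 ▸ hF.p5.restrict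
  have hl : ∀ a b z c w, 0 < a → F a b z c w = lin f0 f3 f5 a b z c w := fun a b z c w ha => by
    rw [e0, e3, e5]
    exact eq_lin_of_covariant h hG hF hμ hd hc ha b z c w
  have hU : ∀ a b z c w, 0 < a → closU F a b z c w
      = 2 * (f3 a b c * d2 f5 a b c - f5 a b c * d2 f3 a b c) := fun a b z c w ha =>
    (closU_congr hl ha).trans (closU_lin _ _ _ _ _ _ _ _)
  let μ' : ℝ → ℝ → ℝ → ℝ := fun a b c => muOf G F a b 0 c 0
  have hμ' : ∀ a b z c w, 0 < a → muOf G F a b z c w = μ' a b c := fun a b z c w ha => by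
    simp only [μ', muOf, hU _ _ _ _ _ ha]
  -- Closure at u = z c / 2 is affine in z and w; its three coefficients are f3 Q, f5 Q and the
  -- equation for f0, with Q = c ∂_2 f5 − 2 ∂_4 f3.
  have hcl : ∀ a b z c w, 0 < a → z * f3 a b c * (c * d2 f5 a b c - 2 * d4 f3 a b c)
      + w * f5 a b c * (c * d2 f5 a b c - 2 * d4 f3 a b c)
      + (c * f5 a b c * d2 f0 a b c - 2 * f3 a b c * d4 f0 a b c
        + 2 * c * (f3 a b c * d1 f5 a b c - f5 a b c * d1 f3 a b c)) = 0 := by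
    intro a b z c w ha
    have := h.clos_half hG hF hμ ha b z c w 0 0
    rw [clos_congr hl ha, clos_lin h0 h3 h5 ha] at this
    linear_combination this
  have hq : Smooth3 fun a b c => c * d2 f5 a b c - 2 * d4 f3 a b c :=
    Smooth3.sub (Smooth3.mul (M := fun _ _ c => c)
      (show ContDiffOn ℝ ∞ (fun q : ℝ × ℝ × ℝ => q.2.2) _ by fun_prop) h5.d2) (h3.d4.const_mul 2)
  refine ⟨f0, f3, f5, μ', h0, h3, h5, (smooth5_muOf G hF).restrict, hl, fun φ hφ x => ?_,
    fun a b c ha => ?_, fun a b c ha => ?_, fun a b c ha => ?_, fun a b c ha => ?_⟩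
  · rw [h.mu_eq hG hF hμ hφ x, along]
    exact hμ' _ _ _ _ _ (hφ.jet_mem 2 x).1
  · simp only [μ', muOf, hU _ _ _ _ _ ha]
    field_simp
  · refine sub_eq_zero.1 (eq_zero_of_closU h hG hF hμ hd hq.lift5 (fun a b z c w ha hne => ?_)
      ha b 0 c 0)
    have k0 := hcl a b 0 c 0 ha
    have k1 := hcl a b 1 c 0 ha
    have k2 := hcl a b 0 c 1 ha
    -- If Q ≠ 0 then f3 = f5 = 0, which contradicts the nonvanishing of the determinant.
    by_contra hx
    have z3 : f3 a b c = 0 := (mul_eq_zero.1 (by linear_combination k1 - k0)).resolve_right hx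
    have z5 : f5 a b c = 0 := (mul_eq_zero.1 (by linear_combination k2 - k0)).resolve_right hx
    apply hne
    rw [hU _ _ _ _ _ ha, z3, z5]
    ring
  · linear_combination hcl a b 0 c 0 ha
  · have hz := muOf_indep h hG hF hμ hd hc ha b 0 c 0
    have hcov := (cov_conditions h hG hF hμ hc ha b 0 c 0).2.2 hz.1 hz.2
    have e2 : p2 (muOf G F) a b 0 c 0 = d2 μ' a b c := rfl
    have e4 : p4 (muOf G F) a b 0 c 0 = d4 μ' a b c := rfl
    rw [e2, e4] at hcov
    rw [e3, e5]
    exact hcov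

end closure

end EffGrav

end

open scoped ContDiff

noncomputable section

namespace EffGrav

/-! ### Smooth primitives -/

/-- The derivative in x is bounded on the compact set of a closed ball times [0, 1], which supplies
the dominating constant. -/
theorem hasFDerivAt_integral {H E : Type*} [NormedAddCommGroup H] [NormedSpace ℝ H]
    [FiniteDimensional ℝ H] [NormedAddCommGroup E] [NormedSpace ℝ E] {f : H → ℝ → E}
    (hf : ContDiff ℝ ∞ fun p : H × ℝ => f p.1 p.2) (x : H) :
    HasFDerivAt (fun x => ∫ t in (0 : ℝ)..1, f x t)
      (∫ t in (0 : ℝ)..1, (fderiv ℝ (fun p : H × ℝ => f p.1 p.2) (x, t)).comp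
        (ContinuousLinearMap.inl ℝ H ℝ)) x := by
  have hd : ∀ x t, HasFDerivAt (fun x => f x t) ((fderiv ℝ (fun p : H × ℝ => f p.1 p.2) (x, t)).comp
      (ContinuousLinearMap.inl ℝ H ℝ)) x := fun x t =>
    HasFDerivAt.comp (g := fun p : H × ℝ => f p.1 p.2) (f := fun y : H => (y, t)) x
      (hf.differentiable (by simp) (x, t)).hasFDerivAt (hasFDerivAt_prodMk_left x t)
  have hc : Continuous fun p : H × ℝ => (fderiv ℝ (fun p : H × ℝ => f p.1 p.2) p).comp
      (ContinuousLinearMap.inl ℝ H ℝ) :=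
    (hf.continuous_fderiv (by simp)).clm_comp continuous_const
  have hft : ∀ x, Continuous (f x) := fun x => 
    hf.continuous.comp (by fun_prop : Continuous fun t : ℝ => (x, t))
  obtain ⟨C, hC⟩ := ((isCompact_closedBall x 1).prod (isCompact_Icc (a := (0 : ℝ)) (b := 1))
    ).exists_bound_of_continuousOn hc.continuousOn
  refine intervalIntegral.hasFDerivAt_integral_of_dominated_of_fderiv_le (bound := fun _ => C)
    (Metric.closedBall_mem_nhds x one_pos)
    (Filter.Eventually.of_forall fun y => (hft y).aestronglyMeasurable)
    ((hft x).intervalIntegrable _ _)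
    (hc.comp (by fun_prop : Continuous fun t : ℝ => (x, t))).aestronglyMeasurable
    (Filter.Eventually.of_forall fun t ht y hy => hC (y, t) ⟨hy, ?_⟩)
    intervalIntegrable_const (Filter.Eventually.of_forall fun t _ y _ => hd y t)
  rw [Set.uIoc_of_le zero_le_one] at ht
  exact Set.Ioc_subset_Icc_self ht

/-- The derivative is an integral of the same kind with values in `H →L[ℝ] E`, so the induction on
the order runs over all targets; a common universe keeps the new target admissible. -/
theorem contDiff_integral.{u} {H E : Type u} [NormedAddCommGroup H] [NormedSpace ℝ H]
    [FiniteDimensional ℝ H] [NormedAddCommGroup E] [NormedSpace ℝ E] {f : H → ℝ → E}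
    (hf : ContDiff ℝ ∞ fun p : H × ℝ => f p.1 p.2) :
    ContDiff ℝ ∞ fun x => ∫ t in (0 : ℝ)..1, f x t := by
  rw [contDiff_infty]
  intro n
  induction n generalizing E with
  | zero =>
    exact contDiff_zero.2 (continuous_iff_continuousAt.2 fun x =>
      (hasFDerivAt_integral hf x).continuousAt)
  | succ n ih =>
    rw [Nat.cast_add, Nat.cast_one]
    refine contDiff_succ_iff_fderiv.2 ⟨fun x => (hasFDerivAt_integral hf x).differentiableAt,
      fun h => absurd h (WithTop.natCast_ne_top n), ?_⟩
    rw [show fderiv ℝ (fun x => ∫ t in (0 : ℝ)..1, f x t) = _ from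
      funext fun x => (hasFDerivAt_integral hf x).fderiv]
    exact ih ((hf.fderiv_right (by simp)).clm_comp contDiff_const)

section three

variable {f : ℝ → ℝ → ℝ → ℝ} {a b c : ℝ}

/-- The primitive of `f` with respect to `s_2`. -/
def prim2 (f : ℝ → ℝ → ℝ → ℝ) (a b c : ℝ) : ℝ := ∫ t in (0 : ℝ)..b, f a t c

theorem smooth3_prim2 (hf : Smooth3 f) : Smooth3 (prim2 f) := by
  -- Two substitutions make the general result applicable: s_1 = exp p turns the half space into the
  -- whole space, and t = s b turns the variable endpoint into [0, 1].
  have h1 : ContDiff ℝ ∞ fun p : (ℝ × ℝ × ℝ) × ℝ =>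
      p.1.2.1 * f (Real.exp p.1.1) (p.2 * p.1.2.1) p.1.2.2 := by
    refine ContDiff.mul (by fun_prop) (contDiffOn_univ.1 ?_)
    exact ContDiffOn.comp (t := {q : ℝ × ℝ × ℝ | 0 < q.1}) hf
      (f := fun p : (ℝ × ℝ × ℝ) × ℝ => (Real.exp p.1.1, p.2 * p.1.2.1, p.1.2.2))
      (ContDiff.contDiffOn ((Real.contDiff_exp.comp (by fun_prop)).prodMk (by fun_prop)))
      fun _ _ => Real.exp_pos _
  have h2 := contDiff_integral
    (f := fun (p : ℝ × ℝ × ℝ) t => p.2.1 * f (Real.exp p.1) (t * p.2.1) p.2.2) h1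
  have h3 : ContDiffOn ℝ ∞ (fun q : ℝ × ℝ × ℝ => (Real.log q.1, q.2.1, q.2.2)) {q | 0 < q.1} :=
    (contDiffOn_fst.log fun _ hq => ne_of_gt hq).prodMk (by fun_prop)
  refine (h2.comp_contDiffOn h3).congr fun q hq => ?_
  simp only [prim2, Function.comp_apply, Real.exp_log hq, intervalIntegral.integral_const_mul,
    intervalIntegral.mul_integral_comp_mul_right (f := fun t => f q.1 t q.2.2), zero_mul, one_mul]

theorem d2_prim2 (hf : Smooth3 f) (ha : 0 < a) : d2 (prim2 f) a b c = f a b c :=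
  Continuous.deriv_integral (fun t => f a t c)
    (continuous_iff_continuousAt.2 fun _ => (hf.hasDerivAt_d2 ha).continuousAt) 0 b

end three

/-! ### The mass function -/

section three

variable (f : ℝ → ℝ → ℝ → ℝ) (a b c r : ℝ)

theorem d1_neg : d1 (fun a b c => -f a b c) a b c = -d1 f a b c := by simp [d1]
theorem d2_neg : d2 (fun a b c => -f a b c) a b c = -d2 f a b c := by simp [d2]
theorem d4_neg : d4 (fun a b c => -f a b c) a b c = -d4 f a b c := by simp [d4]
theorem d1_const_mul : d1 (fun a b c => r * f a b c) a b c = r * d1 f a b c := by simp [d1]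
theorem d2_const_mul : d2 (fun a b c => r * f a b c) a b c = r * d2 f a b c := by simp [d2]

end three

/-- A mass function with `∂_{s_2} M = -f3` and `∂_{s_4} M = -s_4 f5 / 2`. -/
theorem exists_mass {f3 f5 : ℝ → ℝ → ℝ → ℝ} (h3 : Smooth3 f3) (h5 : Smooth3 f5)
    (h : ∀ a b c, 0 < a → c * d2 f5 a b c = 2 * d4 f3 a b c) :
    ∃ M, Smooth3 M ∧ (∀ a b c, 0 < a → d2 M a b c = -f3 a b c) ∧
      ∀ a b c, 0 < a → d4 M a b c = c * (-(1 / 2) * f5 a b c) := by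
  -- M integrates the closed form first along s_4 on the line s_2 = 0 and then along s_2. Placing
  -- the integration variable in the second slot lets `prim2` serve for the s_4 integral too.
  let g : ℝ → ℝ → ℝ → ℝ := fun a b _ => b * f5 a 0 b
  have hg : Smooth3 g := Smooth3.mul (M := fun _ b _ => b)
    (show ContDiffOn ℝ ∞ (fun q : ℝ × ℝ × ℝ => q.2.1) _ by fun_prop)
    (ContDiffOn.comp (t := {q : ℝ × ℝ × ℝ | 0 < q.1}) h5
      (f := fun q : ℝ × ℝ × ℝ => (q.1, 0, q.2.1)) (by fun_prop) fun _ hq => hq)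
  have hI := smooth3_prim2 h3
  have hJ : Smooth3 fun a _ c => prim2 g a c 0 :=
    ContDiffOn.comp (t := {q : ℝ × ℝ × ℝ | 0 < q.1}) (smooth3_prim2 hg)
      (f := fun q : ℝ × ℝ × ℝ => (q.1, q.2.2, 0)) (by fun_prop) fun _ hq => hq
  let M : ℝ → ℝ → ℝ → ℝ := fun a b c => -prim2 f3 a b c - 1 / 2 * prim2 g a c 0
  have hM : Smooth3 M := hI.neg.sub (hJ.const_mul _)
  have e2 : ∀ a b c, 0 < a → d2 M a b c = -f3 a b c := fun a b c ha =>
    ((((hI.hasDerivAt_d2 ha).neg.sub_const _).congr_deriv (by rw [d2_prim2 h3 ha]))).deriv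
  refine ⟨M, hM, e2, fun a b c ha => ?_⟩
  have e0 : d4 M a 0 c = c * (-(1 / 2) * f5 a 0 c) := by
    have : HasDerivAt (fun t => M a 0 t) (-(1 / 2 * (c * f5 a 0 c))) c := by
      have := (((smooth3_prim2 hg).hasDerivAt_d2 (a := a) (b := c) (c := 0) ha).const_mul
        (1 / 2)).neg
      rw [d2_prim2 hg ha] at this
      have e : (fun t => M a 0 t) = -fun t => 1 / 2 * prim2 g a t 0 := by
        funext t
        simp [M, prim2]
      rw [e]
      exact this
    exact this.deriv.trans (by ring)
  -- The required formula for ∂_4 M holds at s_2 = 0, and the integrability condition makes the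
  -- discrepancy independent of s_2.
  have hz : ∀ t, HasDerivAt (fun t => d4 M a t c - c * (-(1 / 2) * f5 a t c)) 0 t := fun t => by
    refine ((hM.d4.hasDerivAt_d2 ha).sub (((h5.hasDerivAt_d2 ha).const_mul _).const_mul
      c)).congr_deriv ?_
    rw [hM.d2_d4 ha, d4_congr e2 ha, d4_neg]
    linear_combination (1 / 2) * h a t c ha
  have hconst := is_const_of_deriv_eq_zero (fun t => (hz t).differentiableAt)
    (fun t => (hz t).deriv) b 0
  simp only [e0, sub_self] at hconst
  exact sub_eq_zero.1 hconst

end EffGrav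

end

open scoped ContDiff

noncomputable section

namespace EffGrav

/-! ### The form of covariant models -/

/-- The coefficients f3, f5 are the partial derivatives of a mass function up to factors. In terms
of it the closure equation for f0 becomes the vanishing Jacobian of M and B, and the relations for μ
become the covariance equations. -/
theorem exists_massForm_of_covariant {F : ℝ → ℝ → ℝ → ℝ → ℝ → ℝ} {G : ℝ} {k : ℕ} {μ : Jet k → ℝ}
    (hG : 0 < G) (hF : Smooth5 F) (hμ : ContDiffOn ℝ ∞ μ (admissible k))
    (hd : admissible k ⊆ closure {j ∈ admissible k | μ j ≠ 0})
    (h : ClosedAlgebra G (heff F) μ) (hc : CovarianceConditions G (heff F) μ) :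
    ∃ M μ' P B : ℝ → ℝ → ℝ → ℝ, Smooth3 M ∧ Smooth3 μ' ∧ IsQuotient M P ∧ IsRTerm M B ∧
      (∀ φ, IsPhasePoint φ → ∀ x, μ (jet k φ x)
        = μ' (s1 (jet 2 φ x)) (s2 (jet 2 φ x)) (s4 (jet 2 φ x))) ∧
      CovarianceEquations G M μ' ∧
      ∀ a b z c w, 0 < a → F a b z c w = massForm M P B a b z c w := by
  obtain ⟨f0, f3, f5, μ', h0, h3, h5, hμ', hl, hm, e1, e2, e3, e4⟩ :=
    exists_lin_of_covariant h hG hF hμ hd hc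
  obtain ⟨M, hM, m2, m4⟩ := exists_mass h3 h5 e2
  have hP : IsQuotient M fun a b c => -(1 / 2) * f5 a b c := ⟨h5.const_mul _, m4⟩
  -- B is determined by f0 = −2 (∂_1 M + B).
  have hB : Smooth3 fun a b c => -(1 / 2) * f0 a b c - d1 M a b c := (h0.const_mul _).sub hM.d1
  refine ⟨M, μ', _, _, hM, hμ', hP, isRTerm_of_commute hM hB fun a b c ha => ?_, hm, ⟨?_, ?_⟩, ?_⟩
  · have b4 : d4 (fun a b c => -(1 / 2) * f0 a b c - d1 M a b c) a b c
        = -(1 / 2) * d4 f0 a b c - c * (-(1 / 2) * d1 f5 a b c) := by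
      have e : d4 (d1 M) a b c = c * (-(1 / 2) * d1 f5 a b c) := by
        rw [← hM.d1_d4 ha, hP.d1_d4 ha, d1_const_mul]
      rw [← e]
      exact (((h0.hasDerivAt_d4 ha).const_mul _).sub (hM.d1.hasDerivAt_d4 ha)).deriv
    have b2 : d2 (fun a b c => -(1 / 2) * f0 a b c - d1 M a b c) a b c
        = -(1 / 2) * d2 f0 a b c + d1 f3 a b c := by
      have e : d2 (d1 M) a b c = -d1 f3 a b c := by
        rw [← hM.d1_d2 ha, d1_congr m2 ha, d1_neg]
      rw [← sub_neg_eq_add, ← e]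
      exact (((h0.hasDerivAt_d2 ha).const_mul _).sub (hM.d1.hasDerivAt_d2 ha)).deriv
    rw [b4, b2, m2 a b c ha, m4 a b c ha]
    linear_combination (-1 / 4) * e3 a b c ha
  · intro a b c ha
    rw [hP.d2_d4 ha, d2_const_mul, d2_congr m2 ha,
      d2_neg, m2 a b c ha, m4 a b c ha, div_eq_iff (by positivity)]
    linear_combination c * e1 a b c ha
  · intro a b c ha
    rw [m2 a b c ha, m4 a b c ha]
    linear_combination (-1 / 2) * e4 a b c ha
  · intro a b z c w ha
    rw [hl a b z c w ha, massForm, m2 a b c ha, lin]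
    ring

end EffGrav

end

/-! ### The classification, its converse and the Dirac observable -/

theorem mainTheorem2 (G : ℝ) (hG : 0 < G) :
    -- every covariant closed model of the nondegenerate branch has the asserted form
    (∀ F : ℝ → ℝ → ℝ → ℝ → ℝ → ℝ, EffGrav.Smooth5 F →
      ∀ (k : ℕ) (μ : EffGrav.Jet k → ℝ),
        ContDiffOn ℝ ∞ μ (EffGrav.admissible k) →
        EffGrav.admissible k ⊆ closure {j ∈ EffGrav.admissible k | μ j ≠ 0} →
        EffGrav.ClosedAlgebra G (EffGrav.heff F) μ →
        EffGrav.CovarianceConditions G (EffGrav.heff F) μ →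
        ∃ M μ' P B : ℝ → ℝ → ℝ → ℝ,
          EffGrav.Smooth3 M ∧ EffGrav.Smooth3 μ' ∧
          EffGrav.IsQuotient M P ∧ EffGrav.IsRTerm M B ∧
          (∀ q ∈ EffGrav.regularSet M, ∃ V, q ∈ V ∧ EffGrav.IsLevelDomain M V) ∧
          (∀ φ, EffGrav.IsPhasePoint φ → ∀ x, μ (EffGrav.jet k φ x)
            = μ' (EffGrav.s1 (EffGrav.jet 2 φ x)) (EffGrav.s2 (EffGrav.jet 2 φ x))
                (EffGrav.s4 (EffGrav.jet 2 φ x))) ∧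
          EffGrav.CovarianceEquations G M μ' ∧
          (∀ a b z c w, 0 < a → F a b z c w = EffGrav.massForm M P B a b z c w)) ∧
    -- every solution of the covariance equations and every `R` give such a model
    (∀ M μ P : ℝ → ℝ → ℝ → ℝ, EffGrav.Smooth3 M → EffGrav.Smooth3 μ →
      EffGrav.IsQuotient M P → EffGrav.CovarianceEquations G M μ →
      (∀ B : ℝ → ℝ → ℝ → ℝ, EffGrav.IsRTerm M B →
        EffGrav.ClosedAlgebra G (EffGrav.heff (EffGrav.massForm M P B))
          (fun j : EffGrav.Jet 2 => μ (EffGrav.s1 j) (EffGrav.s2 j) (EffGrav.s4 j)) ∧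
        EffGrav.CovarianceConditions G (EffGrav.heff (EffGrav.massForm M P B))
          (fun j : EffGrav.Jet 2 => μ (EffGrav.s1 j) (EffGrav.s2 j) (EffGrav.s4 j))) ∧
      -- for `R = 0` the mass function is a Dirac observable
      EffGrav.IsDiracObservable G
        (EffGrav.heff (EffGrav.massForm M P fun _ _ _ => 0))
        (fun j : EffGrav.Jet 2 => M (EffGrav.s1 j) (EffGrav.s2 j) (EffGrav.s4 j))) := by
  refine ⟨fun F hF k μ hμ hd h hc => ?_, fun M μ P hM hμ hP hE => ⟨fun B hB => ?_, ?_⟩⟩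
  · obtain ⟨M, μ', P, B, hM, hμ', hP, hB, hm, hE, hl⟩ :=
      EffGrav.exists_massForm_of_covariant hG hF hμ hd h hc
    exact ⟨M, μ', P, B, hM, hμ', hP, hB, fun _ hq => EffGrav.exists_isLevelDomain hM hq, hm, hE, hl⟩
  · exact ⟨EffGrav.closedAlgebra_massForm hM hμ hP hB.1 hG hE fun a b c ha => hB.commute hM b c ha,
      EffGrav.covarianceConditions_massForm hM hμ hP hB.1 hE⟩
  · exact EffGrav.isDiracObservable_massForm hM hP hG
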